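/- All links are (oriented) non-split links in $S^3$. For a link $K$, let $c(K)$ be its crossing number, and let $\det(K)$ be its determinant, i.e. the order of the first homology group of the double cover of $S^3$ branched along $K$ (taken to be $0$ if the group is infinite). Let $V_K(t)=\sum_i a_i t^i$ be the Jones polynomial of $K$ (the exponents $i$ are integers or half-integers), let $d$ be its span, i.e. the difference between the highest and lowest degrees of its terms, and let $$\mu(K)=\frac{1}{d+1}\sum_i |a_i|$$ be the average of the absolute values of its coefficients. Let $v_8\approx 3.66386$ be the hyperbolic volume of the regular ideal octahedron. A sequence of links $K_n$ is called diagrammatically maximal if $c(K_n)\to\infty$ and $$\lim_{n\to\infty}\frac{2\pi\log\det(K_n)}{c(K_n)}=v_8 .$$ **Proposition.** If $(K_n)$ is any diagrammatically maximal sequence of alternating links, then $$\lim_{n\to\infty}\frac{2\pi\log\mu(K_n)}{c(K_n)}=v_8 .$$ -/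

import Mathlib

open Filter Topology LaurentPolynomial

/-!
Oriented links in `S³` are handled through oriented link diagrams on the sphere, up to the
Reidemeister moves.

A diagram has crossings `Fin n` and arcs-between-crossings ("edges") `Fin m`.  A strand of a
crossing is named by a `Bool`: `true` is the over-strand, `false` is the under-strand.  An end of
a strand is named by a `Bool`: `true` is the outgoing end, `false` is the incoming end.  A side of
an oriented edge or strand is named by a `Bool`: `true` is left, `false` is right.

At a positive crossing the direction of the over-strand, turned counterclockwise by a right angle,
is the direction of the under-strand; at a negative crossing it is the opposite direction.  So a
positive crossing whose over-strand points north has its under-strand pointing west, and a negative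
crossing whose over-strand points north has its under-strand pointing east.
-/

/-- Combinatorial data of an oriented link diagram on a closed oriented surface.  Edges that are
not attached to any crossing are crossingless circles. -/
structure LinkShadow where
  /-- the number of crossings -/
  n : ℕ
  /-- the number of edges, crossingless circles included -/
  m : ℕ
  /-- whether a crossing is positive -/
  pos : Fin n → Bool
  /-- `ends x s o` is the edge at the end `o` (out or in) of the strand `s` (over or under)
  of the crossing `x` -/
  ends : Fin n → Bool → Bool → Fin m
  /-- no edge is attached twice by its terminal end, or twice by its initial end -/
  ends_injective : ∀ o : Bool, Function.Injective fun p : Fin n × Bool => ends p.1 p.2 o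
  /-- an edge is attached by its initial end if and only if it is attached by its terminal end -/
  ends_range : Set.range (fun p : Fin n × Bool => ends p.1 p.2 true) =
    Set.range (fun p : Fin n × Bool => ends p.1 p.2 false)

namespace LinkShadow

/-- At the crossing `x`, the quadrant between the end `o` of the over-strand and the end `u` of the
under-strand lies on the side `l` of the over-strand and on the side `k` of the under-strand. -/
def IsCorner (D : LinkShadow) (x : Fin D.n) (o l u k : Bool) : Prop :=
  u = (l == D.pos x) ∧ k = (o != D.pos x)

/-- Two sides of edges that meet in a quadrant of a crossing. -/
def SideAdj (D : LinkShadow) (a b : Fin D.m × Bool) : Prop :=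
  ∃ (x : Fin D.n) (o u : Bool), D.IsCorner x o a.2 u b.2 ∧
    a.1 = D.ends x true o ∧ b.1 = D.ends x false u

/-- The number of complementary regions, where the regions of the connected pieces of the
projection are counted separately (each piece being drawn on a surface of its own). -/
noncomputable def regions (D : LinkShadow) : ℕ := Nat.card (Quot D.SideAdj)

/-- Two edges that are attached to a common crossing. -/
def EdgeAdj (D : LinkShadow) (e f : Fin D.m) : Prop :=
  ∃ (x : Fin D.n) (s o s' o' : Bool), e = D.ends x s o ∧ f = D.ends x s' o'

/-- The number of connected pieces of the projection. -/
noncomputable def pieces (D : LinkShadow) : ℕ := Nat.card (Quot D.EdgeAdj)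

end LinkShadow

/-- An oriented link diagram on the sphere.  The field `planar` says that the Euler characteristic
of each connected piece is that of the sphere: a connected piece with `v > 0` crossings has `2 v`
edges, so it is planar if and only if it has `v + 2` regions, and fewer otherwise; a crossingless
circle has `2` regions. -/
structure LinkDiagram extends LinkShadow where
  planar : toLinkShadow.regions = n + 2 * toLinkShadow.pieces

namespace LinkDiagram

/-- `D'` is obtained from `D` by forgetting the crossings in `S`: both strands of such a crossing
are joined up straight through it, the other crossings stay as they are, up to renaming of
crossings and edges.  For `S = ∅` this says that `D` and `D'` are isomorphic. -/
def IsForget (D : LinkDiagram) (S : Set (Fin D.n)) (D' : LinkDiagram) : Prop :=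
  ∃ (f : Fin D'.n → Fin D.n) (g : Fin D.m → Fin D'.m),
    Function.Injective f ∧ Set.range f = Sᶜ ∧ Function.Surjective g ∧
    (∀ e e' : Fin D.m, g e = g e' ↔ Relation.EqvGen
      (fun a b => ∃ x ∈ S, ∃ s : Bool, a = D.ends x s false ∧ b = D.ends x s true) e e') ∧
    (∀ x, D'.pos x = D.pos (f x)) ∧
    (∀ x s o, D'.ends x s o = g (D.ends (f x) s o))

/-- The first Reidemeister move, removing a kink. -/
def IsR1 (D D' : LinkDiagram) : Prop :=
  ∃ (x : Fin D.n) (s : Bool), D.ends x s true = D.ends x (!s) false ∧ D.IsForget {x} D'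

/-- The second Reidemeister move, removing two crossings `x`, `y` of opposite signs that are
consecutive on the over-strand and consecutive (in one order or the other) on the under-strand.
Because of the signs the two edges bound a bigon. -/
def IsR2 (D D' : LinkDiagram) : Prop :=
  ∃ x y : Fin D.n, D.pos x = !D.pos y ∧
    D.ends x true true = D.ends y true false ∧
    (D.ends x false true = D.ends y false false ∨ D.ends y false true = D.ends x false false) ∧
    D.IsForget {x, y} D'

/-- In the third Reidemeister move the top strand passes over the crossings `a` and `b`, the middle
strand passes under `a` and over `c`, and the bottom strand passes under `b` and `c`.  The move
exchanges `a` and `b` on the top strand, `a` and `c` on the middle strand, and `b` and `c` on the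
bottom strand. -/
def r3Swap {n : ℕ} (a b c : Fin n) : Equiv.Perm (Fin n × Bool) :=
  Equiv.swap (a, true) (b, true) * Equiv.swap (a, false) (c, true) *
    Equiv.swap (b, false) (c, false)

/-- The third Reidemeister move.  The edges `ab` on the top strand, `ac` on the middle strand and
`bc` on the bottom strand bound a triangular region, which lies on the side `lt`, `lm`, `lb` of
these edges; `dt`, `dm`, `db` tell whether these edges are directed from `a` to `b`, from `a` to
`c`, and from `b` to `c`. -/
def IsR3 (D D' : LinkDiagram) : Prop :=
  ∃ a b c : Fin D.n, a ≠ b ∧ a ≠ c ∧ b ≠ c ∧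
    (∃ dt dm db lt lm lb : Bool,
      D.ends a true dt = D.ends b true (!dt) ∧
      D.ends a false dm = D.ends c true (!dm) ∧
      D.ends b false db = D.ends c false (!db) ∧
      D.IsCorner a dt lt dm lm ∧
      D.IsCorner b (!dt) lt db lb ∧
      D.IsCorner c (!dm) lm (!db) lb) ∧
    ∃ (hn : D'.n = D.n) (hm : D'.m = D.m),
      (∀ x, D'.pos x = D.pos (Fin.cast hn x)) ∧
      (∀ x s o, Fin.cast hm (D'.ends x s o) =
        D.ends (r3Swap a b c (Fin.cast hn x, s)).1 (r3Swap a b c (Fin.cast hn x, s)).2 o)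

/-- Two diagrams that differ by an isomorphism or by one Reidemeister move. -/
def Step (D D' : LinkDiagram) : Prop :=
  D.IsForget ∅ D' ∨ D.IsR1 D' ∨ D.IsR2 D' ∨ D.IsR3 D'

/-- Two diagrams represent the same oriented link: they are related by a finite sequence of
isomorphisms and of Reidemeister moves and their inverses. -/
def SameLink (D D' : LinkDiagram) : Prop := Relation.EqvGen Step D D'

/-- The crossing number `c(K)` of the link `K` represented by `D`: the least number of crossings
in a diagram of `K`. -/
noncomputable def crossingNumber (D : LinkDiagram) : ℕ :=
  sInf {k | ∃ D' : LinkDiagram, D.SameLink D' ∧ D'.n = k}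

/-- The link represented by `D` is non-split: all its diagrams are connected. -/
def IsNonsplit (D : LinkDiagram) : Prop :=
  ∀ D' : LinkDiagram, D.SameLink D' → D'.pieces = 1

/-- A diagram is alternating if each edge leads from an over-strand to an under-strand or from an
under-strand to an over-strand. -/
def IsAlternatingDiagram (D : LinkDiagram) : Prop :=
  ∀ (x : Fin D.n) (s : Bool) (y : Fin D.n) (t : Bool),
    D.ends x s true = D.ends y t false → t = !s

/-- The link represented by `D` is alternating: it has an alternating diagram. -/
def IsAlternatingLink (D : LinkDiagram) : Prop :=
  ∃ D' : LinkDiagram, D.SameLink D' ∧ D'.IsAlternatingDiagram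

/-! ### The determinant -/

/-- The relation vectors of the colouring matrix, in `ℤ^edges`: at each crossing
`over-in = over-out`, and `under-in + under-out = 2 · over`. -/
def colouringRelations (D : LinkDiagram) : Set (Fin D.m → ℤ) :=
  {v | ∃ x : Fin D.n,
    v = Pi.single (D.ends x true false) 1 - Pi.single (D.ends x true true) 1 ∨
    v = Pi.single (D.ends x false false) 1 + Pi.single (D.ends x false true) 1
      - 2 • Pi.single (D.ends x true true) 1}

/-- The vectors in `ℤ^edges` whose coordinates add up to zero. -/
def zeroSum (D : LinkDiagram) : AddSubgroup (Fin D.m → ℤ) where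
  carrier := {v | ∑ e, v e = 0}
  zero_mem' := by simp
  add_mem' := by
    intro a b ha hb
    simp only [Set.mem_ofPred_eq, Pi.add_apply, Finset.sum_add_distrib] at *
    simp [ha, hb]
  neg_mem' := by
    intro a ha
    simp only [Set.mem_ofPred_eq, Pi.neg_apply, Finset.sum_neg_distrib] at *
    simp [ha]

/-- The determinant of the link represented by `D`: the order (`0` if infinite) of the group of
zero-sum vectors modulo the colouring relations.  This group is the first homology group of the
double cover of `S³` branched along the link, and its order is the absolute value of a first minor
of the colouring matrix, i.e. of the Alexander matrix at `t = -1`. -/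
noncomputable def det (D : LinkDiagram) : ℕ :=
  (AddSubgroup.closure D.colouringRelations).relIndex D.zeroSum

/-! ### The Jones polynomial -/

/-- A state of the Kauffman bracket chooses the A-smoothing (`true`) or the B-smoothing (`false`)
at each crossing.  The A-smoothing joins the two quadrants that the over-strand sweeps out when it
turns counterclockwise; at a positive crossing it joins the outgoing end of each strand to the
incoming end of the other, at a negative crossing it joins the two outgoing ends, and the two
incoming ends. -/
def SmoothAdj (D : LinkDiagram) (σ : Fin D.n → Bool) (e f : Fin D.m) : Prop :=
  ∃ (x : Fin D.n) (o : Bool), e = D.ends x true o ∧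
    f = D.ends x false (if σ x then o != D.pos x else o == D.pos x)

/-- The number of circles of a state. -/
noncomputable def loops (D : LinkDiagram) (σ : Fin D.n → Bool) : ℕ :=
  Nat.card (Quot (D.SmoothAdj σ))

/-- The Kauffman bracket, a Laurent polynomial in the variable `A`, with value `1` on a
crossingless circle. -/
noncomputable def bracket (D : LinkDiagram) : ℤ[T;T⁻¹] :=
  ∑ σ : Fin D.n → Bool,
    T (∑ x, if σ x then 1 else -1) * (-T 2 - T (-2)) ^ (D.loops σ - 1)

/-- The writhe. -/
def writhe (D : LinkDiagram) : ℤ := ∑ x, if D.pos x then 1 else -1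

/-- The Jones polynomial `V(t) = (-A³)^(-w) ⟨D⟩` at `A = t^(-1/4)`, as a finitely supported
function from exponents of `t` in `ℚ` to coefficients. -/
noncomputable def jones (D : LinkDiagram) : AddMonoidAlgebra ℤ ℚ :=
  AddMonoidAlgebra.mapDomain (fun k : ℤ => -(k : ℚ) / 4)
    ((D.writhe.negOnePow : ℤ) • (T (-3 * D.writhe) * D.bracket))

/-- The span of the Jones polynomial: highest degree minus lowest degree. -/
noncomputable def jonesSpan (D : LinkDiagram) : ℝ :=
  sSup ((fun q : ℚ => (q : ℝ)) '' (D.jones.coeff.support : Set ℚ)) -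
    sInf ((fun q : ℚ => (q : ℝ)) '' (D.jones.coeff.support : Set ℚ))

/-- The average `μ` of the absolute values of the coefficients of the Jones polynomial. -/
noncomputable def mu (D : LinkDiagram) : ℝ :=
  (1 / (D.jonesSpan + 1)) * ∑ q ∈ D.jones.coeff.support, |(D.jones.coeff q : ℝ)|

end LinkDiagram

/-- The volume of the regular ideal octahedron in hyperbolic 3-space.  In the projective (Klein)
model, the open unit ball with volume form `(1 - |x|²)⁻² dx`, the regular ideal octahedron is the
convex hull of the six points `± eᵢ` of the unit sphere. -/
noncomputable def v8 : ℝ :=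
  ∫ x in convexHull ℝ {v : EuclideanSpace ℝ (Fin 3) |
      ∃ i, v = EuclideanSpace.single i 1 ∨ v = -EuclideanSpace.single i 1},
    ((1 - ‖x‖ ^ 2) ^ 2)⁻¹

/-- A sequence of links, given by diagrams, is diagrammatically maximal if the crossing numbers
tend to infinity and the determinant densities tend to `v8`. -/
def IsDiagrammaticallyMaximal (K : ℕ → LinkDiagram) : Prop :=
  Tendsto (fun n => (K n).crossingNumber) atTop atTop ∧
  Tendsto (fun n => 2 * Real.pi * Real.log ((K n).det : ℝ) / ((K n).crossingNumber : ℝ))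
    atTop (𝓝 v8)

/-! For a non-split alternating link with positive crossing number `c`, the absolute values of the
Jones coefficients add up exactly to the determinant, and the span of the Jones polynomial lies
between `0` and `5 c`. Hence `log μ` and `log det` differ by at most `log (5 c + 1)`, which is
negligible against `c`, and the two densities have the same limit. The value of `v8` plays no role.

The identity `∑ |aᵢ| = det` is proved on a connected alternating diagram. This suffices because both
sides are invariant under Reidemeister moves (`jones_of_sameLink`, `det_of_sameLink`). On such a
diagram both sides count the states with a single circle, that is, the spanning trees of a
checkerboard graph.

For the Jones polynomial, take the circles of the all-B state as vertices and the crossings as edges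
of a graph. Planarity expresses the number of circles of any state by the rank function of this
graph (`loops_eq_crossingRank`), so the bracket is a rank generating sum. By deletion and
contraction its coefficients alternate in sign in a way that excludes cancellation, so the
coefficient norm obeys the recursion of the number of bases (`isAlternatingFrom_rankSum`).

For the determinant, an alternating diagram orients the circles of all states coherently, from
over-ends to under-ends, so a state is a permutation `P` of the edges. The determinant of `1 - P`
plus one diagonal unit is `1` if `P` is a single cycle and `0` otherwise
(`det_one_sub_perm_add_single`). Summed over the states, these determinants merge by multilinearity
into one, whose rows generate the colouring relations and one unit vector (`exists_matrix_det_eq`).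

The bound on the span is a crude degree count in a minimal diagram, which need not be alternating.
Sharp facts about crossing numbers of alternating diagrams are therefore not needed. -/

/-! ### Counting the classes of an equivalence relation -/

namespace Setoid

variable {E E' : Type*}

/-- The number of classes of an equivalence relation. -/
noncomputable def classCount (r : Setoid E) : ℕ := Nat.card (Quotient r)

/-- The smallest equivalence relation that relates `a` and `b`. -/
def pair (a b : E) : Setoid E := Relation.EqvGen.setoid fun x y => x = a ∧ y = b

theorem pair_le_iff {a b : E} {s : Setoid E} : pair a b ≤ s ↔ s a b := by
  refine ⟨fun h => h (Relation.EqvGen.rel _ _ ⟨rfl, rfl⟩), fun h => eqvGen_le ?_⟩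
  rintro x y ⟨rfl, rfl⟩
  exact h

theorem pair_le {a b : E} {s : Setoid E} :
    pair a b ≤ s ↔ (Quotient.mk s a) = (Quotient.mk s b) :=
  pair_le_iff.trans Quotient.eq.symm

theorem pair_comm (a b : E) : pair a b = pair b a :=
  eq_of_forall_ge_iff fun s => by simp only [pair_le, eq_comm]

theorem sup_pair_of_rel {r : Setoid E} {a b : E} (h : r a b) : r ⊔ pair a b = r :=
  sup_eq_left.2 (pair_le_iff.2 h)

open Classical in
/-- Joining the class of `b` to the class of `a`. -/
theorem sup_pair_eq_ker (r : Setoid E) (a b : E) :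
    r ⊔ pair a b = ker fun x => if r x b then Quotient.mk r a else Quotient.mk r x := by
  apply le_antisymm
  · refine sup_le (fun {x y} h => ?_) (pair_le_iff.2 ?_)
    · have : r x b ↔ r y b := ⟨r.trans' (r.symm' h), r.trans' h⟩
      simp only [ker_def, this, Quotient.sound h]
    · simp [ker_def]
  · have key : ∀ x, Quotient.mk (r ⊔ pair a b) x = map_of_le (le_sup_left : r ≤ r ⊔ pair a b)
        (if r x b then Quotient.mk r a else Quotient.mk r x) := by
      intro x
      split_ifs with hx
      · have h1 : (r ⊔ pair a b) x b := (le_sup_left : r ≤ r ⊔ pair a b) hx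
        have h2 : (r ⊔ pair a b) a b := pair_le_iff.1 le_sup_right
        exact Quotient.sound (trans' _ h1 (symm' _ h2))
      · rfl
    intro x y h
    rw [ker_def] at h
    exact Quotient.exact ((key x).trans ((congrArg _ h).trans (key y).symm))

open Classical in
-- By `sup_pair_eq_ker`, the new classes correspond to the range of a map into the old ones that
-- misses exactly the class of `b`.
theorem classCount_sup_pair [Finite E] {r : Setoid E} {a b : E} (h : ¬ r a b) :
    (r ⊔ pair a b).classCount + 1 = r.classCount := by
  have : Set.range (fun x => if r x b then Quotient.mk r a else Quotient.mk r x) =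
      {Quotient.mk r b}ᶜ := by
    ext q
    simp only [Set.mem_range, Set.mem_compl_iff, Set.mem_singleton_iff]
    constructor
    · rintro ⟨x, rfl⟩
      split_ifs with hx
      · exact fun h' => h (Quotient.exact h')
      · exact fun h' => hx (Quotient.exact h')
    · induction q using Quotient.inductionOn with | _ x => ?_
      intro hx
      exact ⟨x, if_neg fun h' => hx (Quotient.sound h')⟩
  have hf : Finite (Quotient r) := inferInstance
  rw [classCount, classCount, sup_pair_eq_ker, Nat.card_congr (quotientKerEquivRange _), this,
    Nat.card_coe_set_eq, ← Set.ncard_add_ncard_compl {Quotient.mk r b}, Set.ncard_singleton,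
    add_comm]

theorem classCount_pos [Finite E] [Nonempty E] (r : Setoid E) : 0 < r.classCount := by
  have : Nonempty (Quotient r) := ⟨Quotient.mk r (Classical.arbitrary E)⟩
  exact Nat.card_pos

theorem classCount_le [Finite E] (r : Setoid E) : r.classCount ≤ Nat.card E :=
  Nat.card_le_card_of_surjective _ Quotient.mk_surjective

theorem classCount_sup_pair_le [Finite E] (r : Setoid E) (a b : E) :
    (r ⊔ pair a b).classCount ≤ r.classCount ∧ r.classCount ≤ (r ⊔ pair a b).classCount + 1 := by
  by_cases h : r a b
  · rw [sup_pair_of_rel h]; omega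
  · have := classCount_sup_pair h; omega

theorem classCount_comap {g : E → E'} (hg : Function.Surjective g) (s : Setoid E') :
    (comap g s).classCount = s.classCount := by
  rw [classCount, classCount, Nat.card_congr (comapQuotientEquiv g s)]
  rw [Set.range_eq_univ.2 (Quotient.mk_surjective.comp hg), Nat.card_univ]

theorem card_quot (r : E → E → Prop) :
    Nat.card (Quot r) = (Relation.EqvGen.setoid r).classCount := by
  refine Nat.card_congr ⟨Quot.lift (Quotient.mk _) fun a b h => Quotient.sound
      (Relation.EqvGen.rel _ _ h), Quotient.lift (Quot.mk r) fun a b h => ?_, ?_, ?_⟩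
  · exact Quot.eqvGen_sound h
  · rintro ⟨x⟩; rfl
  · rintro ⟨x⟩; rfl

/-- The element `p` is related to no other element. -/
def Isolated (r : Setoid E) (p : E) : Prop := r ≤ ker fun x => x = p

theorem Isolated.not_rel {r : Setoid E} {p a : E} (h : r.Isolated p) (ha : a ≠ p) : ¬ r p a := by
  intro h'
  have : (p = p) = (a = p) := h h'
  simp_all

theorem Isolated.sup_pair {r : Setoid E} {p a b : E} (h : r.Isolated p) (ha : a ≠ p)
    (hb : b ≠ p) : (r ⊔ pair a b).Isolated p :=
  sup_le h (pair_le_iff.2 (by simp [ker_def, ha, hb]))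

theorem Isolated.classCount [Finite E] {r : Setoid E} {p a : E} (h : r.Isolated p) (ha : a ≠ p) :
    (r ⊔ pair p a).classCount + 1 = r.classCount :=
  classCount_sup_pair (h.not_rel ha)

/-- Used with `g` the map that merges the edges of a diagram when crossings are forgotten: circles
of the small diagram are then counted among the edges of the large one, with the merged edges
joined. -/
theorem comap_iSup_pair (g : E → E') {κ : Type*} (a b : κ → E) :
    comap g (⨆ i, pair (g (a i)) (g (b i))) = (⨆ i, pair (a i) (b i)) ⊔ ker g := by
  apply le_antisymm
  · have h1 : ker g ≤ (⨆ i, pair (a i) (b i)) ⊔ ker g := le_sup_right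
    have h2 := comap_map_of_ker_le g _ h1
    rw [← h2]
    have h3 : (⨆ i, pair (g (a i)) (g (b i))) ≤ ((⨆ i, pair (a i) (b i)) ⊔ ker g).map g := by
      refine iSup_le fun i => pair_le_iff.2 ?_
      have : comap g (((⨆ i, pair (a i) (b i)) ⊔ ker g).map g) (a i) (b i) := by
        rw [h2]
        exact (le_sup_left : _ ≤ (⨆ i, pair (a i) (b i)) ⊔ ker g)
          (pair_le_iff.1 (le_iSup (fun i => pair (a i) (b i)) i))
      exact this
    exact fun {x y} h => h3 h
  · refine sup_le (iSup_le fun i => pair_le_iff.2 ?_) fun {x y} h => ?_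
    · have := pair_le_iff.1 (le_iSup (fun i => pair (g (a i)) (g (b i))) i)
      exact this
    · rw [comap_rel, show g x = g y from h]

end Setoid

open Setoid

theorem iSup_fin_two' {L : Type*} [CompleteLattice L] (F : Fin 2 → L) : ⨆ k, F k = F 0 ⊔ F 1 :=
  eq_of_forall_ge_iff fun s => by simp

theorem iSup_fin_three' {L : Type*} [CompleteLattice L] (F : Fin 3 → L) :
    ⨆ k, F k = F 0 ⊔ F 1 ⊔ F 2 :=
  eq_of_forall_ge_iff fun s => by simp [and_assoc]

/-! ### State sums -/

/-- The state sum in which the smoothings of the crossing `x` join ends by `C x`. -/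
noncomputable def stateSum {ι E : Type*} [Fintype ι] [DecidableEq ι]
    (C : ι → Bool → Setoid E) : ℤ[T;T⁻¹] :=
  ∑ σ : ι → Bool, T (∑ x, if σ x then 1 else -1) *
    (-T 2 - T (-2)) ^ ((⨆ x, C x (σ x)).classCount - 1)

/-- Here `h` lists the crossings taking part in a move and `f` the others. For each outer state `τ`
a move becomes a comparison of two short local sums. -/
theorem stateSum_split {ι ι' κ E : Type*} [Fintype ι] [DecidableEq ι] [Fintype ι'] [DecidableEq ι']
    [Fintype κ] [DecidableEq κ] (C : ι → Bool → Setoid E) (f : ι' → ι) (h : κ → ι)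
    (hf : Function.Bijective (Sum.elim f h)) :
    stateSum C = ∑ τ : ι' → Bool, T (∑ x, if τ x then 1 else -1) *
      ∑ β : κ → Bool, T (∑ x, if β x then 1 else -1) *
        (-T 2 - T (-2)) ^
          (((⨆ x, C (f x) (τ x)) ⊔ ⨆ k, C (h k) (β k)).classCount - 1) := by
  let e : ι' ⊕ κ ≃ ι := Equiv.ofBijective _ hf
  simp_rw [Finset.mul_sum]
  rw [← Fintype.sum_prod_type', stateSum]
  refine Fintype.sum_equiv ((Equiv.arrowCongr e.symm (Equiv.refl Bool)).trans
    (Equiv.sumArrowEquivProdArrow ι' κ Bool)) _ _ fun σ => ?_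
  have h1 : (∑ x, if σ x then (1 : ℤ) else -1) = (∑ x, if σ (f x) then 1 else -1) +
      ∑ x, if σ (h x) then 1 else -1 := by
    rw [← e.sum_comp, Fintype.sum_sum_type]
    rfl
  have h2 : (⨆ x, C x (σ x)) = (⨆ x, C (f x) (σ (f x))) ⊔ ⨆ k, C (h k) (σ (h k)) := by
    rw [← e.iSup_comp (g := fun x => C x (σ x)), iSup_sum]
    rfl
  rw [h1, h2, T_add, mul_assoc]
  rfl

theorem sum_fin_one_bool {M : Type*} [AddCommMonoid M] (F : (Fin 1 → Bool) → M) :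
    ∑ β, F β = F ![true] + F ![false] := by
  rw [show (Finset.univ : Finset (Fin 1 → Bool)) = {![true], ![false]} by decide]
  simp

theorem sum_fin_two_bool {M : Type*} [AddCommMonoid M] (F : (Fin 2 → Bool) → M) :
    ∑ β, F β = F ![true, true] + F ![true, false] + F ![false, true] + F ![false, false] := by
  rw [show (Finset.univ : Finset (Fin 2 → Bool)) =
    {![true, true], ![true, false], ![false, true], ![false, false]} by decide]
  rw [Finset.sum_insert (by decide), Finset.sum_insert (by decide), Finset.sum_insert (by decide),
    Finset.sum_singleton]
  simp only [add_assoc]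

theorem sum_fin_three_bool {M : Type*} [AddCommMonoid M] (F : (Fin 3 → Bool) → M) :
    ∑ β, F β = F ![true, true, true] + F ![true, true, false] + F ![true, false, true] +
      F ![true, false, false] + F ![false, true, true] + F ![false, true, false] +
      F ![false, false, true] + F ![false, false, false] := by
  rw [show (Finset.univ : Finset (Fin 3 → Bool)) =
    {![true, true, true], ![true, true, false], ![true, false, true], ![true, false, false],
     ![false, true, true], ![false, true, false], ![false, false, true], ![false, false, false]}
    by decide]
  rw [Finset.sum_insert (by decide), Finset.sum_insert (by decide), Finset.sum_insert (by decide),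
    Finset.sum_insert (by decide), Finset.sum_insert (by decide), Finset.sum_insert (by decide),
    Finset.sum_insert (by decide), Finset.sum_singleton]
  simp only [add_assoc]

theorem T_mul_T (a b : ℤ) : (T a * T b : ℤ[T;T⁻¹]) = T (a + b) := (T_add a b).symm

/-! ### State-sum identities behind the Reidemeister moves -/

section LocalMoves

variable {E : Type*} [Finite E]

/-- The kink edge `p` is touched by nothing else, so when the strand bypasses it, it is a circle of
its own. -/
theorem classCount_kink {r : Setoid E} {p i o : E} (hp : r.Isolated p) (hi : i ≠ p) (ho : o ≠ p) :
    (r ⊔ pair i o).classCount = (r ⊔ (pair i p ⊔ pair p o)).classCount + 1 := by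
  have h1 : r ⊔ (pair i p ⊔ pair p o) = r ⊔ pair i o ⊔ pair p i :=
    eq_of_forall_ge_iff fun s => by simp only [sup_le_iff, pair_le]; grind
  rw [h1, (hp.sup_pair hi ho).classCount hi]

theorem Setoid.Isolated.classCount_two {r : Setoid E} {p q a b : E} (hp : r.Isolated p)
    (hq : r.Isolated q) (hpq : p ≠ q) (hap : a ≠ p) (haq : a ≠ q) (hbq : b ≠ q) :
    (r ⊔ pair p a ⊔ pair q b).classCount + 2 = r.classCount := by
  have h1 := hp.classCount hap
  have h2 := (hq.sup_pair hpq haq).classCount hbq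
  omega

theorem Setoid.Isolated.classCount_three {r : Setoid E} {p q s a b c : E} (hp : r.Isolated p)
    (hq : r.Isolated q) (hs : r.Isolated s) (hpq : p ≠ q) (hps : p ≠ s) (hqs : q ≠ s) (hap : a ≠ p)
    (haq : a ≠ q) (has : a ≠ s) (hbq : b ≠ q) (hbs : b ≠ s) (hcs : c ≠ s) :
    (r ⊔ pair p a ⊔ pair q b ⊔ pair s c).classCount + 3 = r.classCount := by
  have h1 := hp.classCount_two hq hpq hap haq hbq
  have h2 := ((hs.sup_pair hps has).sup_pair hqs hbs).classCount hcs
  omega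

/-- The bigon edges `p`, `q` occur in no join of `r`. Of the four states, three join the outer ends
as `a b`, `c d`, one of these having the bigon as an extra circle. The fourth joins `a c`, `b d`, as
the straight strands do. -/
theorem classCount_bigon {r : Setoid E} {p q a b c d : E} (hp : r.Isolated p) (hq : r.Isolated q)
    (hpq : p ≠ q) (hap : a ≠ p) (hbp : b ≠ p) (hcp : c ≠ p) (hdp : d ≠ p)
    (haq : a ≠ q) (hbq : b ≠ q) (hcq : c ≠ q) (hdq : d ≠ q) :
    (r ⊔ ((pair p q ⊔ pair a b) ⊔ (pair p q ⊔ pair c d))).classCount =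
      (r ⊔ ((pair p q ⊔ pair a b) ⊔ (pair p d ⊔ pair c q))).classCount + 1 ∧
    (r ⊔ ((pair p b ⊔ pair a q) ⊔ (pair p q ⊔ pair c d))).classCount =
      (r ⊔ ((pair p q ⊔ pair a b) ⊔ (pair p d ⊔ pair c q))).classCount ∧
    (r ⊔ ((pair p b ⊔ pair a q) ⊔ (pair p d ⊔ pair c q))).classCount =
      (r ⊔ ((pair a p ⊔ pair b q) ⊔ (pair p c ⊔ pair q d))).classCount := by
  have h : (r ⊔ pair a b ⊔ pair c d).Isolated p := (hp.sup_pair hap hbp).sup_pair hcp hdp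
  have h' : (r ⊔ pair a b ⊔ pair c d).Isolated q := (hq.sup_pair haq hbq).sup_pair hcq hdq
  have k : (r ⊔ pair b d ⊔ pair a c).Isolated p := (hp.sup_pair hbp hdp).sup_pair hap hcp
  have k' : (r ⊔ pair b d ⊔ pair a c).Isolated q := (hq.sup_pair hbq hdq).sup_pair haq hcq
  have e1 := h.classCount hpq.symm
  have e2 := h.classCount_two h' hpq hdp hdq hdq
  have e3 := h.classCount_two h' hpq hap haq haq
  have e4 := k.classCount_two k' hpq hbp hbq haq
  have e5 := k.classCount_two k' hpq hap haq hbq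
  rw [show r ⊔ pair a b ⊔ pair c d ⊔ pair p q =
    r ⊔ ((pair p q ⊔ pair a b) ⊔ (pair p q ⊔ pair c d)) from
    eq_of_forall_ge_iff fun s => by simp only [sup_le_iff, pair_le]; grind] at e1
  rw [show r ⊔ pair a b ⊔ pair c d ⊔ pair p d ⊔ pair q d =
    r ⊔ ((pair p q ⊔ pair a b) ⊔ (pair p d ⊔ pair c q)) from
    eq_of_forall_ge_iff fun s => by simp only [sup_le_iff, pair_le]; grind] at e2
  rw [show r ⊔ pair a b ⊔ pair c d ⊔ pair p a ⊔ pair q a =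
    r ⊔ ((pair p b ⊔ pair a q) ⊔ (pair p q ⊔ pair c d)) from
    eq_of_forall_ge_iff fun s => by simp only [sup_le_iff, pair_le]; grind] at e3
  rw [show r ⊔ pair b d ⊔ pair a c ⊔ pair p b ⊔ pair q a =
    r ⊔ ((pair p b ⊔ pair a q) ⊔ (pair p d ⊔ pair c q)) from
    eq_of_forall_ge_iff fun s => by simp only [sup_le_iff, pair_le]; grind] at e4
  rw [show r ⊔ pair b d ⊔ pair a c ⊔ pair p a ⊔ pair q b =
    r ⊔ ((pair a p ⊔ pair b q) ⊔ (pair p c ⊔ pair q d)) from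
    eq_of_forall_ge_iff fun s => by simp only [sup_le_iff, pair_le]; grind] at e5
  omega

/-- Over-ends `p`, `a` and under-ends `q`, `b` of a crossing, joined as `p q`, `a b` or as
`p b`, `a q`. -/
def joinEnds (p a q b : E) (s : Bool) : Setoid E :=
  if s then pair p q ⊔ pair a b else pair p b ⊔ pair a q

/-- The sides `x`, `y`, `z` of the triangle are absent from `r`, so a state matters only through the
pairing it induces on the six outer ends. Four states induce the same pairing, and the first of
these has the triangle as an extra circle, whence the `2` in place of `3`. -/
theorem classCount_triangle {r : Setoid E} {x y z ta tb ma mc bb bc : E} (hx : r.Isolated x)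
    (hy : r.Isolated y) (hz : r.Isolated z) (hxy : x ≠ y) (hxz : x ≠ z) (hyz : y ≠ z)
    (hne : ∀ e ∈ [ta, tb, ma, mc, bb, bc], e ≠ x ∧ e ≠ y ∧ e ≠ z) :
    let S (i j k : Bool) := (r ⊔ (joinEnds x ta y ma i ⊔ joinEnds x tb z bb j ⊔
      joinEnds y mc z bc k)).classCount
    let P (a b c d e f : E) := (r ⊔ pair a b ⊔ pair c d ⊔ pair e f).classCount
    S true true true + 2 = P ta ma tb bb mc bc ∧
    S true true false + 3 = P ta ma tb bb mc bc ∧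
    S true false true + 3 = P ta ma tb bb mc bc ∧
    S false true true + 3 = P ta ma tb bb mc bc ∧
    S false false false + 3 = P tb mc ta bc ma bb ∧
    S true false false + 3 = P ta ma tb mc bb bc ∧
    S false true false + 3 = P ta bc tb bb ma mc ∧
    S false false true + 3 = P ta tb mc bc ma bb := by
  simp only [List.mem_cons, List.not_mem_nil, or_false, forall_eq_or_imp, forall_eq] at hne
  obtain ⟨⟨_, _, _⟩, ⟨_, _, _⟩, ⟨_, _, _⟩, ⟨_, _, _⟩, ⟨_, _, _⟩, ⟨_, _, _⟩⟩ := hne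
  intro S P
  have iso {w a b c d e f : E} (hw : r.Isolated w) (h1 : a ≠ w) (h2 : b ≠ w) (h3 : c ≠ w)
      (h4 : d ≠ w) (h5 : e ≠ w) (h6 : f ≠ w) :
      (r ⊔ pair a b ⊔ pair c d ⊔ pair e f).Isolated w :=
    ((hw.sup_pair h1 h2).sup_pair h3 h4).sup_pair h5 h6
  have key {a b c d e f u v w : E} {R : Setoid E}
      (h1 : a ≠ x ∧ a ≠ y ∧ a ≠ z) (h2 : b ≠ x ∧ b ≠ y ∧ b ≠ z) (h3 : c ≠ x ∧ c ≠ y ∧ c ≠ z)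
      (h4 : d ≠ x ∧ d ≠ y ∧ d ≠ z) (h5 : e ≠ x ∧ e ≠ y ∧ e ≠ z) (h6 : f ≠ x ∧ f ≠ y ∧ f ≠ z)
      (hu : u ≠ x ∧ u ≠ y ∧ u ≠ z) (hv : v ≠ x ∧ v ≠ y ∧ v ≠ z) (hw : w ≠ x ∧ w ≠ y ∧ w ≠ z)
      (hR : R = r ⊔ pair a b ⊔ pair c d ⊔ pair e f ⊔ pair x u ⊔ pair y v ⊔ pair z w) :
      R.classCount + 3 = P a b c d e f := by
    rw [hR]
    exact (iso hx h1.1 h2.1 h3.1 h4.1 h5.1 h6.1).classCount_three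
      (iso hy h1.2.1 h2.2.1 h3.2.1 h4.2.1 h5.2.1 h6.2.1)
      (iso hz h1.2.2 h2.2.2 h3.2.2 h4.2.2 h5.2.2 h6.2.2) hxy hxz hyz
      hu.1 hu.2.1 hu.2.2 hv.2.1 hv.2.2 hw.2.2
  refine ⟨?_, ?_, ?_, ?_, ?_, ?_, ?_, ?_⟩
  · have h := (iso hx ‹ta ≠ x› ‹ma ≠ x› ‹tb ≠ x› ‹bb ≠ x› ‹mc ≠ x› ‹bc ≠ x›).classCount_two
      (iso hy ‹ta ≠ y› ‹ma ≠ y› ‹tb ≠ y› ‹bb ≠ y› ‹mc ≠ y› ‹bc ≠ y›) hxy hxz.symm hyz.symm hyz.symm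
    refine Eq.trans (congrArg (fun R => classCount R + 2) ?_) h
    exact eq_of_forall_ge_iff fun s => by simp only [joinEnds, if_true, sup_le_iff, pair_le]; grind
  · refine key (u := bc) (v := bc) (w := bc) ?_ ?_ ?_ ?_ ?_ ?_ ?_ ?_ ?_ ?_
    rotate_right
    · exact eq_of_forall_ge_iff fun s => by
        simp only [joinEnds, if_true, Bool.false_eq_true, if_false, sup_le_iff, pair_le]; grind
    all_goals exact ⟨‹_›, ‹_›, ‹_›⟩
  · refine key (u := bb) (v := bb) (w := bb) ?_ ?_ ?_ ?_ ?_ ?_ ?_ ?_ ?_ ?_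
    rotate_right
    · exact eq_of_forall_ge_iff fun s => by
        simp only [joinEnds, if_true, Bool.false_eq_true, if_false, sup_le_iff, pair_le]; grind
    all_goals exact ⟨‹_›, ‹_›, ‹_›⟩
  · refine key (u := ma) (v := ma) (w := ma) ?_ ?_ ?_ ?_ ?_ ?_ ?_ ?_ ?_ ?_
    rotate_right
    · exact eq_of_forall_ge_iff fun s => by
        simp only [joinEnds, if_true, Bool.false_eq_true, if_false, sup_le_iff, pair_le]; grind
    all_goals exact ⟨‹_›, ‹_›, ‹_›⟩
  · refine key (u := ma) (v := ta) (w := tb) ?_ ?_ ?_ ?_ ?_ ?_ ?_ ?_ ?_ ?_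
    rotate_right
    · exact eq_of_forall_ge_iff fun s => by
        simp only [joinEnds, Bool.false_eq_true, if_false, sup_le_iff, pair_le]; grind
    all_goals exact ⟨‹_›, ‹_›, ‹_›⟩
  · refine key (u := bb) (v := bb) (w := tb) ?_ ?_ ?_ ?_ ?_ ?_ ?_ ?_ ?_ ?_
    rotate_right
    · exact eq_of_forall_ge_iff fun s => by
        simp only [joinEnds, if_true, Bool.false_eq_true, if_false, sup_le_iff, pair_le]; grind
    all_goals exact ⟨‹_›, ‹_›, ‹_›⟩
  · refine key (u := ma) (v := ta) (w := ma) ?_ ?_ ?_ ?_ ?_ ?_ ?_ ?_ ?_ ?_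
    rotate_right
    · exact eq_of_forall_ge_iff fun s => by
        simp only [joinEnds, if_true, Bool.false_eq_true, if_false, sup_le_iff, pair_le]; grind
    all_goals exact ⟨‹_›, ‹_›, ‹_›⟩
  · refine key (u := ma) (v := ta) (w := ta) ?_ ?_ ?_ ?_ ?_ ?_ ?_ ?_ ?_ ?_
    rotate_right
    · exact eq_of_forall_ge_iff fun s => by
        simp only [joinEnds, if_true, Bool.false_eq_true, if_false, sup_le_iff, pair_le]; grind
    all_goals exact ⟨‹_›, ‹_›, ‹_›⟩

end LocalMoves

/-- Any over-end and under-end may serve as reference, `θ` being the smoothing that joins them. This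
spares the moves a case distinction over signs and orientations. -/
theorem pair_sup_pair_eq_joinEnds {E : Type*} (v w : Bool → E) (p o u θ b : Bool)
    (hθ : θ = (u == (o != p))) :
    pair (v true) (w (if b then true != p else true == p)) ⊔
      pair (v false) (w (if b then false != p else false == p)) =
    joinEnds (v o) (v !o) (w u) (w !u) (b == θ) := by
  subst hθ
  unfold joinEnds
  cases o <;> cases u <;> cases b <;> cases p <;> simp [sup_comm]

/-! ### Invariance of the Jones polynomial under Reidemeister moves -/

namespace LinkDiagram

/-- The joins made by a smoothing of the crossing `x`. -/
def smoothing (D : LinkDiagram) (x : Fin D.n) (b : Bool) : Setoid (Fin D.m) :=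
  pair (D.ends x true true) (D.ends x false (if b then true != D.pos x else true == D.pos x)) ⊔
  pair (D.ends x true false) (D.ends x false (if b then false != D.pos x else false == D.pos x))

theorem smoothing_eq (D : LinkDiagram) (x : Fin D.n) (o u θ b : Bool)
    (hθ : θ = (u == (o != D.pos x))) :
    D.smoothing x b = joinEnds (D.ends x true o) (D.ends x true (!o)) (D.ends x false u)
      (D.ends x false (!u)) (b == θ) :=
  pair_sup_pair_eq_joinEnds _ _ _ o u θ b hθ

theorem eqvGen_smoothAdj (D : LinkDiagram) (σ : Fin D.n → Bool) :
    Relation.EqvGen.setoid (D.SmoothAdj σ) = ⨆ x, D.smoothing x (σ x) := by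
  refine eq_of_forall_ge_iff fun s => ?_
  simp only [iSup_le_iff, smoothing, sup_le_iff, pair_le_iff]
  constructor
  · intro h x
    exact ⟨h (Relation.EqvGen.rel _ _ ⟨x, true, rfl, rfl⟩),
      h (Relation.EqvGen.rel _ _ ⟨x, false, rfl, rfl⟩)⟩
  · intro h
    refine eqvGen_le ?_
    rintro _ _ ⟨x, o, rfl, rfl⟩
    cases o
    · exact (h x).2
    · exact (h x).1

theorem loops_eq (D : LinkDiagram) (σ : Fin D.n → Bool) :
    D.loops σ = (⨆ x, D.smoothing x (σ x)).classCount := by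
  rw [loops, card_quot, eqvGen_smoothAdj]

theorem bracket_eq_stateSum (D : LinkDiagram) : D.bracket = stateSum D.smoothing := by
  simp only [bracket, stateSum, loops_eq]

/-- The joins straight through the crossing `x`. -/
def straight (D : LinkDiagram) (x : Fin D.n) : Setoid (Fin D.m) :=
  pair (D.ends x true false) (D.ends x true true) ⊔
  pair (D.ends x false false) (D.ends x false true)

theorem ends_eq_iff (D : LinkDiagram) {x y : Fin D.n} {s t o : Bool} :
    D.ends x s o = D.ends y t o ↔ x = y ∧ s = t := by
  refine ⟨fun h => ?_, by rintro ⟨rfl, rfl⟩; rfl⟩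
  have := @D.ends_injective o (x, s) (y, t) h
  simpa using this

/-- The data of an isomorphism or of the removal of crossings. -/
theorem IsForget.bracket_eq {D D' : LinkDiagram} {k : ℕ} {h : Fin k → Fin D.n}
    (hh : Function.Injective h) {S : Set (Fin D.n)} (hS : Set.range h = S)
    (H : D.IsForget S D') :
    ∃ f : Fin D'.n → Fin D.n, Function.Bijective (Sum.elim f h) ∧ (∀ x, D'.pos x = D.pos (f x)) ∧
      D'.bracket = ∑ τ : Fin D'.n → Bool, T (∑ x, if τ x then 1 else -1) *
        (-T 2 - T (-2)) ^ (((⨆ x, D.smoothing (f x) (τ x)) ⊔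
          ⨆ j, D.straight (h j)).classCount - 1) := by
  obtain ⟨f, g, hf, hfr, hg, hgk, hpos, hends⟩ := H
  refine ⟨f, ⟨?_, ?_⟩, hpos, ?_⟩
  · refine hf.sumElim hh fun a b hab => ?_
    have : f a ∈ Sᶜ := hfr ▸ ⟨a, rfl⟩
    exact this (hS ▸ ⟨b, hab.symm⟩)
  · rw [← Set.range_eq_univ, Set.Sum.elim_range, hfr, hS, Set.compl_union_self]
  · rw [bracket_eq_stateSum, stateSum]
    refine Finset.sum_congr rfl fun τ _ => ?_
    congr 3
    have hk : ker g = ⨆ j, D.straight (h j) := by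
      refine eq_of_forall_ge_iff fun s => ?_
      simp only [iSup_le_iff, straight, sup_le_iff, pair_le_iff]
      constructor
      · intro hs j
        have hj : h j ∈ S := hS ▸ ⟨j, rfl⟩
        exact ⟨hs ((hgk _ _).2 (.rel _ _ ⟨h j, hj, true, rfl, rfl⟩)),
          hs ((hgk _ _).2 (.rel _ _ ⟨h j, hj, false, rfl, rfl⟩))⟩
      · intro hs x y hxy
        have : Relation.EqvGen.setoid
          (fun a b => ∃ x ∈ S, ∃ s : Bool, a = D.ends x s false ∧ b = D.ends x s true) ≤ s := by
          refine eqvGen_le ?_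
          rintro _ _ ⟨x, hx, t, rfl, rfl⟩
          obtain ⟨j, rfl⟩ := hS ▸ hx
          cases t
          · exact (hs j).2
          · exact (hs j).1
        exact this ((hgk _ _).1 hxy)
    rw [← hk, ← classCount_comap hg]
    have := comap_iSup_pair g
      (fun p : Fin D'.n × Bool => D.ends (f p.1) true p.2)
      (fun p : Fin D'.n × Bool => D.ends (f p.1) false
        (if τ p.1 then p.2 != D.pos (f p.1) else p.2 == D.pos (f p.1)))
    simp only [iSup_prod, iSup_bool_eq] at this
    simp only [smoothing, hpos, hends]
    rw [this]

/-- By `ends_injective` an edge has at most one initial and one terminal attachment. Here these are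
at `x` and `y`, so no other crossing meets it. -/
theorem isolated_smoothing (D : LinkDiagram) {x y z : Fin D.n} {s t b : Bool} {e : Fin D.m}
    (hx : e = D.ends x s true) (hy : e = D.ends y t false) (hzx : z ≠ x) (hzy : z ≠ y) :
    (D.smoothing z b).Isolated e := by
  have key : ∀ u o, D.ends z u o ≠ e := by
    intro u o h
    cases o
    · exact hzy (D.ends_eq_iff.1 (h.trans hy)).1
    · exact hzx (D.ends_eq_iff.1 (h.trans hx)).1
  refine sup_le ?_ ?_ <;> exact pair_le_iff.2 (by simp [Setoid.ker_def, key])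

theorem isolated_iSup (D : LinkDiagram) {ι : Type*} {f : ι → Fin D.n} {τ : ι → Bool}
    {x y : Fin D.n} {s t : Bool} {e : Fin D.m}
    (hx : e = D.ends x s true) (hy : e = D.ends y t false) (hfx : ∀ i, f i ≠ x)
    (hfy : ∀ i, f i ≠ y) : (⨆ i, D.smoothing (f i) (τ i)).Isolated e :=
  iSup_le fun i => D.isolated_smoothing hx hy (hfx i) (hfy i)

theorem writhe_eq (D : LinkDiagram) {ι κ : Type*} [Fintype ι] [Fintype κ] {f : ι → Fin D.n}
    {h : κ → Fin D.n} (hfh : Function.Bijective (Sum.elim f h)) :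
    D.writhe = (∑ i, if D.pos (f i) then 1 else -1) + ∑ j, if D.pos (h j) then 1 else -1 := by
  rw [writhe, ← (Equiv.ofBijective _ hfh).sum_comp, Fintype.sum_sum_type]
  rfl

/-- The Jones polynomial in the variable `A`. -/
noncomputable def framedBracket (D : LinkDiagram) : ℤ[T;T⁻¹] :=
  (D.writhe.negOnePow : ℤ) • (T (-3 * D.writhe) * D.bracket)

theorem framedBracket_of_isForget_empty {D D' : LinkDiagram} (H : D.IsForget ∅ D') :
    D.framedBracket = D'.framedBracket := by
  obtain ⟨f, hf, hpos, hb⟩ := H.bracket_eq (k := 0) (h := Fin.elim0) (fun a => a.elim0) (by simp)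
  have hw : D.writhe = D'.writhe := by
    rw [D.writhe_eq hf, writhe]
    simp [hpos]
  rw [framedBracket, framedBracket, hw, hb, bracket_eq_stateSum, stateSum_split _ _ _ hf]
  simp

theorem not_mem_of_bijective {ι κ α : Type*} {f : ι → α} {h : κ → α}
    (hfh : Function.Bijective (Sum.elim f h)) (i : ι) (j : κ) : f i ≠ h j := fun e =>
  Sum.inl_ne_inr (hfh.1 (show Sum.elim f h (.inl i) = Sum.elim f h (.inr j) from e))

theorem framedBracket_of_isR1 {D D' : LinkDiagram} (H : D.IsR1 D') :
    D.framedBracket = D'.framedBracket := by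
  obtain ⟨x, s, hx, H⟩ := H
  obtain ⟨f, hf, hpos, hb⟩ := H.bracket_eq (k := 1) (h := fun _ => x)
    (fun a b _ => Subsingleton.elim a b) (by simp)
  have hne : ∀ i, f i ≠ x := fun i => not_mem_of_bijective hf i 0
  have : Nonempty (Fin D.m) := ⟨D.ends x s true⟩
  have hw : D.writhe = D'.writhe + if D.pos x then 1 else -1 := by
    rw [D.writhe_eq hf, writhe]
    simp [hpos]
  -- A kink multiplies the bracket by `-A^(±3)`, which the writhe factor compensates.
  have hb' : D.bracket = -T (if D.pos x then 3 else -3) * D'.bracket := by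
    rw [hb, bracket_eq_stateSum, stateSum_split _ _ _ hf, Finset.mul_sum]
    refine Finset.sum_congr rfl fun τ _ => ?_
    rw [mul_left_comm]
    congr 1
    have hp := D.isolated_iSup (τ := τ) (x := x) (y := x) rfl hx hne hne
    have hi : D.ends x s false ≠ D.ends x s true := by
      rw [hx, Ne, D.ends_eq_iff]; simp
    have ho : D.ends x (!s) true ≠ D.ends x s true := by
      rw [Ne, D.ends_eq_iff]; simp
    have hc := classCount_kink hp hi ho
    have hst : (⨆ _ : Fin 1, D.straight x) = pair (D.ends x s false) (D.ends x s true) ⊔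
        pair (D.ends x s true) (D.ends x (!s) true) := by
      simp only [ciSup_const, straight]
      cases s
      · rw [hx, sup_comm]; rfl
      · rw [hx]; rfl
    -- The smoothing that respects orientations is A at a positive and B at a negative crossing. It
    -- cuts the kink off as a circle, and the other smoothing passes through it.
    have hJ : D.smoothing x (D.pos x) = pair (D.ends x s false) (D.ends x (!s) true) := by
      rw [D.smoothing_eq x true false (D.pos x) (D.pos x) (by simp)]
      cases s <;> simp only [Bool.not_true, Bool.not_false] at hx ⊢ <;>
      exact eq_of_forall_ge_iff fun s => by
        simp only [joinEnds, beq_self_eq_true, if_true, sup_le_iff, pair_le]; grind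
    have hN : D.smoothing x (!D.pos x) = pair (D.ends x s false) (D.ends x s true) ⊔
        pair (D.ends x s true) (D.ends x (!s) true) := by
      rw [D.smoothing_eq x true false (D.pos x) (!D.pos x) (by simp)]
      cases s <;> simp only [Bool.not_true, Bool.not_false] at hx ⊢ <;>
      exact eq_of_forall_ge_iff fun s => by
        simp only [joinEnds, Bool.not_beq_self, Bool.false_eq_true, if_false, sup_le_iff,
          pair_le]; grind
    have hpos := classCount_pos ((⨆ i, D.smoothing (f i) (τ i)) ⊔
      (pair (D.ends x s false) (D.ends x s true) ⊔ pair (D.ends x s true) (D.ends x (!s) true)))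
    rw [sum_fin_one_bool, hst]
    obtain ⟨c, hc'⟩ := Nat.exists_eq_add_of_lt hpos
    rw [← hN] at hc hc'
    rw [← hJ] at hc
    rw [← hN]
    simp only [ciSup_unique, Matrix.cons_val_fin_one, Finset.univ_unique, Finset.sum_singleton]
    cases hpx : D.pos x <;>
    · simp only [hpx, Bool.not_false, Bool.not_true, if_true, Bool.false_eq_true, if_false] at *
      rw [hc, hc']
      simp only [zero_add, add_tsub_cancel_right, pow_succ]
      rw [← sub_eq_zero]
      ring_nf
      simp only [T_mul_T]
      norm_num
  rw [framedBracket, framedBracket, hw, hb', Int.negOnePow_add, mul_add, T_add]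
  have hT : (T 3 * T (-3) : ℤ[T;T⁻¹]) = 1 := by rw [T_mul_T]; exact T_zero
  cases D.pos x
  · simp only [Bool.false_eq_true, if_false, Int.negOnePow_neg, Int.negOnePow_one, Units.val_neg,
      zsmul_eq_mul, Int.cast_neg, mul_neg, mul_one, neg_neg]
    linear_combination ((D'.writhe.negOnePow : ℤ) : ℤ[T;T⁻¹]) * T (-3 * D'.writhe) * D'.bracket * hT
  · simp only [if_true, Int.negOnePow_one, Units.val_mul,
      Units.val_neg, Units.val_one, zsmul_eq_mul, Int.cast_mul, Int.cast_neg, Int.cast_one, mul_one]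
    linear_combination ((D'.writhe.negOnePow : ℤ) : ℤ[T;T⁻¹]) * T (-3 * D'.writhe) * D'.bracket * hT

theorem framedBracket_of_isR2 {D D' : LinkDiagram} (H : D.IsR2 D') :
    D.framedBracket = D'.framedBracket := by
  obtain ⟨x, y, hxy, ho, hu, H⟩ := H
  have hne : x ≠ y := by rintro rfl; simp at hxy
  obtain ⟨f, hf, hpos, hb⟩ := H.bracket_eq (k := 2) (h := ![x, y])
    (by
      intro a b
      fin_cases a <;> fin_cases b <;> simp [hne, hne.symm]) (by simp [Set.pair_comm])
  have hfx : ∀ i, f i ≠ x := fun i => not_mem_of_bijective hf i 0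
  have hfy : ∀ i, f i ≠ y := fun i => not_mem_of_bijective hf i 1
  have : Nonempty (Fin D.m) := ⟨D.ends x true true⟩
  have hw : D.writhe = D'.writhe := by
    rw [D.writhe_eq hf, writhe]
    cases hpy : D.pos y <;> simp [hpos, hxy, hpy]
  have hb' : D.bracket = D'.bracket := by
    rw [hb, bracket_eq_stateSum, stateSum_split _ _ _ hf]
    refine Finset.sum_congr rfl fun τ _ => ?_
    congr 1
    obtain ⟨v, hv⟩ : ∃ v, D.ends x false v = D.ends y false (!v) := by
      rcases hu with h | h
      · exact ⟨true, h⟩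
      · exact ⟨false, h.symm⟩
    have hp := D.isolated_iSup (τ := τ) rfl ho hfx hfy
    have hq : (⨆ i, D.smoothing (f i) (τ i)).Isolated (D.ends x false v) := by
      cases v
      · exact D.isolated_iSup hv rfl hfy hfx
      · exact D.isolated_iSup rfl hv hfx hfy
    have hpq : D.ends x true true ≠ D.ends x false v := by
      cases v
      · rw [hv, Ne, Bool.not_false, D.ends_eq_iff]; simp
      · rw [Ne, D.ends_eq_iff]; simp
    have hc := classCount_bigon hp hq hpq (a := D.ends x true false) (b := D.ends x false !v)
      (c := D.ends y true true) (d := D.ends y false v)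
      (by rw [ho, Ne, D.ends_eq_iff]; simp [hne])
      (by cases v <;> simp only [Bool.not_false, Bool.not_true]
          · rw [Ne, D.ends_eq_iff]; simp
          · rw [ho, Ne, D.ends_eq_iff]; simp)
      (by rw [Ne, D.ends_eq_iff]; simp [hne.symm])
      (by cases v 
          · rw [ho, Ne, D.ends_eq_iff]; simp
          · rw [Ne, D.ends_eq_iff]; simp)
      (by cases v 
          · rw [Ne, D.ends_eq_iff]; simp
          · rw [hv, Ne, Bool.not_true, D.ends_eq_iff]; simp [hne])
      (by cases v <;> rw [hv, Ne, D.ends_eq_iff] <;> simp [hne])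
      (by cases v 
          · rw [hv, Ne, Bool.not_false, D.ends_eq_iff]; simp
          · rw [Ne, D.ends_eq_iff]; simp)
      (by cases v <;> rw [Ne, D.ends_eq_iff] <;> simp [hne.symm])
    set r := ⨆ i, D.smoothing (f i) (τ i)
    set θ := (v == (true != D.pos x)) with hθ
    have hx (b) := D.smoothing_eq x true v θ b hθ
    have hy (b) := D.smoothing_eq y false (!v) (!θ) b (by
      rw [hθ, hxy]; cases v <;> cases D.pos y <;> rfl)
    rw [← ho, ← hv, Bool.not_not] at hy
    have hst : (⨆ j : Fin 2, D.straight (![x, y] j)) =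
        ((pair (D.ends x true false) (D.ends x true true) ⊔
          pair (D.ends x false !v) (D.ends x false v)) ⊔
         (pair (D.ends x true true) (D.ends y true true) ⊔
          pair (D.ends x false v) (D.ends y false v))) := by
      rw [iSup_fin_two']
      simp only [straight, Matrix.cons_val_zero, Matrix.cons_val_one]
      cases v <;> simp only [Bool.not_true, Bool.not_false] at hv ⊢ <;>
      exact eq_of_forall_ge_iff fun s => by simp only [sup_le_iff, pair_le]; grind
    rw [sum_fin_two_bool, hst]
    simp only [iSup_fin_two', Fin.sum_univ_two, Matrix.cons_val_zero, Matrix.cons_val_one, hx, hy]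
    have hpos := classCount_pos (r ⊔ ((pair (D.ends x true true) (D.ends x false v) ⊔
      pair (D.ends x true false) (D.ends x false !v)) ⊔
      (pair (D.ends x true true) (D.ends y false v) ⊔ pair (D.ends y true true) (D.ends x false v))))
    obtain ⟨c, hc'⟩ := Nat.exists_eq_add_of_lt hpos
    rw [hc'] at hc
    -- With `δ = -A² - A⁻²`, the three states with equal outer joins contribute `δ + A² + A⁻² = 0`.
    -- Only the reconnecting state is left, with weight `1`; the opposite signs of `x` and `y` are
    -- what produces these weights.
    cases hθ' : θ <;>
    · simp only [joinEnds, beq_self_eq_true, if_true, Bool.false_eq_true, if_false, Bool.not_true,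
        Bool.not_false, Bool.true_beq, Bool.false_beq]
      rw [hc.1, hc.2.1, hc.2.2, hc']
      simp only [zero_add, add_tsub_cancel_right, pow_succ]
      norm_num
      ring
  rw [framedBracket, framedBracket, hw, hb']

end LinkDiagram

theorem joinEnds_symm {E : Type*} (p a q b : E) (s : Bool) :
    joinEnds p a q b s = joinEnds a p b q s := by
  unfold joinEnds
  split_ifs <;> rw [sup_comm]

/-- The three states with exactly one local value `true` induce the same pairings and weights on
both sides. The other five add up on either side to `A^(∓1) (δ^p + δ^q)`, where `δ = -A² - A⁻²` and
`p + 1`, `q + 1` count the circles of the local state `false, false, false` before and after the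
move. The move exchanges `p` and `q`. -/
theorem stateSum_triangle {ι E : Type*} [Fintype ι] [DecidableEq ι] [Finite E]
    {C C' : ι → Bool → Setoid E} {a b c : ι} (hab : a ≠ b) (hac : a ≠ c) (hbc : b ≠ c)
    {x y z ta tb ma mc bb bc : E} (hxy : x ≠ y) (hxz : x ≠ z) (hyz : y ≠ z)
    (hne : ∀ e ∈ [ta, tb, ma, mc, bb, bc], e ≠ x ∧ e ≠ y ∧ e ≠ z) (θ : Bool)
    (hCC : ∀ w, w ≠ a → w ≠ b → w ≠ c → C' w = C w)
    (hiso : ∀ w s, w ≠ a → w ≠ b → w ≠ c →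
      (C w s).Isolated x ∧ (C w s).Isolated y ∧ (C w s).Isolated z)
    (ha : ∀ s, C a s = joinEnds x ta y ma (s == θ))
    (hb : ∀ s, C b s = joinEnds x tb z bb (s == !θ))
    (hc : ∀ s, C c s = joinEnds y mc z bc (s == θ))
    (ha' : ∀ s, C' a s = joinEnds x tb y mc (s == θ))
    (hb' : ∀ s, C' b s = joinEnds x ta z bc (s == !θ))
    (hc' : ∀ s, C' c s = joinEnds y ma z bb (s == θ)) : stateSum C = stateSum C' := by
  have : Nonempty E := ⟨x⟩
  let f : {w // w ≠ a ∧ w ≠ b ∧ w ≠ c} → ι := Subtype.val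
  have hf : Function.Bijective (Sum.elim f ![a, b, c]) := by
    constructor
    · refine Subtype.val_injective.sumElim ?_ ?_
      · intro i j
        fin_cases i <;> fin_cases j <;> simp [hab, hac, hbc, hab.symm, hac.symm, hbc.symm]
      · rintro ⟨w, h1, h2, h3⟩ j
        fin_cases j <;> simp [*]
    · intro w
      by_cases h1 : w = a
      · exact ⟨.inr 0, h1.symm⟩
      by_cases h2 : w = b
      · exact ⟨.inr 1, h2.symm⟩
      by_cases h3 : w = c
      · exact ⟨.inr 2, h3.symm⟩
      · exact ⟨.inl ⟨w, h1, h2, h3⟩, rfl⟩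
  rw [stateSum_split C f _ hf, stateSum_split C' f _ hf]
  refine Finset.sum_congr rfl fun τ _ => ?_
  congr 1
  have hR : (⨆ w, C' (f w) (τ w)) = ⨆ w, C (f w) (τ w) :=
    iSup_congr fun w => by rw [hCC _ w.2.1 w.2.2.1 w.2.2.2]
  rw [hR]
  have h1 : (⨆ w, C (f w) (τ w)).Isolated x :=
    iSup_le fun w => (hiso _ _ w.2.1 w.2.2.1 w.2.2.2).1
  have h2 : (⨆ w, C (f w) (τ w)).Isolated y :=
    iSup_le fun w => (hiso _ _ w.2.1 w.2.2.1 w.2.2.2).2.1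
  have h3 : (⨆ w, C (f w) (τ w)).Isolated z :=
    iSup_le fun w => (hiso _ _ w.2.1 w.2.2.1 w.2.2.2).2.2
  set r := ⨆ w, C (f w) (τ w)
  have k := classCount_triangle h1 h2 h3 hxy hxz hyz hne
  have k' := classCount_triangle (ta := tb) (tb := ta) (ma := mc) (mc := ma) (bb := bc) (bc := bb)
    h1 h2 h3 hxy hxz hyz (fun e he => hne e (by simp at he ⊢; tauto))
  dsimp only at k k'
  obtain ⟨k1, k2, k3, k4, k5, k6, k7, k8⟩ := k
  obtain ⟨l1, l2, l3, l4, l5, l6, l7, l8⟩ := k'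
  have e6 : r ⊔ pair ta ma ⊔ pair tb mc ⊔ pair bb bc = r ⊔ pair tb mc ⊔ pair ta ma ⊔ pair bc bb :=
    eq_of_forall_ge_iff fun s => by simp only [sup_le_iff, pair_le]; grind
  have e7 : r ⊔ pair ta bc ⊔ pair tb bb ⊔ pair ma mc = r ⊔ pair tb bb ⊔ pair ta bc ⊔ pair mc ma :=
    eq_of_forall_ge_iff fun s => by simp only [sup_le_iff, pair_le]; grind
  have e8 : r ⊔ pair ta tb ⊔ pair mc bc ⊔ pair ma bb = r ⊔ pair tb ta ⊔ pair ma bb ⊔ pair mc bc :=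
    eq_of_forall_ge_iff fun s => by simp only [sup_le_iff, pair_le]; grind
  rw [e6] at k6
  rw [e7] at k7
  rw [e8] at k8
  simp only [sum_fin_three_bool, iSup_fin_three', Fin.sum_univ_three, Matrix.cons_val_zero,
    Matrix.cons_val_one, Matrix.cons_val, ha, hb, hc, ha', hb', hc']
  set S : Bool → Bool → Bool → ℕ := fun i j k =>
    (r ⊔ (joinEnds x ta y ma i ⊔ joinEnds x tb z bb j ⊔ joinEnds y mc z bc k)).classCount with hS
  set S' : Bool → Bool → Bool → ℕ := fun i j k =>
    (r ⊔ (joinEnds x tb y mc i ⊔ joinEnds x ta z bc j ⊔ joinEnds y ma z bb k)).classCount with hS'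
  have hS0 (i j k) : 0 < S i j k := classCount_pos _
  have hS0' (i j k) : 0 < S' i j k := classCount_pos _
  change S true true true + 2 = _ at k1
  change S true true false + 3 = _ at k2
  change S true false true + 3 = _ at k3
  change S false true true + 3 = _ at k4
  change S false false false + 3 = _ at k5
  change S true false false + 3 = _ at k6
  change S false true false + 3 = _ at k7
  change S false false true + 3 = _ at k8
  change S' true true true + 2 = _ at l1
  change S' true true false + 3 = _ at l2
  change S' true false true + 3 = _ at l3
  change S' false true true + 3 = _ at l4
  change S' false false false + 3 = _ at l5
  change S' true false false + 3 = _ at l6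
  change S' false true false + 3 = _ at l7
  change S' false false true + 3 = _ at l8
  obtain ⟨p, hp⟩ := Nat.exists_eq_add_of_lt (hS0 false false false)
  obtain ⟨q, hq⟩ := Nat.exists_eq_add_of_lt (hS0' false false false)
  have m1 : S true true true = q + 2 := by omega
  have m2 : S true true false = q + 1 := by omega
  have m3 : S true false true = q + 1 := by omega
  have m4 : S false true true = q + 1 := by omega
  have m5 : S false false false = p + 1 := by omega
  have n1 : S' true true true = p + 2 := by omega
  have n2 : S' true true false = p + 1 := by omega
  have n3 : S' true false true = p + 1 := by omega
  have n4 : S' false true true = p + 1 := by omega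
  have n5 : S' false false false = q + 1 := by omega
  have n6 : S' true false false = S true false false := by omega
  have n7 : S' false true false = S false true false := by omega
  have n8 : S' false false true = S false false true := by omega
  have hT : (T 1 * T 2 : ℤ[T;T⁻¹]) = T 3 := T_mul_T _ _
  have hT' : (T (-1) * T (-2) : ℤ[T;T⁻¹]) = T (-3) := T_mul_T _ _
  have hT2 : (T (-1) * T 2 : ℤ[T;T⁻¹]) = T 1 := T_mul_T _ _
  have hT2' : (T 1 * T (-2) : ℤ[T;T⁻¹]) = T (-1) := T_mul_T _ _
  simp only [hS, hS'] at m1 m2 m3 m4 m5 n1 n2 n3 n4 n5 n6 n7 n8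
  have b1 : (true == true) = true := rfl
  have b2 : (true == false) = false := rfl
  have b3 : (false == true) = false := rfl
  have b4 : (false == false) = true := rfl
  have w1 : ((1 : ℤ) + 1 + 1) = 3 := by norm_num
  have w2 : ((1 : ℤ) + 1 + -1) = 1 := by norm_num
  have w3 : ((1 : ℤ) + -1 + 1) = 1 := by norm_num
  have w4 : ((1 : ℤ) + -1 + -1) = -1 := by norm_num
  have w5 : ((-1 : ℤ) + 1 + 1) = 1 := by norm_num
  have w6 : ((-1 : ℤ) + 1 + -1) = -1 := by norm_num
  have w7 : ((-1 : ℤ) + -1 + 1) = -1 := by norm_num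
  have w8 : ((-1 : ℤ) + -1 + -1) = -3 := by norm_num
  cases θ
  · simp only [b1, b2, b3, b4, Bool.not_false, if_true, Bool.false_eq_true, if_false, m1, m2, m3,
      m4, m5, n1, n2, n3, n4, n5, n6, n7, n8, w1, w2, w3, w4, w5, w6, w7, w8, Nat.add_sub_cancel,
      Nat.add_succ_sub_one, pow_succ]
    linear_combination
      ((-T 2 - T (-2)) ^ p - (-T 2 - T (-2)) ^ q : ℤ[T;T⁻¹]) * hT' +
      ((-T 2 - T (-2)) ^ p - (-T 2 - T (-2)) ^ q : ℤ[T;T⁻¹]) * hT2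
  · simp only [b1, b2, b3, b4, Bool.not_true, if_true, Bool.false_eq_true, if_false, m1, m2, m3,
      m4, m5, n1, n2, n3, n4, n5, n6, n7, n8, w1, w2, w3, w4, w5, w6, w7, w8, Nat.add_sub_cancel,
      Nat.add_succ_sub_one, pow_succ]
    linear_combination
      ((-T 2 - T (-2)) ^ p - (-T 2 - T (-2)) ^ q : ℤ[T;T⁻¹]) * hT +
      ((-T 2 - T (-2)) ^ p - (-T 2 - T (-2)) ^ q : ℤ[T;T⁻¹]) * hT2'

namespace LinkDiagram

/-- Rewrites the bracket of `D'` as a state sum over the crossings and edges of `D`, as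
`stateSum_triangle` requires. -/
theorem smoothing_cast {D D' : LinkDiagram} (hn : D'.n = D.n) (hm : D'.m = D.m)
    {π : Fin D.n × Bool → Fin D.n × Bool}
    (hpos : ∀ x, D'.pos x = D.pos (Fin.cast hn x))
    (hends : ∀ x s o, Fin.cast hm (D'.ends x s o) =
      D.ends (π (Fin.cast hn x, s)).1 (π (Fin.cast hn x, s)).2 o) :
    D'.bracket = stateSum fun (x : Fin D.n) (b : Bool) =>
      pair (D.ends (π (x, true)).1 (π (x, true)).2 true)
        (D.ends (π (x, false)).1 (π (x, false)).2
          (if b then true != D.pos x else true == D.pos x)) ⊔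
      pair (D.ends (π (x, true)).1 (π (x, true)).2 false)
        (D.ends (π (x, false)).1 (π (x, false)).2
          (if b then false != D.pos x else false == D.pos x)) := by
  rw [bracket_eq_stateSum]
  obtain ⟨⟨n', m', pos', ends', i', r'⟩, p'⟩ := D'
  dsimp only at hn hm hpos hends
  subst hn hm
  have h1 : pos' = D.pos := funext hpos
  have h2 : ends' = fun x s o => D.ends (π (x, s)).1 (π (x, s)).2 o :=
    funext fun x => funext fun s => funext fun o => hends x s o
  subst h1 h2
  rfl

theorem ends_ne_of_eq (D : LinkDiagram) {x y : Fin D.n} {s t o : Bool}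
    (h : D.ends x s o = D.ends y t (!o)) (w : Fin D.n) (u v : Bool)
    (hx : ¬ (w = x ∧ u = s ∧ v = o)) (hy : ¬ (w = y ∧ u = t ∧ v = !o)) :
    D.ends w u v ≠ D.ends x s o := by
  by_cases hv : v = o
  · subst hv
    rw [Ne, D.ends_eq_iff]
    tauto
  · have : v = !o := by cases v <;> cases o <;> simp_all
    subst this
    rw [h, Ne, D.ends_eq_iff]
    tauto

theorem r3Swap_spec {n : ℕ} {a b c : Fin n} (hab : a ≠ b) (hac : a ≠ c) (hbc : b ≠ c) :
    r3Swap a b c (a, true) = (b, true) ∧ r3Swap a b c (b, true) = (a, true) ∧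
    r3Swap a b c (a, false) = (c, true) ∧ r3Swap a b c (c, true) = (a, false) ∧
    r3Swap a b c (b, false) = (c, false) ∧ r3Swap a b c (c, false) = (b, false) ∧
    ∀ w s, w ≠ a → w ≠ b → w ≠ c → r3Swap a b c (w, s) = (w, s) := by
  refine ⟨?_, ?_, ?_, ?_, ?_, ?_, fun w s k1 k2 k3 => ?_⟩ <;>
  simp [r3Swap, Equiv.swap_apply_def, hab.symm, hac.symm, hbc.symm, *]

theorem framedBracket_of_isR3 {D D' : LinkDiagram} (H : D.IsR3 D') :
    D.framedBracket = D'.framedBracket := by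
  obtain ⟨a, b, c, hab, hac, hbc, ⟨dt, dm, db, lt, lm, lb, h1, h2, h3, c1, c2, c3⟩, hn, hm,
    hpos, hends⟩ := H
  have hw : D.writhe = D'.writhe := by
    rw [writhe, writhe, ← (finCongr hn).sum_comp]
    simp [hpos]
  have hb : D.bracket = D'.bracket := by
    rw [smoothing_cast hn hm hpos hends, bracket_eq_stateSum]
    obtain ⟨r1, r2, r3, r4, r5, r6, r7⟩ := r3Swap_spec hab hac hbc
    have hiso : ∀ {x y : Fin D.n} {s t o : Bool}, D.ends x s o = D.ends y t (!o) → ∀ w b,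
        w ≠ x → w ≠ y → (D.smoothing w b).Isolated (D.ends x s o) := by
      intro x y s t o h w b hx hy
      cases o
      · exact D.isolated_smoothing h rfl hy hx
      · exact D.isolated_smoothing rfl h hx hy
    -- Because the triangle is a region, the smoothings that join its two sides at `a`, `b`, `c` are
    -- `θ`, `!θ`, `θ` for the single value `θ = (dm == lm)`.
    have hθb : (!(dm == lm)) = (db == ((!dt) != D.pos b)) := by
      obtain ⟨k1, k2⟩ := c1
      obtain ⟨k3, k4⟩ := c2
      rw [k1, k2, k3]
      cases lt <;> cases dt <;> cases D.pos a <;> cases D.pos b <;> rfl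
    have hθc : (dm == lm) = ((!db) == ((!dm) != D.pos c)) := by
      obtain ⟨k5, k6⟩ := c3
      rw [k5]
      cases dm <;> cases lm <;> cases D.pos c <;> rfl
    refine stateSum_triangle hab hac hbc (x := D.ends a true dt) (y := D.ends a false dm)
      (z := D.ends b false db) (ta := D.ends a true !dt) (tb := D.ends b true dt)
      (ma := D.ends a false !dm) (mc := D.ends c true dm) (bb := D.ends b false !db)
      (bc := D.ends c false db) ?_ ?_ ?_ ?_ (dm == lm) ?_ ?_ ?_ ?_ ?_ ?_ ?_ ?_
    · exact (D.ends_ne_of_eq h1 _ _ _ (by simp) (by simp [hab])).symm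
    · exact (D.ends_ne_of_eq h1 _ _ _ (by simp) (by simp)).symm
    · exact (D.ends_ne_of_eq h2 _ _ _ (by simp [hab.symm]) (by simp)).symm
    · simp only [List.mem_cons, List.not_mem_nil, or_false, forall_eq_or_imp, forall_eq]
      have hba := hab.symm
      have hca := hac.symm
      have hcb := hbc.symm
      refine ⟨⟨?_, ?_, ?_⟩, ⟨?_, ?_, ?_⟩, ⟨?_, ?_, ?_⟩, ⟨?_, ?_, ?_⟩, ⟨?_, ?_, ?_⟩, ?_, ?_, ?_⟩ <;>
      first
        | exact D.ends_ne_of_eq h1 _ _ _ (by simp [*])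
            (by simp [*])
        | exact D.ends_ne_of_eq h2 _ _ _ (by simp [*])
            (by simp [*])
        | exact D.ends_ne_of_eq h3 _ _ _ (by simp [*])
            (by simp [*])
    · intro w k1 k2 k3
      simp only [r7 _ _ k1 k2 k3]
      rfl
    · intro w s k1 k2 k3
      exact ⟨hiso h1 w s k1 k2, hiso h2 w s k1 k3, hiso h3 w s k2 k3⟩
    · intro s
      rw [D.smoothing_eq a dt dm (dm == lm) s (by rw [c1.2])]
    · intro s
      rw [D.smoothing_eq b (!dt) db (!(dm == lm)) s hθb, ← h1, Bool.not_not]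
    · intro s
      rw [D.smoothing_eq c (!dm) (!db) (dm == lm) s hθc, ← h2, ← h3, Bool.not_not, Bool.not_not]
    · intro s
      simp only [r1, r3]
      rw [pair_sup_pair_eq_joinEnds (D.ends b true) (D.ends c true) _ dt dm (dm == lm) s
        (by rw [c1.2]), joinEnds_symm, ← h1, ← h2]
    · intro s
      simp only [r2, r5]
      rw [pair_sup_pair_eq_joinEnds (D.ends a true) (D.ends c false) _ (!dt) db (!(dm == lm)) s
        hθb, joinEnds_symm, ← h3, Bool.not_not]
    · intro s
      simp only [r4, r6]
      rw [pair_sup_pair_eq_joinEnds (D.ends a false) (D.ends b false) _ (!dm) (!db) (dm == lm) s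
        hθc, joinEnds_symm, Bool.not_not, Bool.not_not]
  rw [framedBracket, framedBracket, hw, hb]

theorem framedBracket_of_sameLink {D D' : LinkDiagram} (h : D.SameLink D') :
    D.framedBracket = D'.framedBracket := by
  induction h with
  | rel D D' h =>
    rcases h with h | h | h | h
    · exact framedBracket_of_isForget_empty h
    · exact framedBracket_of_isR1 h
    · exact framedBracket_of_isR2 h
    · exact framedBracket_of_isR3 h
  | refl => rfl
  | symm _ _ _ ih => exact ih.symm
  | trans _ _ _ _ _ ih1 ih2 => exact ih1.trans ih2

theorem jones_of_sameLink {D D' : LinkDiagram} (h : D.SameLink D') : D.jones = D'.jones := by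
  have := framedBracket_of_sameLink h
  unfold framedBracket at this
  rw [jones, jones, this]

theorem mu_of_sameLink {D D' : LinkDiagram} (h : D.SameLink D') : D.mu = D'.mu := by
  rw [mu, mu, jonesSpan, jonesSpan, jones_of_sameLink h]

end LinkDiagram

/-! ### Invariance of the determinant under Reidemeister moves -/

namespace LinkDiagram

/-- The group presented by the edges of `D` and the colouring relations. -/
abbrev ColouringGroup (D : LinkDiagram) : Type :=
  (Fin D.m → ℤ) ⧸ AddSubgroup.closure D.colouringRelations

/-- The projection onto the colouring group. -/
def toColouring (D : LinkDiagram) : (Fin D.m → ℤ) →+ D.ColouringGroup :=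
  QuotientAddGroup.mk' _

/-- The generator of the colouring group that belongs to an edge. -/
def arc (D : LinkDiagram) (e : Fin D.m) : D.ColouringGroup := D.toColouring (Pi.single e 1)

theorem toColouring_eq_zero {D : LinkDiagram} {v : Fin D.m → ℤ} :
    D.toColouring v = 0 ↔ v ∈ AddSubgroup.closure D.colouringRelations :=
  QuotientAddGroup.eq_zero_iff v

theorem arc_over (D : LinkDiagram) (x : Fin D.n) (o o' : Bool) :
    D.arc (D.ends x true o) = D.arc (D.ends x true o') := by
  have : D.arc (D.ends x true false) = D.arc (D.ends x true true) := by
    rw [← sub_eq_zero, arc, arc, ← map_sub, toColouring_eq_zero]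
    exact AddSubgroup.subset_closure ⟨x, .inl rfl⟩
  cases o <;> cases o' <;> simp [this]

theorem arc_under (D : LinkDiagram) (x : Fin D.n) (u o : Bool) :
    D.arc (D.ends x false u) + D.arc (D.ends x false !u) = 2 • D.arc (D.ends x true o) := by
  have : D.arc (D.ends x false false) + D.arc (D.ends x false true) =
      2 • D.arc (D.ends x true true) := by
    rw [← sub_eq_zero, arc, arc, arc, ← map_add, ← map_nsmul, ← map_sub, toColouring_eq_zero]
    exact AddSubgroup.subset_closure ⟨x, .inr rfl⟩
  rw [D.arc_over x o true, ← this]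
  cases u
  · rfl
  · exact add_comm _ _

/-- It is enough that `φ` and `ψ` are inverse to each other modulo the relations: enlarging the
zero-sum group by the relation subgroup leaves the relative index unchanged, and after that
enlargement the two zero-sum groups correspond. -/
theorem det_eq_of_hom {D D' : LinkDiagram} (φ : (Fin D.m → ℤ) →+ (Fin D'.m → ℤ))
    (ψ : (Fin D'.m → ℤ) →+ (Fin D.m → ℤ))
    (hφ : ∀ v, ∑ e, φ v e = ∑ e, v e) (hψ : ∀ v, ∑ e, ψ v e = ∑ e, v e)
    (hφR : ∀ v ∈ D.colouringRelations, D'.toColouring (φ v) = 0)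
    (hψR : ∀ v ∈ D'.colouringRelations, D.toColouring (ψ v) = 0)
    (hψφ : ∀ v, D.toColouring (ψ (φ v)) = D.toColouring v)
    (hφψ : ∀ v, D'.toColouring (φ (ψ v)) = D'.toColouring v) : D.det = D'.det := by
  have h1 : AddSubgroup.closure D.colouringRelations =
      (AddSubgroup.closure D'.colouringRelations).comap φ := by
    apply le_antisymm
    · rw [AddSubgroup.closure_le]
      exact fun v hv => toColouring_eq_zero.1 (hφR v hv)
    · intro v hv
      have : AddSubgroup.closure D'.colouringRelations ≤
          (AddSubgroup.closure D.colouringRelations).comap ψ := by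
        rw [AddSubgroup.closure_le]
        exact fun v hv => toColouring_eq_zero.1 (hψR v hv)
      rw [← toColouring_eq_zero, ← hψφ, toColouring_eq_zero]
      exact this hv
  rw [det, det, h1, AddSubgroup.relIndex_comap, ← AddSubgroup.relIndex_sup_right]
  rw [← AddSubgroup.relIndex_sup_right D'.zeroSum]
  congr 1
  apply le_antisymm
  · refine sup_le ?_ le_sup_right
    rintro _ ⟨v, hv, rfl⟩
    refine AddSubgroup.mem_sup_left ?_
    exact (hφ v).trans hv
  · refine sup_le ?_ le_sup_right
    intro v hv
    rw [← sub_add_cancel v (φ (ψ v)), add_comm]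
    refine add_mem (AddSubgroup.mem_sup_left ⟨ψ v, (hψ v).trans hv, rfl⟩)
      (AddSubgroup.mem_sup_right ?_)
    rw [← toColouring_eq_zero, map_sub, hφψ, sub_self]

theorem det_eq_of_arcs {D D' : LinkDiagram} (a : Fin D.m → Fin D'.m → ℤ)
    (b : Fin D'.m → Fin D.m → ℤ) (ha : ∀ e, ∑ i, a e i = 1) (hb : ∀ e, ∑ i, b e i = 1)
    (ha1 : ∀ x, D'.toColouring (a (D.ends x true false)) = D'.toColouring (a (D.ends x true true)))
    (ha2 : ∀ x, D'.toColouring (a (D.ends x false false)) +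
      D'.toColouring (a (D.ends x false true)) = 2 • D'.toColouring (a (D.ends x true true)))
    (hb1 : ∀ x, D.toColouring (b (D'.ends x true false)) = D.toColouring (b (D'.ends x true true)))
    (hb2 : ∀ x, D.toColouring (b (D'.ends x false false)) +
      D.toColouring (b (D'.ends x false true)) = 2 • D.toColouring (b (D'.ends x true true)))
    (hba : ∀ e, D.toColouring (Fintype.linearCombination ℤ b (a e)) = D.arc e)
    (hab : ∀ e, D'.toColouring (Fintype.linearCombination ℤ a (b e)) = D'.arc e) :
    D.det = D'.det := by
  have hsum : ∀ {m m' : ℕ} (a : Fin m → Fin m' → ℤ), (∀ e, ∑ i, a e i = 1) → ∀ v,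
      ∑ e, Fintype.linearCombination ℤ a v e = ∑ e, v e := by
    intro m m' a ha v
    simp only [Fintype.linearCombination_apply, Finset.sum_apply, Pi.smul_apply, smul_eq_mul]
    rw [Finset.sum_comm]
    simp [← Finset.mul_sum, ha]
  have hext : ∀ {D : LinkDiagram} (θ : (Fin D.m → ℤ) →+ D.ColouringGroup),
      (∀ e, θ (Pi.single e 1) = D.arc e) → ∀ v, θ v = D.toColouring v := by
    intro D θ h v
    have : θ.toIntLinearMap = D.toColouring.toIntLinearMap := by
      refine LinearMap.pi_ext' fun e => LinearMap.ext_ring ?_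
      exact h e
    exact congrArg (fun l => l v) this
  refine det_eq_of_hom (Fintype.linearCombination ℤ a).toAddMonoidHom
    (Fintype.linearCombination ℤ b).toAddMonoidHom (hsum a ha) (hsum b hb) ?_ ?_ ?_ ?_
  · rintro _ ⟨x, rfl | rfl⟩
    · simp [Fintype.linearCombination_apply_single, ha1]
    · simp only [LinearMap.toAddMonoidHom_coe, map_sub, map_add, map_nsmul,
        Fintype.linearCombination_apply_single, one_smul, ha2, sub_self]
  · rintro _ ⟨x, rfl | rfl⟩
    · simp [Fintype.linearCombination_apply_single, hb1]
    · simp only [LinearMap.toAddMonoidHom_coe, map_sub, map_add, map_nsmul,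
        Fintype.linearCombination_apply_single, one_smul, hb2, sub_self]
  · refine hext ((D.toColouring.comp (Fintype.linearCombination ℤ b).toAddMonoidHom).comp
      (Fintype.linearCombination ℤ a).toAddMonoidHom) fun e => ?_
    simpa [Fintype.linearCombination_apply_single] using hba e
  · refine hext ((D'.toColouring.comp (Fintype.linearCombination ℤ a).toAddMonoidHom).comp
      (Fintype.linearCombination ℤ b).toAddMonoidHom) fun e => ?_
    simpa [Fintype.linearCombination_apply_single] using hab e

/-- The set `N` contains a representative of every class of merged edges, and choosing
representatives in `N` gives the map back to `D`. The labelling `κ` follows the merging and agrees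
with `arc` on `N`, so the choice of representative does not affect the colour. Edges outside `N` are
recovered from the relations at the forgotten crossings, which is `h3`. -/
theorem det_eq_of_forget {D D' : LinkDiagram} {S : Set (Fin D.n)} {f : Fin D'.n → Fin D.n}
    {g : Fin D.m → Fin D'.m} (hg : Function.Surjective g) (hf : Set.range f = Sᶜ)
    (hgk : ∀ e e' : Fin D.m, g e = g e' → Relation.EqvGen
      (fun a b => ∃ x ∈ S, ∃ s : Bool, a = D.ends x s false ∧ b = D.ends x s true) e e')
    (hends : ∀ x s o, D'.ends x s o = g (D.ends (f x) s o))
    (N : Set (Fin D.m)) (a : Fin D.m → Fin D'.m → ℤ) (κ : Fin D.m → D.ColouringGroup)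
    (haN : ∀ e ∈ N, a e = Pi.single (g e) 1) (ha : ∀ e, ∑ i, a e i = 1)
    (hN : ∀ e, ∃ e' ∈ N, g e' = g e) (hκ : ∀ x ∈ S, ∀ s, κ (D.ends x s false) = κ (D.ends x s true))
    (hκN : ∀ e ∈ N, κ e = D.arc e) (hfN : ∀ x s o, D.ends (f x) s o ∈ N)
    (h1 : ∀ x ∈ S, D'.toColouring (a (D.ends x true false)) =
      D'.toColouring (a (D.ends x true true)))
    (h2 : ∀ x ∈ S, D'.toColouring (a (D.ends x false false)) +
      D'.toColouring (a (D.ends x false true)) = 2 • D'.toColouring (a (D.ends x true true)))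
    (h3 : ∀ ψ : (Fin D'.m → ℤ) →ₗ[ℤ] (Fin D.m → ℤ),
      (∀ e ∈ N, D.toColouring (ψ (Pi.single (g e) 1)) = D.arc e) →
      ∀ e ∉ N, D.toColouring (ψ (a e)) = D.arc e) : D.det = D'.det := by
  have hκg : ∀ e e', g e = g e' → κ e = κ e' := by
    intro e e' h
    have : Relation.EqvGen.setoid
        (fun a b => ∃ x ∈ S, ∃ s : Bool, a = D.ends x s false ∧ b = D.ends x s true) ≤ ker κ := by
      refine Setoid.eqvGen_le ?_
      rintro _ _ ⟨x, hx, s, rfl, rfl⟩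
      exact hκ x hx s
    exact this (hgk e e' h)
  choose s hsN hsg using fun e' => (hg.exists.1 ⟨e', rfl⟩ : ∃ e, e' = g e).elim
    fun e (he : e' = g e) => (hN e).imp fun e₁ h => (⟨h.1, h.2.trans he.symm⟩ : e₁ ∈ N ∧ g e₁ = e')
  have harc : ∀ e ∈ N, D.arc (s (g e)) = D.arc e := by
    intro e he
    rw [← hκN _ (hsN _), ← hκN _ he]
    exact hκg _ _ (hsg _)
  have hψ : ∀ e ∈ N, D.toColouring (Fintype.linearCombination ℤ
      (fun e' => Pi.single (s e') (1 : ℤ)) (Pi.single (g e) 1)) = D.arc e := by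
    intro e he
    rw [Fintype.linearCombination_apply_single, one_smul]
    exact harc e he
  have hbx : ∀ x s' o, D.toColouring (Pi.single (s (D'.ends x s' o)) 1) = D.arc (D.ends (f x) s' o) := by
    intro x s' o
    rw [hends]
    exact harc _ (hfN _ _ _)
  refine det_eq_of_arcs a (fun e' => Pi.single (s e') 1) ha (fun e => by simp) ?_ ?_ ?_ ?_ ?_ ?_
  · intro x
    by_cases hx : x ∈ S
    · exact h1 x hx
    · obtain ⟨y, rfl⟩ : x ∈ Set.range f := hf ▸ hx
      rw [haN _ (hfN _ _ _), haN _ (hfN _ _ _), ← hends, ← hends]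
      exact D'.arc_over y _ _
  · intro x
    by_cases hx : x ∈ S
    · exact h2 x hx
    · obtain ⟨y, rfl⟩ : x ∈ Set.range f := hf ▸ hx
      rw [haN _ (hfN _ _ _), haN _ (hfN _ _ _), haN _ (hfN _ _ _), ← hends, ← hends, ← hends]
      exact D'.arc_under y false true
  · intro x
    rw [hbx, hbx]
    exact D.arc_over _ _ _
  · intro x
    rw [hbx, hbx, hbx]
    exact D.arc_under _ false true
  · intro e
    by_cases he : e ∈ N
    · rw [haN e he]
      exact hψ e he
    · exact h3 _ hψ e he
  · intro e
    rw [Fintype.linearCombination_apply_single, one_smul, haN _ (hsN _), hsg]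
    rfl

/-- Covers isomorphisms, where `S` is empty, and kinks, where the four ends at the crossing have the
same colour. -/
theorem det_of_isForget_of_forall {D D' : LinkDiagram} {S : Set (Fin D.n)} (H : D.IsForget S D')
    (h : ∀ x ∈ S, ∀ s o s' o', D.arc (D.ends x s o) = D.arc (D.ends x s' o'))
    (hg : ∀ g : Fin D.m → Fin D'.m, (∀ x ∈ S, ∀ s, g (D.ends x s false) = g (D.ends x s true)) →
      ∀ x ∈ S, ∀ s o s' o', g (D.ends x s o) = g (D.ends x s' o')) : D.det = D'.det := by
  obtain ⟨f, g, hf, hfr, hgs, hgk, hpos, hends⟩ := H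
  have hg' := hg g fun x hx s => (hgk _ _).2 (.rel _ _ ⟨x, hx, s, rfl, rfl⟩)
  refine det_eq_of_forget hgs hfr (fun e e' => (hgk e e').1) hends Set.univ
    (fun e => Pi.single (g e) 1) D.arc (fun _ _ => rfl) (fun e => by simp) (fun e => ⟨e, trivial, rfl⟩)
    (fun x hx s => h x hx _ _ _ _) (fun _ _ => rfl) (fun _ _ _ => trivial) ?_ ?_
    (fun _ _ e he => absurd trivial he)
  · intro x hx
    rw [hg' x hx true false true true]
  · intro x hx
    rw [hg' x hx false false true true, hg' x hx false true true true, two_nsmul]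

theorem det_of_isR1 {D D' : LinkDiagram} (H : D.IsR1 D') : D.det = D'.det := by
  obtain ⟨x, s, hx, H⟩ := H
  refine det_of_isForget_of_forall H ?_ ?_
  · rintro x rfl
    have h1 := D.arc_over x true false
    have h2 := D.arc_under x true true
    have h3 := congrArg D.arc hx
    have h4 : D.arc (D.ends x false true) = D.arc (D.ends x true true) ∧
        D.arc (D.ends x false false) = D.arc (D.ends x true true) := by
      cases s
      · simp only [Bool.not_false, Bool.not_true] at h2 h3
        rw [h3, ← h1, two_nsmul] at h2
        exact ⟨h3.trans h1.symm, add_left_cancel h2⟩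
      · simp only [Bool.not_true] at h2 h3
        rw [← h3, two_nsmul] at h2
        exact ⟨add_right_cancel h2, h3.symm⟩
    intro s o s' o'
    cases s <;> cases o <;> cases s' <;> cases o' <;> simp [h1, h4]
  · rintro g hg x rfl
    have h1 := hg x rfl true
    have h2 := hg x rfl false
    have h3 := congrArg g hx
    intro s₁ o s' o'
    have h4 : g (D.ends x true false) = g (D.ends x false true) := by
      cases s
      · exact h3.symm
      · exact h1.trans (h3.trans h2)
    cases s₁ <;> cases o <;> cases s' <;> cases o' <;> simp [← h1, h2, h4]

theorem det_of_isR2 {D D' : LinkDiagram} (H : D.IsR2 D') : D.det = D'.det := by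
  obtain ⟨x, y, hxy, ho, hu, f, g, hf, hfr, hgs, hgk, hpos, hends⟩ := H
  have hne : x ≠ y := by rintro rfl; simp at hxy
  obtain ⟨v, hv⟩ : ∃ v, D.ends x false v = D.ends y false (!v) := by
    rcases hu with h | h
    · exact ⟨true, h⟩
    · exact ⟨false, h.symm⟩
  have hfx : ∀ i, f i ≠ x := by
    rintro i rfl
    have : f i ∈ ({f i, y} : Set (Fin D.n))ᶜ := hfr ▸ ⟨i, rfl⟩
    simp at this
  have hfy : ∀ i, f i ≠ y := by
    rintro i rfl
    have : f i ∈ ({x, f i} : Set (Fin D.n))ᶜ := hfr ▸ ⟨i, rfl⟩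
    simp at this
  have hg : ∀ z ∈ ({x, y} : Set (Fin D.n)), ∀ s o o', g (D.ends z s o) = g (D.ends z s o') := by
    intro z hz s o o'
    have : g (D.ends z s false) = g (D.ends z s true) :=
      (hgk _ _).2 (.rel _ _ ⟨z, hz, s, rfl, rfl⟩)
    cases o <;> cases o' <;> simp [this]
  have hx : x ∈ ({x, y} : Set (Fin D.n)) := .inl rfl
  have hy : y ∈ ({x, y} : Set (Fin D.n)) := .inr rfl
  set q := D.ends x false v with hq
  have hne_q (w u o) := D.ends_ne_of_eq hv w u o
  have n1 : ∀ o, D.ends x true o ≠ q := fun o => hne_q _ _ _ (by simp) (by simp)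
  have n2 : ∀ o, D.ends y true o ≠ q := fun o => hne_q _ _ _ (by simp) (by simp)
  have n3 : D.ends x false (!v) ≠ q := hne_q _ _ _ (by simp) (by simp [hne])
  have n4 : D.ends y false v ≠ q := hne_q _ _ _ (by simp [hne.symm]) (by simp)
  -- The under-edge `q` of the bigon is the one generator that is lost. Its colour is forced by the
  -- relation at `x`.
  let a : Fin D.m → Fin D'.m → ℤ := fun e => if e = q then
    2 • Pi.single (g (D.ends x true true)) 1 - Pi.single (g (D.ends x false !v)) 1
    else Pi.single (g e) 1
  let κ : Fin D.m → D.ColouringGroup := fun e => if e = q then D.arc (D.ends x false !v) else D.arc e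
  have haq : a q = 2 • Pi.single (g (D.ends x true true)) 1 - Pi.single (g (D.ends x false !v)) 1 :=
    if_pos rfl
  have haN : ∀ e, e ≠ q → a e = Pi.single (g e) 1 := fun e he => if_neg he
  have hκq : κ q = D.arc (D.ends x false !v) := if_pos rfl
  have hκN : ∀ e, e ≠ q → κ e = D.arc e := fun e he => if_neg he
  have r1 := D.arc_under x v true
  have r2 := D.arc_under y v true
  have r3 : D.arc (D.ends y true true) = D.arc (D.ends x true true) := by
    rw [ho]; exact D.arc_over _ _ _
  -- Passing under the same colour twice means reflecting twice, so the original colour returns.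
  have r4 : D.arc (D.ends y false v) = D.arc (D.ends x false !v) := by
    rw [← hv, r3, ← r1, add_comm] at r2
    exact add_left_cancel r2
  have hgo : g (D.ends y true true) = g (D.ends x true true) := by
    rw [ho]; exact hg y hy _ _ _
  have hgv : g (D.ends y false v) = g (D.ends x false !v) := by
    rw [hg y hy false v (!v), ← hv]; exact hg x hx _ _ _
  refine det_eq_of_forget hgs hfr (fun e e' => (hgk e e').1) hends {e | e ≠ q} a κ haN ?_ ?_ ?_
    hκN ?_ ?_ ?_ ?_
  · intro e
    by_cases he : e = q
    · rw [he, haq]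
      simp [Finset.sum_sub_distrib, ← Finset.mul_sum]
    · rw [haN e he]
      simp
  · intro e
    by_cases he : e = q
    · exact ⟨_, n3, by rw [he]; exact hg x hx _ _ _⟩
    · exact ⟨e, he, rfl⟩
  · rintro z (rfl | rfl) (_ | _)
    · have : κ q = κ (D.ends z false !v) := by rw [hκq, hκN _ n3]
      cases v
      · exact this
      · exact this.symm
    · rw [hκN _ (n1 _), hκN _ (n1 _)]
      exact D.arc_over _ _ _
    · have : κ (D.ends z false !v) = κ (D.ends z false v) := by
        rw [← hv, hκq, hκN _ n4, r4]
      cases v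
      · exact this.symm
      · exact this
    · rw [hκN _ (n2 _), hκN _ (n2 _)]
      exact D.arc_over _ _ _
  · exact fun i s o => hne_q _ _ _ (fun h => hfx i h.1) (fun h => hfy i h.1)
  · rintro z (rfl | rfl)
    · rw [haN _ (n1 _), haN _ (n1 _), hg z hx _ false true]
    · rw [haN _ (n2 _), haN _ (n2 _), hg z hy _ false true]
  · have key1 : D'.toColouring (a q) + D'.toColouring (a (D.ends x false !v)) =
        2 • D'.toColouring (a (D.ends x true true)) := by
      rw [haq, haN _ n3, haN _ (n1 _), map_sub, map_nsmul, sub_add_cancel]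
    have key2 : D'.toColouring (a (D.ends y false !v)) + D'.toColouring (a (D.ends y false v)) =
        2 • D'.toColouring (a (D.ends y true true)) := by
      rw [← hv, haq, haN _ n4, haN _ (n2 _), map_sub, map_nsmul, hgo, hgv, sub_add_cancel]
    rintro z (rfl | rfl)
    · cases v
      · exact key1
      · rw [← key1, add_comm]; rfl
    · cases v
      · rw [← key2, add_comm]; rfl
      · exact key2
  · intro ψ hψ e he
    have he : e = q := by simpa using he
    rw [he, haq, map_sub, map_nsmul, map_sub, map_nsmul, hψ _ (n1 _), hψ _ n3, ← r1,
      add_sub_cancel_right]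

/-- Self-distributivity of the reflections `q ↦ 2 x - q`: reflecting `q` in `u` and then in `x`
equals reflecting in `x` and then in `s`, the mirror image of `u` in `x`. This is the algebraic
content of the third move. -/
theorem _root_.two_nsmul_sub_add {G : Type*} [AddCommGroup G] {x p q r s u : G}
    (h1 : p + q = 2 • x) (h2 : q + r = 2 • u) (h3 : s + u = 2 • x) : 2 • x - r + p = 2 • s := by
  rw [eq_sub_of_add_eq h1, eq_sub_of_add_eq h3, eq_sub_of_add_eq' h2]
  abel

theorem det_of_isR3 {D D' : LinkDiagram} (H : D.IsR3 D') : D.det = D'.det := by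
  obtain ⟨a, b, c, hab, hac, hbc, ⟨dt, dm, db, lt, lm, lb, h1, h2, h3, -, -, -⟩, hn, hm,
    -, hends⟩ := H
  obtain ⟨t, ht⟩ : ∃ t : Fin D.m ≃ Fin D'.m, ∀ x s o, t (D.ends
      (r3Swap a b c (x, s)).1 (r3Swap a b c (x, s)).2 o) = D'.ends (Fin.cast hn.symm x) s o :=
    ⟨finCongr hm.symm, fun x s o => by
      have := hends (Fin.cast hn.symm x) s o
      simp only [Fin.cast_cast, Fin.cast_eq_self] at this
      simp [← this]⟩
  have hall : ∀ x : Fin D'.n, ∃ y : Fin D.n, x = Fin.cast hn.symm y := fun x => ⟨Fin.cast hn x, rfl⟩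
  obtain ⟨r1, r2, r3, r4, r5, r6, r7⟩ := r3Swap_spec hab hac hbc
  set ab := D.ends a true dt with hab'
  set ac := D.ends a false dm with hac'
  set bc := D.ends b false db with hbc'
  have hne1 : ∀ w u v, ¬ (w = a ∧ u = false ∧ v = dm) → ¬ (w = c ∧ u = true ∧ v = !dm) →
      D.ends w u v ≠ ac := D.ends_ne_of_eq h2
  have hne2 : ∀ w u v, ¬ (w = b ∧ u = false ∧ v = db) → ¬ (w = c ∧ u = false ∧ v = !db) →
      D.ends w u v ≠ bc := D.ends_ne_of_eq h3
  have hcb : bc ≠ ac := hne1 _ _ _ (by simp [hab.symm]) (by simp)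
  -- the relations of `D`
  have d1 : D.arc (D.ends a true !dt) = D.arc ab := D.arc_over _ _ _
  have d2 : D.arc (D.ends b true dt) = D.arc ab := by rw [h1]; exact D.arc_over _ _ _
  have d3 : D.arc ac + D.arc (D.ends a false !dm) = 2 • D.arc ab := D.arc_under _ _ _
  have d4 : D.arc bc + D.arc (D.ends b false !db) = 2 • D.arc ab := by
    rw [h1]; exact D.arc_under _ _ _
  have d5 : D.arc (D.ends c true dm) = D.arc ac := by rw [h2]; exact D.arc_over _ _ _
  have d6 : D.arc (D.ends c false db) + D.arc bc = 2 • D.arc ac := by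
    rw [h2, h3]; exact D.arc_under _ _ _
  -- the relations of `D'`
  have over' : ∀ x o o', D'.arc (t (D.ends (r3Swap a b c (x, true)).1 (r3Swap a b c (x, true)).2 o))
      = D'.arc (t (D.ends (r3Swap a b c (x, true)).1 (r3Swap a b c (x, true)).2 o')) := by
    intro x o o'
    rw [ht, ht]
    exact D'.arc_over _ _ _
  have under' : ∀ x u o,
      D'.arc (t (D.ends (r3Swap a b c (x, false)).1 (r3Swap a b c (x, false)).2 u)) +
      D'.arc (t (D.ends (r3Swap a b c (x, false)).1 (r3Swap a b c (x, false)).2 !u))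
      = 2 • D'.arc (t (D.ends (r3Swap a b c (x, true)).1 (r3Swap a b c (x, true)).2 o)) := by
    intro x u o
    rw [ht, ht, ht]
    exact D'.arc_under _ _ _
  have e1 : D'.arc (t (D.ends a true !dt)) = D'.arc (t ab) := by simpa [r2] using over' b (!dt) dt
  have e2 : D'.arc (t (D.ends b true dt)) = D'.arc (t ab) := by
    rw [h1]; simpa [r1] using over' a dt (!dt)
  have e3 : D'.arc (t (D.ends c true dm)) + D'.arc (t ac) = 2 • D'.arc (t ab) := by
    rw [h1, h2]; simpa [r1, r3] using under' a dm (!dt)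
  have e4 : D'.arc (t (D.ends c false db)) + D'.arc (t bc) = 2 • D'.arc (t ab) := by
    rw [h3]; simpa [r2, r5] using under' b db dt
  have e5 : D'.arc (t (D.ends a false !dm)) = D'.arc (t ac) := by
    simpa [r4] using over' c (!dm) dm
  have e6 : D'.arc (t bc) + D'.arc (t (D.ends b false !db)) = 2 • D'.arc (t ac) := by
    simpa [r4, r6] using under' c db dm
  -- The outer edges and `ab` keep their colours. The sides `ac` and `bc` change theirs, so each is
  -- expressed by kept edges through relations of the source diagram: `d5` and `d4` for `α`, `e5`
  -- and `e4` for `β`.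
  let α : Fin D.m → Fin D'.m → ℤ := fun e =>
    if e = ac then Pi.single (t (D.ends c true dm)) 1 else
    if e = bc then 2 • Pi.single (t ab) 1 - Pi.single (t (D.ends b false !db)) 1 else
    Pi.single (t e) 1
  let β : Fin D'.m → Fin D.m → ℤ := fun e =>
    if t.symm e = ac then Pi.single (D.ends a false !dm) 1 else
    if t.symm e = bc then 2 • Pi.single ab 1 - Pi.single (D.ends c false db) 1 else
    Pi.single (t.symm e) 1
  have α1 : α ac = Pi.single (t (D.ends c true dm)) 1 := if_pos rfl
  have α2 : α bc = 2 • Pi.single (t ab) 1 - Pi.single (t (D.ends b false !db)) 1 := by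
    simp only [α, if_neg hcb, if_true]
  have α3 : ∀ e, e ≠ ac → e ≠ bc → α e = Pi.single (t e) 1 := fun e k1 k2 => by
    simp only [α, if_neg k1, if_neg k2]
  have β1 : β (t ac) = Pi.single (D.ends a false !dm) 1 := by
    simp only [β, Equiv.symm_apply_apply, if_true]
  have β2 : β (t bc) = 2 • Pi.single ab 1 - Pi.single (D.ends c false db) 1 := by
    simp only [β, Equiv.symm_apply_apply, if_neg hcb, if_true]
  have β3 : ∀ e, e ≠ ac → e ≠ bc → β (t e) = Pi.single e 1 := fun e k1 k2 => by
    simp only [β, Equiv.symm_apply_apply, if_neg k1, if_neg k2]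
  have A1 : D'.toColouring (α ac) = D'.arc (t (D.ends c true dm)) := by rw [α1]; rfl
  have A2 : D'.toColouring (α bc) = 2 • D'.arc (t ab) - D'.arc (t (D.ends b false !db)) := by
    rw [α2, map_sub, map_nsmul]; rfl
  have A3 : ∀ e, e ≠ ac → e ≠ bc → D'.toColouring (α e) = D'.arc (t e) := fun e k1 k2 => by
    rw [α3 e k1 k2]; rfl
  have B1 : D.toColouring (β (t ac)) = D.arc (D.ends a false !dm) := by rw [β1]; rfl
  have B2 : D.toColouring (β (t bc)) = 2 • D.arc ab - D.arc (D.ends c false db) := by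
    rw [β2, map_sub, map_nsmul]; rfl
  have B3 : ∀ e, e ≠ ac → e ≠ bc → D.toColouring (β (t e)) = D.arc e := fun e k1 k2 => by
    rw [β3 e k1 k2]; rfl
  have nab : ab ≠ ac ∧ ab ≠ bc := ⟨hne1 _ _ _ (by simp) (by simp [hac]),
    hne2 _ _ _ (by simp) (by simp)⟩
  have nta : D.ends a true (!dt) ≠ ac ∧ D.ends a true (!dt) ≠ bc :=
    ⟨hne1 _ _ _ (by simp) (by simp [hac]), hne2 _ _ _ (by simp) (by simp)⟩
  have ntb : D.ends b true dt ≠ ac ∧ D.ends b true dt ≠ bc :=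
    ⟨hne1 _ _ _ (by simp) (by simp [hbc]), hne2 _ _ _ (by simp) (by simp)⟩
  have nma : D.ends a false (!dm) ≠ ac ∧ D.ends a false (!dm) ≠ bc :=
    ⟨hne1 _ _ _ (by simp) (by simp), hne2 _ _ _ (by simp [hab]) (by simp [hac])⟩
  have nmc : D.ends c true dm ≠ ac ∧ D.ends c true dm ≠ bc :=
    ⟨hne1 _ _ _ (by simp) (by simp), hne2 _ _ _ (by simp) (by simp)⟩
  have nbb : D.ends b false (!db) ≠ ac ∧ D.ends b false (!db) ≠ bc :=
    ⟨hne1 _ _ _ (by simp [hab.symm]) (by simp), hne2 _ _ _ (by simp) (by simp [hbc])⟩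
  have nbc : D.ends c false db ≠ ac ∧ D.ends c false db ≠ bc :=
    ⟨hne1 _ _ _ (by simp [hac.symm]) (by simp), hne2 _ _ _ (by simp [hbc.symm]) (by simp)⟩
  have nw : ∀ w s o, w ≠ a → w ≠ b → w ≠ c → D.ends w s o ≠ ac ∧ D.ends w s o ≠ bc :=
    fun w s o k1 k2 k3 => ⟨hne1 _ _ _ (by simp [k1]) (by simp [k3]),
      hne2 _ _ _ (by simp [k2]) (by simp [k3])⟩
  have two : ∀ {G : Type} [AddCommGroup G] (F G' : Bool → G) (o u : Bool) (h : F o = F (!o))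
      (h' : G' u + G' (!u) = 2 • F o), F false = F true ∧ G' false + G' true = 2 • F true := by
    intro G _ F G' o u h h'
    cases o <;> cases u <;> simp only [Bool.not_true, Bool.not_false] at h h' <;>
      refine ⟨?_, ?_⟩ <;> first | exact h | exact h.symm | skip
    · rw [← h, h']
    · rw [← h, ← h', add_comm]
    · exact h'
    · rw [← h', add_comm]
  have hA : ∀ x, (D'.toColouring (α (D.ends x true false)) = D'.toColouring (α (D.ends x true true)))
      ∧ D'.toColouring (α (D.ends x false false)) + D'.toColouring (α (D.ends x false true)) =
        2 • D'.toColouring (α (D.ends x true true)) := by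
    intro x
    by_cases k1 : x = a
    · refine two (fun o => D'.toColouring (α (D.ends x true o)))
        (fun o => D'.toColouring (α (D.ends x false o))) dt dm ?_ ?_ <;> rw [k1]
      · rw [A3 _ nta.1 nta.2, ← hab', A3 _ nab.1 nab.2, e1]
      · rw [← hac', ← hab', A1, A3 _ nma.1 nma.2, A3 _ nab.1 nab.2, e5, e3]
    by_cases k2 : x = b
    · refine two (fun o => D'.toColouring (α (D.ends x true o)))
        (fun o => D'.toColouring (α (D.ends x false o))) dt db ?_ ?_ <;> rw [k2]
      · rw [A3 _ ntb.1 ntb.2, ← h1, A3 _ nab.1 nab.2, e2]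
      · rw [← hbc', A2, A3 _ nbb.1 nbb.2, A3 _ ntb.1 ntb.2, e2, sub_add_cancel]
    by_cases k3 : x = c
    · refine two (fun o => D'.toColouring (α (D.ends x true o)))
        (fun o => D'.toColouring (α (D.ends x false o))) dm db ?_ ?_ <;> rw [k3]
      · rw [A3 _ nmc.1 nmc.2, ← h2, A1]
      · rw [← h3, A2, A3 _ nbc.1 nbc.2, A3 _ nmc.1 nmc.2]
        exact (add_comm _ _).trans (two_nsmul_sub_add e4 e6 e3)
    · have h5 := over' x
      have h6 := under' x
      simp only [r7 x _ k1 k2 k3] at h5 h6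
      have n (s o) := nw x s o k1 k2 k3
      rw [A3 _ (n _ _).1 (n _ _).2, A3 _ (n _ _).1 (n _ _).2, A3 _ (n _ _).1 (n _ _).2,
        A3 _ (n _ _).1 (n _ _).2]
      exact ⟨h5 _ _, h6 false true⟩
  have hB : ∀ x, (D.toColouring (β (D'.ends x true false)) =
        D.toColouring (β (D'.ends x true true)))
      ∧ D.toColouring (β (D'.ends x false false)) + D.toColouring (β (D'.ends x false true)) =
        2 • D.toColouring (β (D'.ends x true true)) := by
    intro x
    obtain ⟨x, rfl⟩ := hall x
    simp only [← ht]
    by_cases k1 : x = a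
    · rw [k1, r1, r3]
      refine two (fun o => D.toColouring (β (t (D.ends b true o))))
        (fun o => D.toColouring (β (t (D.ends c true o)))) dt dm ?_ ?_
      · rw [B3 _ ntb.1 ntb.2, ← h1, B3 _ nab.1 nab.2, d2]
      · rw [← h2, B1, B3 _ nmc.1 nmc.2, B3 _ ntb.1 ntb.2, d2, d5, d3]
    by_cases k2 : x = b
    · rw [k2, r2, r5]
      refine two (fun o => D.toColouring (β (t (D.ends a true o))))
        (fun o => D.toColouring (β (t (D.ends c false o)))) dt db ?_ ?_
      · rw [B3 _ nta.1 nta.2, ← hab', B3 _ nab.1 nab.2, d1]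
      · rw [← h3, ← hab', B2, B3 _ nbc.1 nbc.2, B3 _ nab.1 nab.2, add_sub_cancel]
    by_cases k3 : x = c
    · rw [k3, r4, r6]
      refine two (fun o => D.toColouring (β (t (D.ends a false o))))
        (fun o => D.toColouring (β (t (D.ends b false o)))) dm db ?_ ?_
      · rw [← hac', B1, B3 _ nma.1 nma.2]
      · rw [← hbc', ← hac', B1, B2, B3 _ nbb.1 nbb.2]
        exact two_nsmul_sub_add ((add_comm _ _).trans d4) ((add_comm _ _).trans d6)
          ((add_comm _ _).trans d3)
    · have n (s o) := nw x s o k1 k2 k3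
      simp only [r7 x _ k1 k2 k3]
      rw [B3 _ (n _ _).1 (n _ _).2, B3 _ (n _ _).1 (n _ _).2, B3 _ (n _ _).1 (n _ _).2,
        B3 _ (n _ _).1 (n _ _).2]
      exact ⟨D.arc_over _ _ _, D.arc_under _ false true⟩
  refine det_eq_of_arcs α β ?_ ?_ (fun x => (hA x).1) (fun x => (hA x).2) (fun x => (hB x).1)
    (fun x => (hB x).2) ?_ ?_
  · intro e
    simp only [α]
    split_ifs <;> simp [Finset.sum_sub_distrib, ← Finset.mul_sum]
  · intro e
    simp only [β]
    split_ifs <;> simp [Finset.sum_sub_distrib, ← Finset.mul_sum]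
  · intro e
    by_cases k1 : e = ac
    · rw [k1, α1, Fintype.linearCombination_apply_single, one_smul, B3 _ nmc.1 nmc.2, d5]
    by_cases k2 : e = bc
    · rw [k2, α2, map_sub, map_nsmul, Fintype.linearCombination_apply_single,
        Fintype.linearCombination_apply_single, one_smul, one_smul, map_sub, map_nsmul,
        B3 _ nab.1 nab.2, B3 _ nbb.1 nbb.2, ← d4, add_sub_cancel_right]
    · rw [α3 e k1 k2, Fintype.linearCombination_apply_single, one_smul, B3 e k1 k2]
  · intro e
    obtain ⟨e, rfl⟩ := t.surjective e
    by_cases k1 : e = ac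
    · rw [k1, β1, Fintype.linearCombination_apply_single, one_smul, A3 _ nma.1 nma.2, e5]
    by_cases k2 : e = bc
    · rw [k2, β2, map_sub, map_nsmul, Fintype.linearCombination_apply_single,
        Fintype.linearCombination_apply_single, one_smul, one_smul, map_sub, map_nsmul,
        A3 _ nab.1 nab.2, A3 _ nbc.1 nbc.2, ← e4, add_sub_cancel_left]
    · rw [β3 e k1 k2, Fintype.linearCombination_apply_single, one_smul, A3 e k1 k2]

theorem det_of_sameLink {D D' : LinkDiagram} (h : D.SameLink D') : D.det = D'.det := by
  induction h with
  | rel D D' h =>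
    rcases h with h | h | h | h
    · exact det_of_isForget_of_forall h (by simp) (by simp)
    · exact det_of_isR1 h
    · exact det_of_isR2 h
    · exact det_of_isR3 h
  | refl => rfl
  | symm _ _ _ ih => exact ih.symm
  | trans _ _ _ _ _ ih1 ih2 => exact ih1.trans ih2

end LinkDiagram

/-! ### Circuits of transition systems and determinants -/

section Circuits

variable {J : Type*} [Fintype J] [DecidableEq J]

/-- Expand and use antisymmetry. At a crossing with over-ends `a`, `b` and under-edges `u`, `v`, the
left side holds the rows of the two smoothings, and the right side the colouring relations `a = b`
and `2 b = u + v`. -/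
theorem alternating_two_rows {V : Type*} [AddCommGroup V] {F : V → V → ℤ}
    (h1 : ∀ x y z, F (x + y) z = F x z + F y z) (h2 : ∀ x y z, F x (y + z) = F x y + F x z)
    (h0 : ∀ x, F x x = 0) (a b u v : V) :
    F (a - u) (b - v) + F (a - v) (b - u) = F (a - b) (b + b - u - v) := by
  have s1 : ∀ x y z, F (x - y) z = F x z - F y z := fun x y z => by
    have := h1 (x - y) y z
    rw [sub_add_cancel] at this
    omega
  have s2 : ∀ x y z, F x (y - z) = F x y - F x z := fun x y z => by
    have := h2 x (y - z) z
    rw [sub_add_cancel] at this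
    omega
  have hs : ∀ x y, F x y + F y x = 0 := fun x y => by
    have := h0 (x + y)
    rw [h1, h2, h2, h0, h0] at this
    omega
  simp only [s1, s2, h2, h0]
  have := hs u v
  have := hs u b
  have := hs v b
  omega

theorem det_updateRow_two (M : Matrix J J ℤ) {i j : J} (hij : i ≠ j) (a b u v : J → ℤ) :
    ((M.updateRow i (a - u)).updateRow j (b - v)).det +
      ((M.updateRow i (a - v)).updateRow j (b - u)).det =
      ((M.updateRow i (a - b)).updateRow j (b + b - u - v)).det := by
  refine alternating_two_rows (F := fun r s => ((M.updateRow i r).updateRow j s).det)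
    (fun x y z => ?_) (fun x y z => Matrix.det_updateRow_add _ _ _ _) (fun x => ?_) a b u v
  · simp only [Matrix.updateRow_comm _ hij]
    exact Matrix.det_updateRow_add _ _ _ _
  · exact Matrix.det_zero_of_row_eq hij (by
      rw [Matrix.updateRow_ne hij, Matrix.updateRow_self, Matrix.updateRow_self])

theorem sum_update_bool {ι M : Type*} [Fintype ι] [DecidableEq ι] [AddCommMonoid M] (x : ι)
    (F : (ι → Bool) → M) :
    ∑ σ, (F (Function.update σ x true) + F (Function.update σ x false)) = 2 • ∑ σ, F σ := by
  have hinv : Function.Involutive fun σ : ι → Bool => Function.update σ x (!σ x) := fun σ => by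
    simp
  have h1 : ∀ σ : ι → Bool, F (Function.update σ x true) + F (Function.update σ x false) =
      F σ + F (Function.update σ x (!σ x)) := by
    intro σ
    cases h : σ x
    · rw [add_comm, ← h, Function.update_eq_self, h]; rfl
    · rw [← h, Function.update_eq_self, h]; rfl
  simp_rw [h1]
  rw [Finset.sum_add_distrib, two_nsmul]
  congr 1
  exact Equiv.sum_comp (Function.Involutive.toPerm _ hinv) F

variable {ι : Type*} [Fintype ι] [DecidableEq ι]

/-- The rows `a x - b x` and `2 b x - u x - v x` for `x ∈ S`, and for other `x` the rows
`a x - u x` and `b x - v x`, or with `u x` and `v x` exchanged. -/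
def transitionRows (a b u v : ι → ι × Bool → ℤ) (S : Finset ι) (σ : ι → Bool) :
    Matrix (ι × Bool) (ι × Bool) ℤ := fun p =>
  if p.2 then if p.1 ∈ S then a p.1 - b p.1 else a p.1 - (if σ p.1 then u p.1 else v p.1)
  else if p.1 ∈ S then b p.1 + b p.1 - u p.1 - v p.1
    else b p.1 - (if σ p.1 then v p.1 else u p.1)

theorem transitionRows_insert (a b u v : ι → ι × Bool → ℤ) {S : Finset ι} (σ : ι → Bool) {x : ι}
    (hx : x ∉ S) :
    (transitionRows a b u v S (Function.update σ x true)).det +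
      (transitionRows a b u v S (Function.update σ x false)).det =
      (transitionRows a b u v (insert x S) σ).det := by
  have h : ∀ (r s : ι × Bool → ℤ) (σ' : ι → Bool) (S' : Finset ι),
      (∀ y, y ≠ x → (y ∈ S' ↔ y ∈ S) ∧ σ' y = σ y) →
      transitionRows a b u v S' σ' (x, true) = r → transitionRows a b u v S' σ' (x, false) = s →
      transitionRows a b u v S' σ' =
        ((transitionRows a b u v S σ).updateRow (x, true) r).updateRow (x, false) s := by
    intro r s σ' S' h1 h2 h3
    funext ⟨y, o⟩
    by_cases hy : y = x
    · subst hy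
      cases o
      · rw [h3, Matrix.updateRow_self]
      · rw [h2, Matrix.updateRow_ne (by simp), Matrix.updateRow_self]
    · rw [Matrix.updateRow_ne (by simp [hy]), Matrix.updateRow_ne (by simp [hy])]
      simp only [transitionRows, (h1 y hy).1, (h1 y hy).2]
  have hne : ((x, true) : ι × Bool) ≠ (x, false) := by simp
  rw [h (a x - u x) (b x - v x) (Function.update σ x true) S
      (fun y hy => by simp [hy]) (by simp [transitionRows, hx]) (by simp [transitionRows, hx]),
    h (a x - v x) (b x - u x) (Function.update σ x false) S
      (fun y hy => by simp [hy]) (by simp [transitionRows, hx]) (by simp [transitionRows, hx]),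
    h (a x - b x) (b x + b x - u x - v x) σ (insert x S)
      (fun y hy => by simp [hy]) (by simp [transitionRows]) (by simp [transitionRows])]
  exact det_updateRow_two _ hne _ _ _ _

/-- Crossings are moved into `S` one at a time. The rows of a crossing in `S` no longer depend on
its smoothing, so each insertion doubles the sum over `σ`; this is the factor `2 ^ S.card`,
cancelled at the end. -/
theorem sum_det_transitionRows (a b u v : ι → ι × Bool → ℤ) (σ₀ : ι → Bool) :
    ∑ σ, (transitionRows a b u v ∅ σ).det =
      (transitionRows a b u v Finset.univ σ₀).det := by
  have key : ∀ S : Finset ι, 2 ^ S.card * ∑ σ, (transitionRows a b u v ∅ σ).det =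
      ∑ σ, (transitionRows a b u v S σ).det := by
    intro S
    induction S using Finset.induction_on with
    | empty => simp
    | insert x S hx ih =>
      rw [← Finset.sum_congr rfl fun σ _ => transitionRows_insert a b u v σ hx,
        sum_update_bool x (fun σ => (transitionRows a b u v S σ).det), ← ih,
        Finset.card_insert_of_notMem hx]
      simp only [nsmul_eq_mul, Nat.cast_ofNat]
      ring
  have h := key Finset.univ
  have hc : ∀ σ, transitionRows a b u v Finset.univ σ = transitionRows a b u v Finset.univ σ₀ := by
    intro σ
    funext p
    simp [transitionRows]
  rw [Finset.sum_congr rfl fun σ _ => congrArg Matrix.det (hc σ), Finset.sum_const,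
    Finset.card_univ, Finset.card_univ, Fintype.card_fun, Fintype.card_bool, nsmul_eq_mul, Nat.cast_pow, Nat.cast_ofNat] at h
  exact mul_left_cancel₀ (by positivity) h

open Classical in
-- For a single cycle, column operations and the order in which the cycle visits the points make the
-- matrix unitriangular. Otherwise a `P`-invariant function vanishing at `p₀` lies in the kernel.
theorem det_one_sub_perm_add_single (P : Equiv.Perm J) (p₀ : J) :
    (Matrix.of fun p => Pi.single p (1 : ℤ) - Pi.single (P p) 1 +
      if p = p₀ then Pi.single p₀ 1 else 0 : Matrix J J ℤ).det =
        if ∀ p, P.SameCycle p₀ p then 1 else 0 := by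
  set M : Matrix J J ℤ := Matrix.of fun p => Pi.single p (1 : ℤ) - Pi.single (P p) 1 +
      if p = p₀ then Pi.single p₀ 1 else 0 with hM
  have hMv : ∀ v p, (M.mulVec v) p = v p - v (P p) + if p = p₀ then v p₀ else 0 := by
    intro v p
    simp only [Matrix.mulVec, dotProduct, hM, Matrix.of_apply, Pi.add_apply, Pi.sub_apply,
      Pi.single_apply, add_mul, sub_mul, ite_mul, one_mul, zero_mul, Finset.sum_add_distrib,
      Finset.sum_sub_distrib, Finset.sum_ite_eq', Finset.mem_univ, if_true]
    split_ifs <;> simp [Pi.single_apply]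
  split_ifs with h
  -- The first time at which the orbit of `p₀` reaches `p`. Applying `P` increases it except on the
  -- return to `p₀`.
  · let τ : J → ℕ := fun p => Nat.find (h p).exists_nat_pow_eq
    have hτ : ∀ p, (P ^ τ p) p₀ = p := fun p => Nat.find_spec (h p).exists_nat_pow_eq
    have hτ' : ∀ p k, (P ^ k) p₀ = p → τ p ≤ k := fun p k hk =>
      Nat.find_min' (h p).exists_nat_pow_eq hk
    have hinj : Function.Injective τ := fun p q hpq => by rw [← hτ p, ← hτ q, hpq]
    have hlt : ∀ p, P p ≠ p₀ → τ p < τ (P p) := by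
      intro p hp
      obtain ⟨k, hk⟩ : ∃ k, τ (P p) = k + 1 := Nat.exists_eq_succ_of_ne_zero fun h0 => by
        have := hτ (P p)
        rw [h0] at this
        exact hp this.symm
      have := hτ (P p)
      rw [hk, pow_succ', Equiv.Perm.mul_apply] at this
      have := hτ' p k (P.injective this)
      omega
    have h0 : τ p₀ = 0 := Nat.le_zero.1 (hτ' p₀ 0 rfl)
    -- Adding all columns to column `p₀` replaces it by the row sums, which are `1` at `p₀` and `0`
    -- elsewhere.
    have hdet : M.det = (M.updateCol p₀ fun p => if p = p₀ then 1 else 0).det := by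
      have := Matrix.det_updateCol_sum M p₀ (fun _ => (1 : ℤ))
      rw [one_smul] at this
      rw [← this]
      congr 2
      funext p
      have := hMv (fun _ => 1) p
      simp only [Matrix.mulVec, dotProduct, mul_one] at this
      simp [this]
    rw [hdet]
    have hval : ∀ p q, (M.updateCol p₀ fun p => if p = p₀ then 1 else 0) p q =
        if q = p₀ then (if p = p₀ then 1 else 0) else
          (if q = p then 1 else 0) - (if q = P p then 1 else 0) := by
      intro p q
      rw [Matrix.updateCol_apply]
      by_cases hq : q = p₀
      · rw [if_pos hq, if_pos hq]
      · rw [if_neg hq, if_neg hq]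
        by_cases hp : p = p₀ <;>
          simp only [hM, Matrix.of_apply, Pi.add_apply, Pi.sub_apply, Pi.single_apply, hp, hq,
            if_true, if_false, add_zero, Pi.zero_apply]
    let _ : LinearOrder J := LinearOrder.lift' τ hinj
    rw [Matrix.det_of_isUpperTriangular]
    · refine Finset.prod_eq_one fun p _ => ?_
      rw [hval]
      by_cases hp : p = p₀
      · rw [if_pos hp, if_pos hp]
      · rw [if_neg hp, if_pos rfl, if_neg, sub_zero]
        intro hpp
        have := hlt p (hpp ▸ hp)
        rw [← hpp] at this
        exact lt_irrefl _ this
    · intro p q hqp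
      have hqp : τ q < τ p := hqp
      rw [hval]
      by_cases hq : q = p₀
      · rw [if_pos hq, if_neg]
        rintro rfl
        omega
      · rw [if_neg hq, if_neg, if_neg, sub_zero]
        · rintro rfl
          have := hlt p hq
          omega
        · rintro rfl
          omega
  · push Not at h
    obtain ⟨p₁, hp₁⟩ := h
    refine Matrix.exists_mulVec_eq_zero_iff.1 ⟨fun p => if P.SameCycle p₀ p then 0 else 1, ?_, ?_⟩
    · intro h0
      simpa [hp₁] using congrFun h0 p₁
    · funext p
      rw [hMv]
      simp [Equiv.Perm.sameCycle_apply_right, Equiv.Perm.SameCycle.refl]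

/-- For nonzero determinant this is the change of basis formula. For determinant `0`, a nonzero
index `k` would give `C * M = k • 1` for some integer matrix `C`, which is impossible; so the index
is infinite, recorded as `0`. -/
theorem index_closure_range_row (M : Matrix J J ℤ) :
    (AddSubgroup.closure (Set.range M)).index = M.det.natAbs := by
  have hspan : AddSubgroup.closure (Set.range M) =
      (Submodule.span ℤ (Set.range M)).toAddSubgroup :=
    (Submodule.span_int_eq_addSubgroupClosure _).symm
  by_cases hd : M.det = 0
  · rw [hd, Int.natAbs_zero]
    by_contra hk
    set k := (AddSubgroup.closure (Set.range M)).index with hk'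
    have : ∀ i : J, ∃ c : J → ℤ, ∑ j, c j • M j = k • Pi.single i 1 := by
      intro i
      have h := AddSubgroup.nsmul_index_mem (H := AddSubgroup.closure (Set.range M)) (Pi.single i 1)
      rw [hspan] at h
      exact (Submodule.mem_span_range_iff_exists_fun ℤ).1 (by rw [hk', hspan]; exact h)
    choose C hC using this
    have hCM : (Matrix.of C) * M = (k : ℤ) • (1 : Matrix J J ℤ) := by
      ext i j
      have := congrFun (hC i) j
      simp only [Finset.sum_apply, Pi.smul_apply, smul_eq_mul] at this
      rw [Matrix.mul_apply]
      simp only [Matrix.of_apply, Matrix.smul_apply, this, Matrix.one_apply, Pi.single_apply,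
        eq_comm]
      simp
    have := congrArg Matrix.det hCM
    rw [Matrix.det_mul, hd, mul_zero, Matrix.det_smul, Matrix.det_one, mul_one] at this
    exact pow_ne_zero _ (Nat.cast_ne_zero.2 hk) this.symm
  · have hli : LinearIndependent ℤ M := Matrix.linearIndependent_rows_of_det_ne_zero hd
    have h := Submodule.natAbs_det_basis_change (Pi.basisFun ℤ J) (Submodule.span ℤ (Set.range M))
      (Module.Basis.span hli)
    rw [hspan]
    refine Eq.trans h.symm ?_
    congr 1
    rw [Pi.basisFun_det]
    congr 1
    funext i
    exact congrArg Subtype.val (Module.Basis.span_apply hli i)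

/-- The multiples of a unit vector are a complement of the zero-sum group, so adjoining them to `L`
turns a relative index into an index in the whole lattice. -/
theorem index_sup_zmultiples_single {L : AddSubgroup (J → ℤ)} {Z : AddSubgroup (J → ℤ)}
    (hZ : ∀ v, v ∈ Z ↔ ∑ i, v i = 0) (hL : L ≤ Z) (p₀ : J) :
    (L ⊔ AddSubgroup.zmultiples (Pi.single p₀ 1 : J → ℤ)).index = L.relIndex Z := by
  set W := AddSubgroup.zmultiples (Pi.single p₀ 1 : J → ℤ)
  have htop : Z ⊔ (L ⊔ W) = ⊤ := by
    refine eq_top_iff.2 fun v _ => ?_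
    rw [← sub_add_cancel v ((∑ i, v i) • (Pi.single p₀ 1 : J → ℤ))]
    refine add_mem (AddSubgroup.mem_sup_left ((hZ _).2 ?_))
      (AddSubgroup.mem_sup_right (AddSubgroup.mem_sup_right ⟨∑ i, v i, rfl⟩))
    simp [Finset.sum_sub_distrib, ← Finset.mul_sum]
  have hW : W ⊓ Z = ⊥ := by
    refine eq_bot_iff.2 ?_
    rintro _ ⟨⟨k, rfl⟩, hk⟩
    have := (hZ _).1 hk
    have hk0 : k = 0 := by simpa [← Finset.mul_sum] using this
    simp [hk0]
  rw [← AddSubgroup.relIndex_top_right, ← htop, AddSubgroup.relIndex_sup_right,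
    ← AddSubgroup.inf_relIndex_right, sup_inf_assoc_of_le _ hL, hW, sup_bot_eq]

end Circuits

theorem setoid_sameCycle_eq {J : Type*} (P : Equiv.Perm J) :
    Equiv.Perm.SameCycle.setoid P = Relation.EqvGen.setoid fun p q => q = P p := by
  apply le_antisymm
  · rintro x _ ⟨i, rfl⟩
    have hx : ∀ y, Relation.EqvGen.setoid (fun p q => q = P p) y (P y) :=
      fun y => Relation.EqvGen.rel _ _ rfl
    induction i using Int.induction_on with
    | zero => exact Setoid.refl' _ _
    | succ i ih =>
      rw [zpow_add_one, ← (Commute.self_zpow P (i : ℤ)).eq, Equiv.Perm.mul_apply]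
      exact Setoid.trans' _ ih (hx _)
    | pred i ih =>
      refine Setoid.trans' _ ih (Setoid.symm' _ ?_)
      have := hx ((P ^ (-(i : ℤ) - 1)) x)
      rwa [← Equiv.Perm.mul_apply, ← zpow_one_add, add_sub_cancel] at this
  · refine Setoid.eqvGen_le ?_
    rintro x _ rfl
    exact ⟨1, by simp⟩

/-! ### The determinant of an alternating diagram counts its one-circle states -/

namespace LinkDiagram

/-- A diagram in which every edge has one end at an over-strand and one at an under-strand. -/
structure IsFullyAlternating (D : LinkDiagram) : Prop where
  overBijective : Function.Bijective fun p : Fin D.n × Bool => D.ends p.1 true p.2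
  underBijective : Function.Bijective fun p : Fin D.n × Bool => D.ends p.1 false p.2

theorem exists_ends_eq {D : LinkDiagram} (hp : D.pieces = 1) (hn : 0 < D.n) (e : Fin D.m) :
    ∃ x s o, e = D.ends x s o := by
  by_contra! he
  have hsub : Subsingleton (Quot D.EdgeAdj) := (Nat.card_eq_one_iff_unique.1 hp).1
  have h1 : Relation.EqvGen.setoid D.EdgeAdj ≤ ker fun f => f = e := by
    refine Setoid.eqvGen_le ?_
    rintro _ _ ⟨x, s, o, s', o', rfl, rfl⟩
    simp [Setoid.ker_def, (he _ _ _).symm]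
  have h2 : Relation.EqvGen.setoid D.EdgeAdj (D.ends ⟨0, hn⟩ true true) e :=
    Quot.eqvGen_exact (Subsingleton.elim _ _)
  have h3 : (D.ends ⟨0, hn⟩ true true = e) = (e = e) := h1 h2
  exact he ⟨0, hn⟩ true true (show _ = e by simpa using h3).symm

/-- Connectedness and the presence of a crossing exclude crossingless circles, so every edge has two
ends, and alternation makes one of them over and the other under. -/
theorem isFullyAlternating {D : LinkDiagram} (h : D.IsAlternatingDiagram) (hp : D.pieces = 1)
    (hn : 0 < D.n) : D.IsFullyAlternating := by
  have hatt := exists_ends_eq hp hn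
  have hrange : ∀ x s o, ∃ y t, D.ends x s o = D.ends y t (!o) := by
    intro x s o
    have : D.ends x s o ∈ Set.range fun p : Fin D.n × Bool => D.ends p.1 p.2 (!o) := by
      cases o
      · rw [Bool.not_false, D.ends_range]; exact ⟨(x, s), rfl⟩
      · rw [Bool.not_true, ← D.ends_range]; exact ⟨(x, s), rfl⟩
    obtain ⟨⟨y, t⟩, hy⟩ := this
    exact ⟨y, t, hy.symm⟩
  have halt : ∀ x s o y t, D.ends x s o = D.ends y t (!o) → t = !s := by
    intro x s o y t hxy
    cases o
    · rw [h y t x s hxy.symm, Bool.not_not]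
    · exact h x s y t hxy
  have key : ∀ s, Function.Bijective fun p : Fin D.n × Bool => D.ends p.1 s p.2 := by
    intro s
    constructor
    · rintro ⟨x, o⟩ ⟨y, o'⟩ hxy
      dsimp only at hxy
      by_cases ho : o' = o
      · subst ho
        rw [(D.ends_eq_iff.1 hxy).1]
      · have : o' = !o := by cases o <;> cases o' <;> simp_all
        rw [this] at hxy
        have := halt _ _ _ _ _ hxy
        simp at this
    · intro e
      obtain ⟨x, t, o, rfl⟩ := hatt e
      by_cases hts : t = s
      · exact ⟨(x, o), by rw [hts]⟩
      · obtain ⟨y, t', hy⟩ := hrange x t o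
        have h' := halt _ _ _ _ _ hy
        have : t' = s := by cases t <;> cases s <;> simp_all
        exact ⟨(y, !o), by rw [hy, this]⟩
  exact ⟨key true, key false⟩

namespace IsFullyAlternating

variable {D : LinkDiagram} (h : D.IsFullyAlternating)

/-- Over-ends as edges. -/
noncomputable def overEquiv : Fin D.n × Bool ≃ Fin D.m := Equiv.ofBijective _ h.overBijective

/-- Under-ends as edges. -/
noncomputable def underEquiv : Fin D.n × Bool ≃ Fin D.m := Equiv.ofBijective _ h.underBijective

/-- The involution that sends the over-ends to the under-ends that they are joined to. -/
def joinPerm (D : LinkDiagram) (σ : Fin D.n → Bool) : Equiv.Perm (Fin D.n × Bool) :=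
  Function.Involutive.toPerm
    (fun p => (p.1, if σ p.1 then p.2 != D.pos p.1 else p.2 == D.pos p.1)) fun p => by
      obtain ⟨x, o⟩ := p
      dsimp only
      cases σ x <;> cases D.pos x <;> cases o <;> rfl

/-- The permutation of the edges, named by their over-ends, that follows the circles of a state. -/
noncomputable def statePerm (σ : Fin D.n → Bool) : Equiv.Perm (Fin D.n × Bool) :=
  (joinPerm D σ).trans (h.underEquiv.trans h.overEquiv.symm)

theorem overEquiv_statePerm (σ : Fin D.n → Bool) (x : Fin D.n) (o : Bool) :
    h.overEquiv (h.statePerm σ (x, o)) =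
      D.ends x false (if σ x then o != D.pos x else o == D.pos x) := by
  rw [statePerm, Equiv.trans_apply, Equiv.trans_apply, Equiv.apply_symm_apply]
  rfl

theorem smoothing_rel_iff (σ : Fin D.n → Bool) (p q : Fin D.n × Bool) :
    (⨆ x, D.smoothing x (σ x)) (h.overEquiv p) (h.overEquiv q) ↔ (h.statePerm σ).SameCycle p q := by
  have : comap h.overEquiv (⨆ x, D.smoothing x (σ x)) =
      Equiv.Perm.SameCycle.setoid (h.statePerm σ) := by
    rw [setoid_sameCycle_eq, ← eqvGen_smoothAdj]
    apply le_antisymm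
    · intro p q hpq
      have hle : Relation.EqvGen.setoid (D.SmoothAdj σ) ≤ comap h.overEquiv.symm
          (Relation.EqvGen.setoid fun p q => q = h.statePerm σ p) := by
        refine Setoid.eqvGen_le ?_
        rintro _ _ ⟨x, o, rfl, rfl⟩
        rw [← h.overEquiv_statePerm, comap_rel, Equiv.symm_apply_apply]
        refine Relation.EqvGen.rel _ _ ?_
        congr 1
        exact (h.overEquiv.symm_apply_apply (x, o)).symm
      have := hle hpq
      rwa [comap_rel, Equiv.symm_apply_apply, Equiv.symm_apply_apply] at this
    · refine Setoid.eqvGen_le ?_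
      rintro ⟨x, o⟩ _ rfl
      rw [comap_rel]
      exact Relation.EqvGen.rel _ _ ⟨x, o, rfl, h.overEquiv_statePerm σ x o⟩
  rw [← Setoid.comap_rel, this]
  rfl

theorem loops_eq_one_iff (σ : Fin D.n → Bool) (p₀ : Fin D.n × Bool) :
    D.loops σ = 1 ↔ ∀ p, (h.statePerm σ).SameCycle p₀ p := by
  rw [loops_eq, classCount, Nat.card_eq_one_iff_unique, Quotient.subsingleton_iff]
  simp_rw [← h.smoothing_rel_iff]
  constructor
  · rintro ⟨h1, -⟩ p
    rw [h1]
    trivial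
  · intro h1
    refine ⟨Setoid.eq_top_iff.2 fun e f => ?_, ⟨Quotient.mk _ (h.overEquiv p₀)⟩⟩
    have he := h1 (h.overEquiv.symm e)
    have hf := h1 (h.overEquiv.symm f)
    rw [Equiv.apply_symm_apply] at he hf
    exact Setoid.trans' _ (Setoid.symm' _ he) hf

theorem exists_matrix_det_eq (h : D.IsFullyAlternating) (hn : 0 < D.n) :
    ∃ M : Matrix (Fin D.n × Bool) (Fin D.n × Bool) ℤ,
      M.det = ∑ σ, (if D.loops σ = 1 then 1 else 0) ∧ D.det = M.det.natAbs := by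
  let x₀ : Fin D.n := ⟨0, hn⟩
  let β : Fin D.n × Bool ≃ Fin D.n × Bool := h.underEquiv.trans h.overEquiv.symm
  let S (p : Fin D.n × Bool) : Fin D.n × Bool → ℤ := Pi.single p 1
  let w : Fin D.n × Bool → ℤ := S (x₀, true)
  -- The extra unit vector sits in the term `a x₀`, which occurs in the row `(x₀, true)` for either
  -- smoothing and also after merging.
  let a (x : Fin D.n) : Fin D.n × Bool → ℤ := S (x, true) + if x = x₀ then w else 0
  let b (x : Fin D.n) : Fin D.n × Bool → ℤ := S (x, false)
  let u (x : Fin D.n) : Fin D.n × Bool → ℤ := S (β (x, !D.pos x))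
  let v (x : Fin D.n) : Fin D.n × Bool → ℤ := S (β (x, D.pos x))
  set M := transitionRows a b u v Finset.univ fun _ => true with hM
  have hP : ∀ σ p, h.statePerm σ p =
      β (p.1, if σ p.1 then p.2 != D.pos p.1 else p.2 == D.pos p.1) := fun σ p => rfl
  have hdet : M.det = ∑ σ, (if D.loops σ = 1 then 1 else 0) := by
    rw [hM, ← sum_det_transitionRows]
    refine Finset.sum_congr rfl fun σ _ => ?_
    have h1 := det_one_sub_perm_add_single (h.statePerm σ) (x₀, true)
    simp only [← h.loops_eq_one_iff σ (x₀, true)] at h1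
    refine Eq.trans (congrArg Matrix.det ?_) (h1.trans (by congr))
    funext ⟨x, o⟩
    change transitionRows a b u v ∅ σ (x, o) = S (x, o) - S (h.statePerm σ (x, o)) +
      if (x, o) = (x₀, true) then w else 0
    rw [hP]
    cases o <;> cases hσ : σ x <;>
      simp [transitionRows, hσ, a, b, u, v, sub_add_eq_add_sub]
  refine ⟨M, hdet, ?_⟩
  let e : (Fin D.m → ℤ) ≃+ (Fin D.n × Bool → ℤ) :=
    (LinearEquiv.funCongrLeft ℤ ℤ h.overEquiv).toAddEquiv
  have he : ∀ p, e (Pi.single (h.overEquiv p) 1) = S p := by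
    intro p
    funext q
    change (Pi.single (h.overEquiv p) 1 : Fin D.m → ℤ) (h.overEquiv q) =
      (Pi.single p 1 : Fin D.n × Bool → ℤ) q
    simp [Pi.single_apply]
  have heo : ∀ x o, e (Pi.single (D.ends x true o) 1) = S (x, o) := fun x o => he (x, o)
  have heu : ∀ x o, e (Pi.single (D.ends x false o) 1) = S (β (x, o)) := by
    intro x o
    rw [← he, Equiv.trans_apply, Equiv.apply_symm_apply]
    rfl
  let Z : AddSubgroup (Fin D.n × Bool → ℤ) := D.zeroSum.map e.toAddMonoidHom
  let L : AddSubgroup (Fin D.n × Bool → ℤ) :=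
    (AddSubgroup.closure D.colouringRelations).map e.toAddMonoidHom
  have hZ : ∀ v, v ∈ Z ↔ ∑ i, v i = 0 := by
    intro v
    rw [AddSubgroup.mem_map_equiv]
    change ∑ i, (e.symm v) i = 0 ↔ _
    have : ∑ i, (e.symm v) i = ∑ i, v i := by
      rw [← Equiv.sum_comp h.overEquiv]
      exact Finset.sum_congr rfl fun i _ => congrFun (e.apply_symm_apply v) i
    rw [this]
  have hLo : ∀ x, S (x, true) - S (x, false) ∈ L := fun x => by
    rw [← neg_sub]
    refine neg_mem ⟨_, AddSubgroup.subset_closure ⟨x, .inl rfl⟩, ?_⟩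
    simp only [AddEquiv.toAddMonoidHom_eq_coe, AddMonoidHom.coe_coe, map_sub, heo]
  have hLu : ∀ x, S (β (x, false)) + S (β (x, true)) - 2 • S (x, true) ∈ L := fun x => by
    refine ⟨_, AddSubgroup.subset_closure ⟨x, .inr rfl⟩, ?_⟩
    simp only [AddEquiv.toAddMonoidHom_eq_coe, AddMonoidHom.coe_coe, map_sub, map_add, map_nsmul,
      heo, heu]
  have hL : L ≤ Z := by
    refine AddSubgroup.map_mono ((AddSubgroup.closure_le _).2 ?_)
    rintro _ ⟨x, rfl | rfl⟩
    · change ∑ e, _ = (0 : ℤ)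
      simp [Finset.sum_sub_distrib]
    · change ∑ e, _ = (0 : ℤ)
      simp [Finset.sum_sub_distrib, Finset.sum_add_distrib, ← Finset.mul_sum]
  have hMt : ∀ x, M (x, true) = a x - b x := fun x => by simp [hM, transitionRows]
  have hMf : ∀ x, M (x, false) = b x + b x - u x - v x := fun x => by simp [hM, transitionRows]
  have huv : ∀ x, u x + v x = S (β (x, false)) + S (β (x, true)) := by
    intro x
    simp only [u, v]
    cases D.pos x
    · exact add_comm _ _
    · rfl
  have hspan : AddSubgroup.closure (Set.range M) = L ⊔ AddSubgroup.zmultiples w := by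
    have hw : ∀ x, (if x = x₀ then w else 0) ∈ AddSubgroup.zmultiples w := by
      intro x
      split_ifs
      · exact AddSubgroup.mem_zmultiples w
      · exact zero_mem _
    have r1 : ∀ x, M (x, true) = (S (x, true) - S (x, false)) + if x = x₀ then w else 0 :=
      fun x => by rw [hMt]; simp only [a, b]; abel
    have r2 : ∀ x, M (x, false) = -(S (β (x, false)) + S (β (x, true)) - 2 • S (x, true)) -
        2 • (S (x, true) - S (x, false)) := fun x => by
      rw [hMf, sub_sub, huv]
      simp only [b]
      abel
    apply le_antisymm
    · rw [AddSubgroup.closure_le]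
      rintro _ ⟨⟨x, _ | _⟩, rfl⟩
      · rw [r2]
        exact AddSubgroup.mem_sup_left (sub_mem (neg_mem (hLu x)) (nsmul_mem (hLo x) 2))
      · rw [r1]
        exact add_mem (AddSubgroup.mem_sup_left (hLo x)) (AddSubgroup.mem_sup_right (hw x))
    · have hM' : ∀ p, M p ∈ AddSubgroup.closure (Set.range M) :=
        fun p => AddSubgroup.subset_closure ⟨p, rfl⟩
      have hwM : w ∈ AddSubgroup.closure (Set.range M) := by
        -- Since `β` permutes the edges, everything but `w` cancels in the sum of all rows. So `w`
        -- lies in the row lattice and can be separated from the relation at `x₀`.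
        have hsum : ∑ p, (M p : Fin D.n × Bool → ℤ) = w := by
          have h1 : ∑ p, S (β p) = ∑ p, S p := Equiv.sum_comp β S
          rw [Fintype.sum_prod_type, Fintype.sum_prod_type] at h1
          refine (Fintype.sum_prod_type fun p => M p).trans ?_
          simp only [Fintype.sum_bool, r1, r2] at h1 ⊢
          have h2 : ∀ x, S (x, true) - S (x, false) + (if x = x₀ then w else 0) +
              (-(S (β (x, false)) + S (β (x, true)) - 2 • S (x, true)) -
                2 • (S (x, true) - S (x, false))) =
              (if x = x₀ then w else 0) + (S (x, true) + S (x, false)) -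
                (S (β (x, true)) + S (β (x, false))) := fun x => by abel
          rw [Finset.sum_congr rfl fun x _ => h2 x, Finset.sum_sub_distrib, Finset.sum_add_distrib,
            h1]
          simp
        rw [← hsum]
        exact sum_mem fun p _ => hM' p
      have hwN : ∀ x, (if x = x₀ then w else 0) ∈ AddSubgroup.closure (Set.range M) := fun x =>
        (AddSubgroup.zmultiples_le.2 hwM) (hw x)
      have hoN : ∀ x, S (x, true) - S (x, false) ∈ AddSubgroup.closure (Set.range M) := fun x => by
        rw [← add_sub_cancel_right (S (x, true) - S (x, false)) (if x = x₀ then w else 0), ← r1]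
        exact sub_mem (hM' _) (hwN x)
      refine sup_le (AddSubgroup.map_le_iff_le_comap.2 ((AddSubgroup.closure_le _).2 ?_))
        (AddSubgroup.zmultiples_le.2 hwM)
      rintro _ ⟨x, rfl | rfl⟩
      · change e (_ - _) ∈ AddSubgroup.closure (Set.range M)
        rw [map_sub, heo, heo, ← neg_sub]
        exact neg_mem (hoN x)
      · change e (_ - _) ∈ AddSubgroup.closure (Set.range M)
        rw [map_sub, map_add, map_nsmul, heo, heu, heu]
        have : S (β (x, false)) + S (β (x, true)) - 2 • S (x, true) =
            -(M (x, false)) - 2 • (S (x, true) - S (x, false)) := by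
          rw [r2]; abel
        rw [this]
        exact sub_mem (neg_mem (hM' _)) (nsmul_mem (hoN x) 2)
  rw [← index_closure_range_row, hspan, index_sup_zmultiples_single hZ hL, det]
  exact (AddSubgroup.relIndex_map_map_of_injective _ _ e.injective).symm

theorem det_eq_card (h : D.IsFullyAlternating) (hn : 0 < D.n) :
    D.det = (Finset.univ.filter fun σ => D.loops σ = 1).card := by
  obtain ⟨M, h1, h2⟩ := h.exists_matrix_det_eq hn
  rw [h2, h1, Finset.sum_boole]
  simp

end IsFullyAlternating

end LinkDiagram

/-! ### Rank generating sums -/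

/-- A rank function of a matroid on `α`. -/
structure IsRank {α : Type*} [DecidableEq α] (r : Finset α → ℕ) : Prop where
  empty : r ∅ = 0
  le_insert (x : α) (F : Finset α) : r F ≤ r (insert x F)
  insert_le (x : α) (F : Finset α) : r (insert x F) ≤ r F + 1
  insert_eq {x : α} {F G : Finset α} (hFG : F ⊆ G) (h : r (insert x F) = r F) :
    r (insert x G) = r G

/-- The generating sum of a rank function. -/
def rankSum {α R : Type*} [CommSemiring R] (a b d : R) (E : Finset α) (r : Finset α → ℕ) : R :=
  ∑ F ∈ E.powerset, a ^ F.card * b ^ (E.card - F.card) * d ^ (r E + F.card - 2 * r F)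

namespace IsRank

variable {α : Type*} [DecidableEq α] {r : Finset α → ℕ}

theorem le_card (h : IsRank r) (F : Finset α) : r F ≤ F.card := by
  induction F using Finset.induction_on with
  | empty => simp [h.empty]
  | insert x F hx ih =>
    rw [Finset.card_insert_of_notMem hx]
    exact (h.insert_le x F).trans (Nat.succ_le_succ ih)

theorem mono (h : IsRank r) : Monotone r := by
  intro F G hFG
  rw [← Finset.sdiff_union_of_subset hFG]
  induction G \ F using Finset.induction_on with
  | empty => simp
  | insert x H _ ih => exact ih.trans (Finset.insert_union x H F ▸ h.le_insert x _)

theorem contract (h : IsRank r) (e : α) :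
    IsRank fun F => r (insert e F) - r {e} where
  empty := by simp
  le_insert x F := by
    rw [Finset.insert_comm]
    exact Nat.sub_le_sub_right (h.le_insert _ _) _
  insert_le x F := by
    have := h.insert_le x (insert e F)
    rw [Finset.insert_comm]
    omega
  insert_eq {x F G} hFG hx := by
    have h1 : ∀ H, r {e} ≤ r (insert e H) := fun H => h.mono (by simp)
    have := h.insert_eq (x := x) (Finset.insert_subset_insert e hFG)
    have h2 := h1 (insert x F)
    have h3 := h1 F
    rw [Finset.insert_comm x e F, Finset.insert_comm x e G] at this
    rw [this (by omega)]

variable {R : Type*} [CommSemiring R] (a b d : R) {e : α} {E : Finset α}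

/-- A loop never changes the rank, so the exponent of `d` grows by one exactly when the loop is
included. For a coloop it grows by one exactly when the coloop is omitted. -/
theorem rankSum_insert_of_loop (h : IsRank r) (he : e ∉ E) (h0 : r {e} = 0) :
    rankSum a b d (insert e E) r = (b + a * d) * rankSum a b d E r := by
  have hr : ∀ F, r (insert e F) = r F := fun F =>
    h.insert_eq (Finset.empty_subset F) (by rw [h.empty]; exact h0)
  rw [rankSum, Finset.sum_powerset_insert he, rankSum, add_mul, Finset.mul_sum, Finset.mul_sum]
  congr 1 <;> refine Finset.sum_congr rfl fun F hF => ?_ <;>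
    rw [Finset.mem_powerset] at hF <;> have hc := Finset.card_le_card hF
  · rw [hr, Finset.card_insert_of_notMem he, Nat.succ_sub hc, pow_succ]
    ring
  · have := h.mono hF
    have := h.le_card F
    rw [hr, hr, Finset.card_insert_of_notMem he,
      Finset.card_insert_of_notMem fun h' => he (hF h'), Nat.add_sub_add_right,
      show r E + (F.card + 1) - 2 * r F = (r E + F.card - 2 * r F) + 1 by omega]
    ring

theorem rankSum_insert_of_coloop (h : IsRank r) (he : e ∉ E) (h1 : r (insert e E) = r E + 1) :
    rankSum a b d (insert e E) r = (b * d + a) * rankSum a b d E r := by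
  have hr : ∀ F ⊆ E, r (insert e F) = r F + 1 := fun F hF => by
    have := h.insert_eq (x := e) hF
    have := h.le_insert e F
    have := h.insert_le e F
    omega
  rw [rankSum, Finset.sum_powerset_insert he, rankSum, add_mul, Finset.mul_sum, Finset.mul_sum]
  congr 1 <;> refine Finset.sum_congr rfl fun F hF => ?_ <;>
    rw [Finset.mem_powerset] at hF <;> have hc := Finset.card_le_card hF <;>
    have := h.mono hF <;> have := h.le_card F
  · rw [h1, Finset.card_insert_of_notMem he, Nat.succ_sub hc, pow_succ,
      show r E + 1 + F.card - 2 * r F = (r E + F.card - 2 * r F) + 1 by omega]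
    ring
  · rw [h1, hr F hF, Finset.card_insert_of_notMem he,
      Finset.card_insert_of_notMem fun h' => he (hF h'), Nat.add_sub_add_right,
      show r E + 1 + (F.card + 1) - 2 * (r F + 1) = r E + F.card - 2 * r F by omega]
    ring

theorem rankSum_insert (h : IsRank r) (he : e ∉ E) (h0 : r {e} = 1) (h1 : r (insert e E) = r E) :
    rankSum a b d (insert e E) r = b * rankSum a b d E r +
      a * rankSum a b d E fun F => r (insert e F) - r {e} := by
  rw [rankSum, Finset.sum_powerset_insert he, rankSum, rankSum, Finset.mul_sum, Finset.mul_sum]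
  congr 1 <;> refine Finset.sum_congr rfl fun F hF => ?_ <;>
    rw [Finset.mem_powerset] at hF <;> have hc := Finset.card_le_card hF <;>
    have := h.mono hF <;> have := h.le_card F
  · rw [h1, Finset.card_insert_of_notMem he, Nat.succ_sub hc, pow_succ]
    ring
  · have h2 := h.mono (show {e} ⊆ insert e F by simp)
    have h3 := h.mono (Finset.insert_subset_insert e hF)
    have h4 := h.insert_le e F
    rw [Finset.card_insert_of_notMem he,
      Finset.card_insert_of_notMem fun h' => he (hF h'), Nat.add_sub_add_right, h0,
      show r (insert e E) + (F.card + 1) - 2 * r (insert e F) =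
        r (insert e E) - 1 + F.card - 2 * (r (insert e F) - 1) by omega]
    ring

end IsRank

/-! ### Laurent polynomials with alternating coefficients -/

/-- The sum of the absolute values of the coefficients. -/
noncomputable def coeffNorm {G : Type*} (x : AddMonoidAlgebra ℤ G) : ℤ :=
  ∑ g ∈ x.coeff.support, |x.coeff g|

theorem coeffNorm_eq_sum {G : Type*} (x : AddMonoidAlgebra ℤ G) {s : Finset G}
    (hs : x.coeff.support ⊆ s) : coeffNorm x = ∑ g ∈ s, |x.coeff g| :=
  Finset.sum_subset hs fun g _ hg => by simpa using hg

theorem coeffNorm_neg {G : Type*} (x : AddMonoidAlgebra ℤ G) : coeffNorm (-x) = coeffNorm x := by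
  simp [coeffNorm, AddMonoidAlgebra.coeff_neg]

theorem coeffNorm_mapDomain {G H : Type*} {f : G → H} (hf : Function.Injective f)
    (x : AddMonoidAlgebra ℤ G) : coeffNorm (AddMonoidAlgebra.mapDomain f x) = coeffNorm x := by
  classical
  rw [coeffNorm, AddMonoidAlgebra.mapDomain, AddMonoidAlgebra.coeff_ofCoeff,
    Finsupp.mapDomain_support_of_injective hf, Finset.sum_image hf.injOn]
  simp only [Finsupp.mapDomain_apply hf, coeffNorm]

theorem coeff_T_mul (i j : ℤ) (x : ℤ[T;T⁻¹]) : (T i * x).coeff j = x.coeff (j - i) := by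
  rw [T, AddMonoidAlgebra.coeff_single_mul_apply, one_mul, neg_add_eq_sub]

theorem T_mul_eq_mapDomain (i : ℤ) (x : ℤ[T;T⁻¹]) :
    T i * x = AddMonoidAlgebra.mapDomain (i + ·) x := by
  ext j
  obtain ⟨k, rfl⟩ : ∃ k, j = i + k := ⟨j - i, by ring⟩
  rw [coeff_T_mul, add_sub_cancel_left, AddMonoidAlgebra.mapDomain, AddMonoidAlgebra.coeff_ofCoeff,
    Finsupp.mapDomain_apply (add_right_injective i)]

theorem coeffNorm_T_mul (i : ℤ) (x : ℤ[T;T⁻¹]) : coeffNorm (T i * x) = coeffNorm x := by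
  rw [T_mul_eq_mapDomain, coeffNorm_mapDomain (add_right_injective i)]

/-- The coefficient of degree `ρ + 4 k + i`, where `0 ≤ i < 4`, has the sign of `(-1) ^ k`. -/
def IsAlternatingFrom (ρ : ℤ) (x : ℤ[T;T⁻¹]) : Prop :=
  ∀ j, 0 ≤ (((j - ρ) / 4).negOnePow : ℤ) * x.coeff j

namespace IsAlternatingFrom

variable {ρ : ℤ} {x y : ℤ[T;T⁻¹]}

theorem add (hx : IsAlternatingFrom ρ x) (hy : IsAlternatingFrom ρ y) :
    IsAlternatingFrom ρ (x + y) := fun j => by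
  rw [AddMonoidAlgebra.coeff_add, Finsupp.add_apply, mul_add]
  exact add_nonneg (hx j) (hy j)

theorem coeffNorm_add (hx : IsAlternatingFrom ρ x) (hy : IsAlternatingFrom ρ y) :
    coeffNorm (x + y) = coeffNorm x + coeffNorm y := by
  classical
  have habs : ∀ {z}, IsAlternatingFrom ρ z → ∀ j,
      |z.coeff j| = (((j - ρ) / 4).negOnePow : ℤ) * z.coeff j := fun hz j => by
    rw [← abs_of_nonneg (hz j), abs_mul, Int.abs_negOnePow, one_mul]
  rw [coeffNorm_eq_sum x (Finset.subset_union_left (s₂ := y.coeff.support)),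
    coeffNorm_eq_sum y (Finset.subset_union_right (s₁ := x.coeff.support)),
    coeffNorm_eq_sum (x + y) (s := x.coeff.support ∪ y.coeff.support)
      (by rw [AddMonoidAlgebra.coeff_add]; exact Finsupp.support_add),
    ← Finset.sum_add_distrib]
  refine Finset.sum_congr rfl fun j _ => ?_
  rw [habs hx, habs hy, habs (hx.add hy), AddMonoidAlgebra.coeff_add, Finsupp.add_apply, mul_add]

theorem T_mul (hx : IsAlternatingFrom ρ x) (i : ℤ) : IsAlternatingFrom (ρ + i) (T i * x) :=
  fun j => by
    rw [coeff_T_mul, show j - (ρ + i) = j - i - ρ by ring]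
    exact hx (j - i)

theorem neg_iff : IsAlternatingFrom (ρ + 4) (-x) ↔ IsAlternatingFrom ρ x := forall_congr' fun j => by
  rw [AddMonoidAlgebra.coeff_neg, Finsupp.neg_apply, show j - (ρ + 4) = j - ρ + (-1) * 4 by ring,
    Int.add_mul_ediv_right _ _ (by norm_num), Int.negOnePow_add]
  simp

end IsAlternatingFrom

/-- A loop contributes the factor `-A³`, a coloop `-A⁻³`. In the remaining case the deletion times
`A⁻¹` and the contraction times `A` alternate from the same degree, so nothing cancels and the norms
add. The sum `rankSum 1 1 0`, which counts bases, satisfies the same recursion. -/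
theorem isAlternatingFrom_rankSum {α : Type*} [DecidableEq α] (E : Finset α) {r : Finset α → ℕ}
    (h : IsRank r) :
    IsAlternatingFrom (2 * r E - E.card) (rankSum (T 1) (T (-1)) (-T 2 - T (-2)) E r) ∧
      coeffNorm (rankSum (T 1) (T (-1)) (-T 2 - T (-2)) E r) =
        (rankSum 1 1 0 E r : ℕ) := by
  induction E using Finset.induction_on generalizing r with
  | empty =>
    simp only [rankSum, Finset.powerset_empty, Finset.sum_singleton, Finset.card_empty, h.empty]
    constructor
    · intro j
      simp only [mul_zero, Nat.sub_zero, add_zero, pow_zero, one_mul]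
      rw [← T_zero, T_apply]
      split_ifs with hj
      · simp [← hj]
      · simp
    · simp only [mul_zero, Nat.sub_zero, add_zero, pow_zero, one_mul]
      rw [← T_zero, coeffNorm, T, AddMonoidAlgebra.coeff_single,
        Finsupp.support_single _ one_ne_zero]
      simp
  | insert e E he ih =>
    have hT : ∀ i j, (T i * T j : ℤ[T;T⁻¹]) = T (i + j) := T_mul_T
    rw [Finset.card_insert_of_notMem he]
    push_cast
    by_cases h0 : r {e} = 0
    · have h2 : (T (-1) + T 1 * (-T 2 - T (-2)) : ℤ[T;T⁻¹]) = -T 3 := by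
        rw [mul_sub, mul_neg, hT, hT]; norm_num
      have hr : r (insert e E) = r E :=
        h.insert_eq (Finset.empty_subset E) (by rw [h.empty]; exact h0)
      rw [h.rankSum_insert_of_loop _ _ _ he h0, h.rankSum_insert_of_loop _ _ _ he h0, h2, neg_mul,
        coeffNorm_neg, coeffNorm_T_mul, hr]
      refine ⟨?_, by simpa using (ih h).2⟩
      -- The factor `A³` moves the reference degree by `3` and the sign moves it by `4`, in total by
      -- `-1` as the new cardinality demands.
      rw [← IsAlternatingFrom.neg_iff, neg_neg]
      have := (ih h).1.T_mul 3
      convert this using 1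
      ring
    by_cases h1 : r (insert e E) = r E
    · have h0 : r {e} = 1 := by
        have := h.insert_le e ∅
        rw [h.empty] at this
        change r {e} ≤ _ at this
        omega
      have ih1 := ih h
      have ih2 := ih (h.contract e)
      have hd := ih1.1.T_mul (-1)
      have hc := ih2.1.T_mul 1
      have hle := h.mono (show {e} ⊆ insert e E by simp)
      have ih2' := ih2.2
      rw [h0] at ih2'
      rw [h0, Nat.cast_sub (h0 ▸ hle), Nat.cast_one,
        show 2 * ((r (insert e E) : ℤ) - 1) - E.card + 1 = 2 * r E - E.card + -1 by
          rw [h1]; ring] at hc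
      rw [h.rankSum_insert _ _ _ he h0 h1, h.rankSum_insert _ _ _ he h0 h1, h0]
      rw [hd.coeffNorm_add hc, coeffNorm_T_mul, coeffNorm_T_mul, ih1.2, ih2', h1]
      refine ⟨?_, by push_cast; ring⟩
      have := hd.add hc
      convert this using 1
      ring
    · have h1 : r (insert e E) = r E + 1 := by
        have := h.insert_le e E
        have := h.le_insert e E
        omega
      have h2 : (T (-1) * (-T 2 - T (-2)) + T 1 : ℤ[T;T⁻¹]) = -T (-3) := by
        rw [mul_sub, mul_neg, hT, hT]; norm_num; abel
      rw [h.rankSum_insert_of_coloop _ _ _ he h1, h.rankSum_insert_of_coloop _ _ _ he h1, h2,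
        neg_mul, coeffNorm_neg, coeffNorm_T_mul, h1]
      refine ⟨?_, by simpa using (ih h).2⟩
      have := IsAlternatingFrom.neg_iff.2 ((ih h).1.T_mul (-3))
      convert this using 1
      push_cast
      ring

/-! ### Circles of states and the matroid of crossings -/

theorem Setoid.classCount_anti {E : Type*} [Finite E] {r s : Setoid E} (h : r ≤ s) :
    s.classCount ≤ r.classCount :=
  Nat.card_le_card_of_surjective (Setoid.map_of_le h) fun q =>
    Quotient.inductionOn q fun x => ⟨Quotient.mk r x, rfl⟩

/-- Started at `p`, the product follows the `P`-orbit of `q`. This orbit never meets `p`, so it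
closes up at `q`. -/
theorem Equiv.Perm.SameCycle.of_mul_swap {J : Type*} [Finite J] [DecidableEq J] {P : Equiv.Perm J}
    {p q : J} (h : ¬ P.SameCycle p q) : (P * Equiv.swap p q).SameCycle p q := by
  have key : ∀ i : ℕ, (P * Equiv.swap p q).SameCycle p q ∨
      ((P * Equiv.swap p q) ^ (i + 1)) p = (P ^ (i + 1)) q := by
    intro i
    induction i with
    | zero => simp
    | succ i ih =>
      refine ih.elim Or.inl fun ih => ?_
      by_cases hq : (P ^ (i + 1)) q = q
      · exact .inl ⟨(i + 1 : ℕ), by rw [zpow_natCast, ih, hq]⟩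
      · have hp : (P ^ (i + 1)) q ≠ p := fun h' =>
          h (Equiv.Perm.SameCycle.symm ⟨(i + 1 : ℕ), by rw [zpow_natCast, h']⟩)
        right
        rw [pow_succ', Equiv.Perm.mul_apply, ih, Equiv.Perm.mul_apply,
          Equiv.swap_apply_of_ne_of_ne hp hq, pow_succ' P (i + 1), Equiv.Perm.mul_apply]
  refine (key (orderOf P - 1)).elim id fun h' => ⟨(orderOf P : ℕ), ?_⟩
  rw [Nat.sub_add_cancel (orderOf_pos P), pow_orderOf_eq_one, Equiv.Perm.one_apply] at h'
  rw [zpow_natCast, h']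

namespace LinkDiagram

/-- The relation that glues the two ends of the over-strand of a crossing. -/
def overGlue (D : LinkDiagram) (x : Fin D.n) : Setoid (Fin D.m) :=
  pair (D.ends x true true) (D.ends x true false)

/-- The circles of the all-B state, glued at the crossings in `F`. -/
noncomputable def gluedCircles (D : LinkDiagram) (F : Finset (Fin D.n)) : Setoid (Fin D.m) :=
  (⨆ x, D.smoothing x false) ⊔ F.sup D.overGlue

theorem gluedCircles_insert (D : LinkDiagram) (x : Fin D.n) (F : Finset (Fin D.n)) :
    D.gluedCircles (insert x F) = D.gluedCircles F ⊔ D.overGlue x := by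
  rw [gluedCircles, gluedCircles, Finset.sup_insert, sup_comm (D.overGlue x), sup_assoc]

theorem gluedCircles_mono (D : LinkDiagram) : Monotone D.gluedCircles := fun _ _ h =>
  sup_le_sup_left (Finset.sup_mono h) _

/-- The matroid rank of a set of crossings. -/
noncomputable def crossingRank (D : LinkDiagram) (F : Finset (Fin D.n)) : ℕ :=
  (D.gluedCircles ∅).classCount - (D.gluedCircles F).classCount

/-- This is a graphic matroid: the vertices are the all-B circles, and a crossing is the edge
between the circles through its two over-ends. -/
theorem isRank_crossingRank (D : LinkDiagram) : IsRank D.crossingRank := by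
  have h0 : ∀ F, (D.gluedCircles F).classCount ≤ (D.gluedCircles ∅).classCount := fun F =>
    classCount_anti (D.gluedCircles_mono (Finset.empty_subset F))
  have h1 : ∀ x F, (D.gluedCircles (insert x F)).classCount ≤ (D.gluedCircles F).classCount ∧
      (D.gluedCircles F).classCount ≤ (D.gluedCircles (insert x F)).classCount + 1 := fun x F => by
    rw [gluedCircles_insert]
    exact classCount_sup_pair_le _ _ _
  refine ⟨Nat.sub_self _, fun x F => ?_, fun x F => ?_, fun {x F G} hFG h => ?_⟩
  · have := h1 x F
    simp only [crossingRank]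
    omega
  · have := h1 x F
    simp only [crossingRank]
    omega
  · have hx : D.gluedCircles F (D.ends x true true) (D.ends x true false) := by
      by_contra hx
      have := classCount_sup_pair hx
      rw [← overGlue, ← gluedCircles_insert] at this
      have := h0 F
      simp only [crossingRank] at h
      omega
    rw [crossingRank, gluedCircles_insert, overGlue,
      sup_pair_of_rel (D.gluedCircles_mono hFG hx), crossingRank]

/-- Once the over-ends are glued, either smoothing connects all four ends. -/
theorem smoothing_le (D : LinkDiagram) (x : Fin D.n) (b b' : Bool) :
    D.smoothing x b ≤ D.smoothing x b' ⊔ D.overGlue x := by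
  have : ∀ s, D.smoothing x b' ⊔ D.overGlue x ≤ s → D.smoothing x b ≤ s := fun s => by
    simp only [smoothing, overGlue, sup_le_iff, pair_le]
    cases D.pos x <;> cases b <;> cases b' <;> simp <;> grind
  exact this _ le_rfl

theorem iSup_smoothing_le (D : LinkDiagram) {x : Fin D.n} {σ σ' : Fin D.n → Bool}
    (h : ∀ y ≠ x, σ y = σ' y) :
    (⨆ y, D.smoothing y (σ y)) ≤ (⨆ y, D.smoothing y (σ' y)) ⊔ D.overGlue x := by
  refine iSup_le fun y => ?_
  by_cases hy : y = x
  · subst hy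
    exact (D.smoothing_le y _ _).trans
      (sup_le_sup_right (le_iSup (fun z => D.smoothing z (σ' z)) y) _)
  · rw [h y hy]
    exact le_sup_of_le_left (le_iSup (fun z => D.smoothing z (σ' z)) y)

theorem iSup_smoothing_le_gluedCircles (D : LinkDiagram) (F : Finset (Fin D.n)) :
    (⨆ y, D.smoothing y (decide (y ∈ F))) ≤ D.gluedCircles F := by
  refine iSup_le fun y => ?_
  have h1 : D.smoothing y false ≤ D.gluedCircles F :=
    le_sup_of_le_left (le_iSup (fun y => D.smoothing y false) y)
  by_cases hy : y ∈ F
  · exact (D.smoothing_le y _ false).trans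
      (sup_le h1 (le_sup_of_le_right (Finset.le_sup (f := D.overGlue) hy)))
  · simpa [hy] using h1

theorem loops_pos {D : LinkDiagram} (hn : 0 < D.n) (σ : Fin D.n → Bool) : 0 < D.loops σ := by
  have : Nonempty (Fin D.m) := ⟨D.ends ⟨0, hn⟩ true true⟩
  rw [loops_eq]
  exact classCount_pos _

namespace IsFullyAlternating

variable {D : LinkDiagram} (h : D.IsFullyAlternating)

include h

theorem statePerm_eq_mul_swap {x : Fin D.n} {σ σ' : Fin D.n → Bool} (hx : σ' x = !σ x)
    (hσ : ∀ y ≠ x, σ y = σ' y) :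
    h.statePerm σ' = h.statePerm σ * Equiv.swap (x, true) (x, false) := by
  have hP : ∀ σ p, h.statePerm σ p = (h.underEquiv.trans h.overEquiv.symm)
      (p.1, if σ p.1 then p.2 != D.pos p.1 else p.2 == D.pos p.1) := fun σ p => rfl
  ext1 ⟨y, o⟩
  rw [Equiv.Perm.mul_apply, hP, hP]
  by_cases hy : y = x
  · subst hy
    congr 1
    cases o
    · rw [Equiv.swap_apply_right]
      simp only [hx]
      cases σ y <;> cases D.pos y <;> rfl
    · rw [Equiv.swap_apply_left]
      simp only [hx]
      cases σ y <;> cases D.pos y <;> rfl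
  · rw [Equiv.swap_apply_of_ne_of_ne (by simp [hy]) (by simp [hy])]
    simp only [hσ y hy]

/-- Changing one smoothing multiplies the state permutation by a transposition, which merges two
different cycles. The coherent orientation of the circles enters here. -/
theorem loops_flip_of_not_rel {x : Fin D.n} {σ σ' : Fin D.n → Bool} (hx : σ' x = !σ x)
    (hσ : ∀ y ≠ x, σ y = σ' y)
    (hr : ¬ (⨆ y, D.smoothing y (σ y)) (D.ends x true true) (D.ends x true false)) :
    D.loops σ' + 1 = D.loops σ := by
  have h1 : (⨆ y, D.smoothing y (σ' y)) (D.ends x true true) (D.ends x true false) := by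
    refine (h.smoothing_rel_iff σ' (x, true) (x, false)).2 ?_
    rw [h.statePerm_eq_mul_swap hx hσ]
    exact Equiv.Perm.SameCycle.of_mul_swap fun h' =>
      hr ((h.smoothing_rel_iff σ (x, true) (x, false)).2 h')
  have h2 := classCount_sup_pair hr
  have h3 : (⨆ y, D.smoothing y (σ y)) ⊔ D.overGlue x = ⨆ y, D.smoothing y (σ' y) := by
    have h4 : (⨆ y, D.smoothing y (σ' y)) ⊔ D.overGlue x = ⨆ y, D.smoothing y (σ' y) :=
      sup_pair_of_rel h1
    apply le_antisymm
    · exact sup_le ((D.iSup_smoothing_le hσ).trans h4.le) (pair_le_iff.2 h1)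
    · exact D.iSup_smoothing_le fun y hy => (hσ y hy).symm
  rw [overGlue] at h3
  rw [loops_eq, loops_eq, ← h3, h2]

omit h in
-- After gluing the over-ends of `x` the two states have the same classes, and gluing costs at most
-- one class.
theorem loops_flip_le {x : Fin D.n} {σ σ' : Fin D.n → Bool} (hσ : ∀ y ≠ x, σ y = σ' y) :
    D.loops σ' ≤ D.loops σ + 1 := by
  have h1 := classCount_anti (sup_le (D.iSup_smoothing_le hσ)
    (le_sup_right : D.overGlue x ≤ (⨆ y, D.smoothing y (σ' y)) ⊔ D.overGlue x))
  have h2 := classCount_sup_pair_le (⨆ y, D.smoothing y (σ y)) (D.ends x true true)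
    (D.ends x true false)
  have h4 := classCount_anti (sup_le (D.iSup_smoothing_le fun y hy => (hσ y hy).symm)
    (le_sup_right : D.overGlue x ≤ (⨆ y, D.smoothing y (σ y)) ⊔ D.overGlue x))
  have h3 := classCount_sup_pair_le (⨆ y, D.smoothing y (σ' y)) (D.ends x true true)
    (D.ends x true false)
  simp only [overGlue] at h1 h4
  rw [loops_eq, loops_eq]
  omega

/-- The defect `2 k(F) + |F| - L(F)` does not decrease when `F` grows. -/
theorem defect_mono {F G : Finset (Fin D.n)} (hFG : F ⊆ G) :
    2 * ((D.gluedCircles F).classCount : ℤ) + F.card - D.loops (fun y => decide (y ∈ F)) ≤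
      2 * ((D.gluedCircles G).classCount : ℤ) + G.card - D.loops (fun y => decide (y ∈ G)) := by
  rw [← Finset.sdiff_union_of_subset hFG]
  have hdis : ∀ y ∈ G \ F, y ∉ F := fun y hy => (Finset.mem_sdiff.1 hy).2
  generalize G \ F = H at hdis ⊢
  induction H using Finset.induction_on with
  | empty => simp
  | insert x H hxH ih =>
    refine (ih fun y hy => hdis y (Finset.mem_insert_of_mem hy)).trans ?_
    have hx : x ∉ H ∪ F := by simp [hxH, hdis x]
    rw [Finset.insert_union]
    generalize H ∪ F = F' at hx
    have hσ : ∀ y ≠ x, decide (y ∈ F') = decide (y ∈ insert x F') := fun y hy => by simp [hy]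
    rw [Finset.card_insert_of_notMem hx, gluedCircles_insert]
    -- If the over-ends are already glued, `k` is unchanged while `L` grows by at most `1`, no more
    -- than the cardinality. Otherwise `k` and `L` both drop by `1` and the defect is unchanged.
    by_cases hr : D.gluedCircles F' (D.ends x true true) (D.ends x true false)
    · have := loops_flip_le hσ
      rw [overGlue, sup_pair_of_rel hr]
      push_cast
      omega
    · have := h.loops_flip_of_not_rel (by simp [hx]) hσ
        fun h' => hr (D.iSup_smoothing_le_gluedCircles F' h')
      have := classCount_sup_pair hr
      rw [overGlue]
      push_cast
      omega

/-- The regions correspond to the circles of the two extreme states. -/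
theorem regions_eq : D.regions = D.loops (fun _ => true) + D.loops (fun _ => false) := by
  -- The value `o e` tells whether `e` leaves its over-end, so `l != o e` says whether the side `l`
  -- is on the right when `e` is walked from its over-end to its under-end. This is constant around
  -- a region; right sides trace the all-A circles and left sides the all-B circles.
  let o : Fin D.m → Bool := fun e => (h.overEquiv.symm e).2
  have ho : ∀ x b, o (D.ends x true b) = b := fun x b =>
    congrArg Prod.snd (h.overEquiv.symm_apply_apply (x, b))
  have hu : ∀ x b, o (D.ends x false b) = !b := by
    intro x b
    obtain ⟨⟨y, c⟩, hy⟩ := h.overBijective.2 (D.ends x false b)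
    rw [← hy, ho]
    rcases Bool.eq_or_eq_not c b with rfl | h'
    · have := @D.ends_injective c (y, true) (x, false) hy
      simp at this
    · exact h'
  let e : Quot D.SideAdj ≃ (t : Bool) × Quot (D.SmoothAdj fun _ => t) :=
    { toFun := Quot.lift (fun a => ⟨a.2 != o a.1, Quot.mk _ a.1⟩) (by
        rintro ⟨_, l⟩ ⟨_, k⟩ ⟨x, b, u, ⟨h1, h2⟩, rfl, rfl⟩
        dsimp only at h1 h2 ⊢
        have h3 : (k != o (D.ends x false u)) = (l != o (D.ends x true b)) := by
          rw [ho, hu, h1, h2]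
          cases b <;> cases l <;> cases D.pos x <;> rfl
        rw [h3]
        refine congrArg (Sigma.mk _) (Quot.sound ⟨x, b, rfl, ?_⟩)
        rw [ho, h1]
        congr 1
        cases b <;> cases l <;> cases D.pos x <;> rfl)
      invFun := fun q => Quot.lift (fun e => Quot.mk _ (e, q.1 != o e)) (by
        rintro _ _ ⟨x, b, rfl, rfl⟩
        refine Quot.sound ⟨x, b, _, ⟨?_, ?_⟩, rfl, rfl⟩
        · rw [ho]
          cases b <;> cases q.1 <;> cases D.pos x <;> rfl
        · rw [hu]
          cases b <;> cases q.1 <;> cases D.pos x <;> rfl) q.2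
      left_inv := by
        rintro ⟨⟨e, l⟩⟩
        refine congrArg (fun l => Quot.mk _ (e, l)) ?_
        dsimp only
        cases l <;> cases o e <;> rfl
      right_inv := by
        rintro ⟨t, ⟨e⟩⟩
        have : ((t != o e) != o e) = t := by cases t <;> cases o e <;> rfl
        change (⟨(t != o e) != o e, Quot.mk _ e⟩ : (t : Bool) × Quot (D.SmoothAdj fun _ => t)) = _
        rw [this] }
  rw [LinkShadow.regions, Nat.card_congr e, Nat.card_sigma]
  simp [loops]

/-- The defect of `defect_mono` is monotone and equal at both extremes, hence constant. At `∅` it is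
`k(∅)`, the number of all-B circles. At the full set it is `2 + n` minus the number of all-A
circles, which is again the number of all-B circles by `regions_eq` and planarity. -/
theorem loops_eq_crossingRank (hp : D.pieces = 1) (hn : 0 < D.n) (F : Finset (Fin D.n)) :
    D.loops (fun y => decide (y ∈ F)) - 1 =
      D.crossingRank Finset.univ + F.card - 2 * D.crossingRank F := by
  have hne : Nonempty (Fin D.m) := ⟨D.ends ⟨0, hn⟩ true true⟩
  have h0 : D.loops (fun y => decide (y ∈ (∅ : Finset (Fin D.n)))) =
      (D.gluedCircles ∅).classCount := by
    simp [loops_eq, gluedCircles]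
  have h0' : D.loops (fun _ => false) = (D.gluedCircles ∅).classCount := by
    simp [loops_eq, gluedCircles]
  have h1 : (D.gluedCircles Finset.univ).classCount ≤ 1 := by
    have hle : Relation.EqvGen.setoid D.EdgeAdj ≤ D.gluedCircles Finset.univ := by
      refine Setoid.eqvGen_le ?_
      have hs : ∀ x, D.smoothing x false ⊔ D.overGlue x ≤ D.gluedCircles Finset.univ := fun x =>
        sup_le_sup (le_iSup (fun x => D.smoothing x false) x)
          (Finset.le_sup (f := D.overGlue) (Finset.mem_univ x))
      rintro _ _ ⟨x, s, o, s', o', rfl, rfl⟩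
      rw [← pair_le_iff]
      refine le_trans ?_ (hs x)
      have : ∀ t, D.smoothing x false ⊔ D.overGlue x ≤ t →
          pair (D.ends x s o) (D.ends x s' o') ≤ t := fun t => by
        simp only [smoothing, overGlue, sup_le_iff, pair_le]
        cases D.pos x <;> cases s <;> cases o <;> cases s' <;> cases o' <;> simp <;> grind
      exact this _ le_rfl
    have := classCount_anti hle
    rwa [← card_quot, ← LinkShadow.pieces, hp] at this
  have h2 : 0 < (D.gluedCircles Finset.univ).classCount := classCount_pos _
  have h3 := h.defect_mono (Finset.empty_subset F)
  have h4 := h.defect_mono (Finset.subset_univ F)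
  have h5 := h.regions_eq
  have h6 := D.planar
  have h7 := loops_pos hn fun y => decide (y ∈ F)
  have h8 := classCount_anti (D.gluedCircles_mono (Finset.empty_subset F))
  have h9 := classCount_anti (D.gluedCircles_mono (Finset.subset_univ F))
  simp only [h0, Finset.card_empty] at h3
  simp only [Finset.mem_univ, decide_true, Finset.card_univ, Fintype.card_fin] at h4
  rw [h6, hp, h0'] at h5
  simp only [crossingRank]
  omega

theorem bracket_eq_rankSum (hp : D.pieces = 1) (hn : 0 < D.n) :
    D.bracket = rankSum (T 1) (T (-1)) (-T 2 - T (-2)) Finset.univ D.crossingRank := by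
  rw [bracket, rankSum, Finset.powerset_univ]
  refine Finset.sum_bij' (fun σ _ => Finset.univ.filter fun x => σ x = true)
    (fun F _ x => decide (x ∈ F)) (by simp) (by simp) (by simp) (by simp) fun σ _ => ?_
  have h1 := h.loops_eq_crossingRank hp hn (Finset.univ.filter fun x => σ x = true)
  simp only [Finset.mem_filter, Finset.mem_univ, true_and, Bool.decide_eq_true] at h1
  rw [h1, T_pow, T_pow, T_mul_T]
  congr 2
  rw [Finset.sum_ite, Finset.sum_const, Finset.sum_const, Finset.filter_not,
    Finset.card_sdiff_of_subset (Finset.filter_subset _ _), nsmul_eq_mul, nsmul_eq_mul]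

theorem coeffNorm_jones (hp : D.pieces = 1) (hn : 0 < D.n) : coeffNorm D.jones = D.det := by
  have hinj : Function.Injective fun k : ℤ => -(k : ℚ) / 4 := fun a b hab => by
    have : (a : ℚ) = b := by simp only at hab; linarith
    exact_mod_cast this
  have hb : coeffNorm D.bracket = D.det := by
    rw [h.bracket_eq_rankSum hp hn, (isAlternatingFrom_rankSum _ D.isRank_crossingRank).2,
      h.det_eq_card hn, rankSum, Finset.powerset_univ, Finset.card_filter]
    congr 1
    refine Finset.sum_bij' (fun F _ x => decide (x ∈ F))
      (fun σ _ => Finset.univ.filter fun x => σ x = true)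
      (by simp) (by simp) (by simp) (by simp) fun F _ => ?_
    -- At `d = 0` the summand is `0 ^ (L - 1)`, the indicator of `L = 1`. Positivity of `L` is
    -- needed because the subtraction truncates.
    rw [← h.loops_eq_crossingRank hp hn, one_pow, one_pow, one_mul, one_mul, zero_pow_eq]
    have := loops_pos hn fun x => decide (x ∈ F)
    congr 1
    exact propext ⟨fun _ => by omega, fun _ => by omega⟩
  rw [jones, coeffNorm_mapDomain hinj]
  rcases Int.isUnit_iff.1 D.writhe.negOnePow.isUnit with h1 | h1 <;> rw [h1]
  · rw [one_smul, coeffNorm_T_mul, hb]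
  · rw [neg_one_smul, coeffNorm_neg, coeffNorm_T_mul, hb]

end IsFullyAlternating

end LinkDiagram

/-! ### The span of the Jones polynomial -/

/-- All exponents lie in `[-B, B]`. -/
def IsBoundedBy (B : ℤ) (x : ℤ[T;T⁻¹]) : Prop := ∀ k, x.coeff k ≠ 0 → |k| ≤ B

namespace IsBoundedBy

variable {B B' : ℤ} {x y : ℤ[T;T⁻¹]}

theorem mono (h : IsBoundedBy B x) (hB : B ≤ B') : IsBoundedBy B' x := fun k hk => (h k hk).trans hB

theorem add (hx : IsBoundedBy B x) (hy : IsBoundedBy B y) : IsBoundedBy B (x + y) := by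
  intro k hk
  by_cases h : x.coeff k = 0
  · refine hy k fun h' => hk ?_
    rw [AddMonoidAlgebra.coeff_add, Finsupp.add_apply, h, h', add_zero]
  · exact hx k h

theorem neg (hx : IsBoundedBy B x) : IsBoundedBy B (-x) := fun k hk =>
  hx k fun h' => hk (by rw [AddMonoidAlgebra.coeff_neg, Finsupp.neg_apply, h', neg_zero])

theorem T_mul (hx : IsBoundedBy B x) (i : ℤ) : IsBoundedBy (|i| + B) (T i * x) := fun k hk => by
  rw [coeff_T_mul] at hk
  have := abs_add_le i (k - i)
  rw [add_sub_cancel] at this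
  exact this.trans (add_le_add_right (hx _ hk) _)

theorem sum {ι : Type*} {s : Finset ι} {f : ι → ℤ[T;T⁻¹]} (h : ∀ i ∈ s, IsBoundedBy B (f i)) :
    IsBoundedBy B (∑ i ∈ s, f i) :=
  Finset.sum_induction f (IsBoundedBy B) (fun _ _ => add) (fun k hk => by simp at hk) h

theorem circle_pow (j : ℕ) : IsBoundedBy (2 * j) ((-T 2 - T (-2) : ℤ[T;T⁻¹]) ^ j) := by
  induction j with
  | zero =>
    intro k hk
    rw [pow_zero, ← T_zero, T_apply] at hk
    have : k = 0 := by by_contra h; exact hk (if_neg (Ne.symm h))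
    simp [this]
  | succ j ih =>
    have h : (-T 2 - T (-2) : ℤ[T;T⁻¹]) ^ (j + 1) =
        -(T 2 * (-T 2 - T (-2)) ^ j) + -(T (-2) * (-T 2 - T (-2)) ^ j) := by ring
    rw [h]
    exact ((ih.T_mul 2).neg.mono (by norm_num; linarith)).add
      ((ih.T_mul (-2)).neg.mono (by norm_num; linarith))

end IsBoundedBy

theorem Real.sSup_sub_sInf_mem {S : Set ℝ} {a b : ℝ} (hab : a ≤ b) (hS : S ⊆ Set.Icc a b) :
    sSup S - sInf S ∈ Set.Icc 0 (b - a) := by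
  have h1 : BddBelow S := ⟨a, fun x hx => (hS hx).1⟩
  have h2 : BddAbove S := ⟨b, fun x hx => (hS hx).2⟩
  refine ⟨sub_nonneg.2 (Real.sInf_le_sSup S h1 h2), ?_⟩
  rcases S.eq_empty_or_nonempty with rfl | hne
  · simpa using hab
  · exact sub_le_sub (csSup_le hne fun x hx => (hS hx).2) (le_csInf hne fun x hx => (hS hx).1)

namespace LinkDiagram

theorem isBoundedBy_bracket {D : LinkDiagram} (hp : D.pieces = 1) (hn : 0 < D.n) :
    IsBoundedBy (9 * D.n) D.bracket := by
  refine IsBoundedBy.sum fun σ _ => ?_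
  -- The signs contribute degree at most `n`, and at most `4 n` circles contribute at most `2` each,
  -- whence `9 n`.
  refine ((IsBoundedBy.circle_pow _).T_mul _).mono ?_
  have h1 : |∑ x, if σ x then (1 : ℤ) else -1| ≤ D.n := by
    refine (Finset.abs_sum_le_sum_abs _ _).trans ?_
    have : ∀ x, |if σ x then (1 : ℤ) else -1| = 1 := fun x => by split_ifs <;> simp
    simp [this]
  have h2 : D.loops σ ≤ 4 * D.n := by
    rw [loops_eq]
    refine (classCount_le _).trans ?_
    have := Nat.card_le_card_of_surjective (fun p : Fin D.n × Bool × Bool => D.ends p.1 p.2.1 p.2.2)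
      fun e => by
        obtain ⟨x, s, o, rfl⟩ := exists_ends_eq hp hn e
        exact ⟨(x, s, o), rfl⟩
    simp only [Nat.card_eq_fintype_card, Fintype.card_prod, Fintype.card_fin,
      Fintype.card_bool] at this ⊢
    omega
  have h3 := loops_pos hn σ
  rw [Nat.cast_sub (by omega)]
  push_cast
  omega

theorem jonesSpan_mem {D : LinkDiagram} (hp : D.pieces = 1) (hn : 0 < D.n) :
    D.jonesSpan ∈ Set.Icc (0 : ℝ) (5 * D.n) := by
  have hn' : (0 : ℝ) < D.n := Nat.cast_pos.2 hn
  -- In the variable `A` the degrees fill an interval of length at most `18 n`. Since `t = A⁻⁴`, the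
  -- span is at most `18 n / 4`, which is below `5 n`.
  refine Set.Icc_subset_Icc_right ?_ (Real.sSup_sub_sInf_mem (a := (3 * D.writhe - 9 * D.n) / 4)
    (b := (3 * D.writhe + 9 * D.n) / 4) (by linarith) ?_)
  · linarith
  · rintro _ ⟨q, hq, rfl⟩
    classical
    have h1 := Finsupp.mapDomain_support (Finset.mem_coe.1 hq)
    obtain ⟨k, hk, rfl⟩ := Finset.mem_image.1 h1
    have h2 : D.bracket.coeff (k + 3 * D.writhe) ≠ 0 := by
      intro h0
      refine Finsupp.mem_support_iff.1 hk ?_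
      rw [AddMonoidAlgebra.coeff_smul, Finsupp.smul_apply, coeff_T_mul,
        show k - -3 * D.writhe = k + 3 * D.writhe by ring, h0, smul_zero]
    have h3 := abs_le.1 (isBoundedBy_bracket hp hn _ h2)
    have h4 : (-(9 * D.n) : ℝ) ≤ k + 3 * D.writhe := by exact_mod_cast h3.1
    have h5 : (k + 3 * D.writhe : ℝ) ≤ 9 * D.n := by exact_mod_cast h3.2
    push_cast
    constructor <;> linarith

theorem mu_eq_div (D : LinkDiagram) : D.mu = coeffNorm D.jones / (D.jonesSpan + 1) := by
  rw [mu, coeffNorm, one_div, inv_mul_eq_div]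
  push_cast
  rfl

/-- For a non-split alternating link, the average coefficient is the determinant up to a factor
that is linear in the crossing number. -/
theorem exists_mu_eq_det_div {D : LinkDiagram} (hs : D.IsNonsplit) (ha : D.IsAlternatingLink)
    (hc : 0 < D.crossingNumber) :
    ∃ d ∈ Set.Icc (0 : ℝ) (5 * D.crossingNumber), D.mu = D.det / (d + 1) := by
  -- Two diagrams are used: the minimal diagram `D'` bounds the span, and the alternating diagram
  -- `A` evaluates the coefficient sum. Non-splitness makes both connected.
  obtain ⟨D', hD', hn'⟩ : ∃ D', D.SameLink D' ∧ D'.n = D.crossingNumber :=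
    Nat.sInf_mem (s := {k | ∃ D' : LinkDiagram, D.SameLink D' ∧ D'.n = k})
      ⟨D.n, D, Relation.EqvGen.refl _, rfl⟩
  obtain ⟨A, hA, hAalt⟩ := ha
  have hAn : D.crossingNumber ≤ A.n := Nat.sInf_le ⟨A, hA, rfl⟩
  have hA' := (isFullyAlternating hAalt (hs A hA) (hc.trans_le hAn)).coeffNorm_jones (hs A hA)
    (hc.trans_le hAn)
  refine ⟨D'.jonesSpan, hn' ▸ jonesSpan_mem (hs D' hD') (hn' ▸ hc), ?_⟩
  rw [mu_of_sameLink hD', mu_eq_div, ← jones_of_sameLink hD', jones_of_sameLink hA, hA',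
    det_of_sameLink hA]
  simp

end LinkDiagram

/-! ### Passage to the limit -/

theorem abs_log_div_sub_log_le {a d c : ℝ} (hd : 0 ≤ d) (hdc : d ≤ c) :
    |Real.log (a / (d + 1)) - Real.log a| ≤ Real.log (c + 1) := by
  have h0 : 0 ≤ Real.log (c + 1) := Real.log_nonneg (by linarith)
  -- Here both logarithms are `Real.log 0 = 0`, so a vanishing determinant needs no exclusion.
  by_cases ha : a = 0
  · simpa [ha] using h0
  · rw [Real.log_div ha (by linarith), sub_sub_cancel_left, abs_neg,
      abs_of_nonneg (Real.log_nonneg (by linarith))]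
    exact Real.log_le_log (by linarith) (by linarith)

theorem tendsto_log_mul_add_one_div : Tendsto (fun x : ℝ => Real.log (5 * x + 1) / x) atTop (𝓝 0) := by
  -- The constants are chosen so that `y / 5 - 1 / 5 = x` for `y = 5 x + 1`.
  have h1 := Real.tendsto_pow_log_div_mul_add_atTop (1 / 5) (-1 / 5) 1 (by norm_num)
  have h2 : Tendsto (fun x : ℝ => 5 * x + 1) atTop atTop :=
    tendsto_atTop_add_const_right _ _ (tendsto_id.const_mul_atTop (by norm_num))
  refine (h1.comp h2).congr fun x => ?_
  simp only [Function.comp_apply, pow_one]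
  congr 1
  ring

theorem mainTheorem12 (K : ℕ → LinkDiagram)
    (hsplit : ∀ n, (K n).IsNonsplit)
    (halt : ∀ n, (K n).IsAlternatingLink)
    (hmax : IsDiagrammaticallyMaximal K) :
    Tendsto (fun n => 2 * Real.pi * Real.log (K n).mu / ((K n).crossingNumber : ℝ))
      atTop (𝓝 v8) := by
  obtain ⟨hc, hdet⟩ := hmax
  have herr : Tendsto (fun n => 2 * Real.pi *
      (Real.log (5 * ((K n).crossingNumber : ℝ) + 1) / ((K n).crossingNumber : ℝ))) atTop (𝓝 0) := by
    rw [← mul_zero (2 * Real.pi)]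
    exact (tendsto_log_mul_add_one_div.comp
      (tendsto_natCast_atTop_atTop.comp hc)).const_mul (2 * Real.pi)
  have hdiff : Tendsto (fun n => 2 * Real.pi * Real.log (K n).mu / ((K n).crossingNumber : ℝ) -
      2 * Real.pi * Real.log ((K n).det : ℝ) / ((K n).crossingNumber : ℝ)) atTop (𝓝 0) := by
    refine squeeze_zero_norm' ?_ herr
    -- The crossing numbers tend to infinity, so they are eventually positive, as
    -- `exists_mu_eq_det_div` requires.
    filter_upwards [hc.eventually_gt_atTop 0] with n hn
    obtain ⟨d, hd, hmu⟩ := LinkDiagram.exists_mu_eq_det_div (hsplit n) (halt n) hn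
    have hle := abs_log_div_sub_log_le (a := (K n).det) hd.1 hd.2
    rw [hmu, ← sub_div, ← mul_sub, mul_div_assoc, Real.norm_eq_abs, abs_mul, abs_div,
      abs_of_pos (Real.two_pi_pos), Nat.abs_cast]
    gcongr
  simpa using hdiff.add hdet
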